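/- Let $d \ge 1$. Fourier transforms are normalised by $\hat\rho(\omega) = \int_{\mathbb{R}^d} e^{-i\omega\cdot x}\rho(x)\,dx$ and $\mathfrak{K}(x) = \int_{\mathbb{R}^d} e^{i\omega\cdot x}\hat{\mathfrak{K}}(\omega)\,d\omega$. Let $\rho:\mathbb{R}^d\to\mathbb{R}$ and $\mathfrak{K}:\mathbb{R}^d\to\mathbb{R}$ satisfy the following assumptions. (A1) $\rho \in C_c^\infty(\mathbb{R}^d)$ and $\int\rho = 1$. (A2) $\partial^{j}\hat\rho(0)=0$ for every multi-index $j$ with $1\le |j|\le d-1$, and $|\hat\rho|$ has a local maximum at $0$. (K1) $\mathfrak{K}$ is positive definite and radial, and $\mathfrak{K}(0)=1$. (K2) $\mathfrak{K}\in C^\infty(\mathbb{R}^d)$ and $|\mathfrak{K}(x)|\le C(1+|x|)^{-a}$ for some $C,a>0$ and all $x$. (K3) $\hat{\mathfrak{K}}$ is (given by) an integrable function supported in the unit ball, and there are constants $c_1,c_2>0$ such that $c_1|\omega|^d \le \int_{|\xi|\le|\omega|}\hat{\mathfrak{K}}(\xi)\,d\xi\le c_2|\omega|^d$ for all $|\omega|<1$.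 Let $\bar{\mathfrak{K}}$ be the (unique) continuous positive definite function with $\bar{\mathfrak{K}}*\bar{\mathfrak{K}}=\mathfrak{K}$, let $\xi$ be a space-time white noise on $\mathbb{R}^d\times(0,\infty)$, and let $$X^\star(\cdot)=\int_{\mathbb{R}^d}\int_0^\infty \bar{\mathfrak{K}}(e^r(y-\cdot))\,e^{dr/2}\,\xi(dy,dr),\qquad X^\star_t(\cdot)=\int_{\mathbb{R}^d}\int_0^t \bar{\mathfrak{K}}(e^r(y-\cdot))\,e^{dr/2}\,\xi(dy,dr)\quad(t\ge0)$$ be the associated $\star$-scale invariant field (a random distribution) and its martingale approximation. Let $\mathcal{F}_t=\sigma(X^\star_s: s\in[0,t))$ and $\mathcal{F}_\infty=\sigma(\bigcup_{t\ge 0}\mathcal{F}_t)$. For $\varepsilon>0$ let $\rho_\varepsilon=\varepsilon^{-d}\rho(\varepsilon^{-1}\cdot)$ and $X^\star_{(\varepsilon)}=\rho_\varepsilon*X^\star$. Then there exist a constant $\mathfrak{a}\in(0,1)$, depending only on $\rho$ and $\mathfrak{K}$, and, on a suitable extension of the probability space, a smooth, stationary, centred Gaussian field $W$ on $\mathbb{R}^d$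 that is independent of $\mathcal{F}_\infty$ and satisfies $\mathbb{E}[W(x)W(y)]\to0$ as $|x-y|\to\infty$, together with smooth, stationary, centred Gaussian fields $Z_{t}$ on $\mathbb{R}^d$, $t>0$, such that, with $t_\varepsilon=\log(\mathfrak{a}\varepsilon^{-1})$ and $W_{t_\varepsilon}(\cdot)=W(e^{t_\varepsilon}\cdot)$, the following holds. For each fixed $\varepsilon\in(0,\mathfrak{a})$ the three fields $X^\star_{t_\varepsilon}$, $W_{t_\varepsilon}$, $Z_{t_\varepsilon}$ are mutually independent and $$\bigl(X^\star_{(\varepsilon)}(x)\bigr)_{x\in\mathbb{R}^d}\ \overset{\mathrm{law}}{=}\ \bigl(X^\star_{t_\varepsilon}(x)+W_{t_\varepsilon}(x)+Z_{t_\varepsilon}(x)\bigr)_{x\in\mathbb{R}^d}.$$ Moreover, for every $x\in\mathbb{R}^d$, $\mathbb{E}[Z_{t_\varepsilon}(x)^2]\to0$ as $\varepsilon\to0$. -/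

import Mathlib

open MeasureTheory ProbabilityTheory Filter Set
open scoped Topology ContDiff

universe u

/-- Euclidean space of dimension `d`. -/
abbrev Rd (d : ℕ) : Type := EuclideanSpace ℝ (Fin d)

/-! ### Assumptions on the mollifier -/

section Mollifier

variable {d : ℕ}

/-- The Fourier transform `w ↦ ∫ exp(-i w·x) ρ(x) dx` of a real function. -/
noncomputable def fourierHat (ρ : Rd d → ℝ) (w : Rd d) : ℂ :=
  ∫ x, Complex.exp (-(Complex.I * ((inner ℝ w x : ℝ) : ℂ))) * (ρ x : ℂ)

/-- (A1): `ρ` is smooth, compactly supported and has unit mass. -/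
structure AssumptionA1 (ρ : Rd d → ℝ) : Prop where
  smooth : ContDiff ℝ ∞ ρ
  compactSupport : HasCompactSupport ρ
  unitMass : ∫ x, ρ x = 1

/-- (A2): all partial derivatives of `ρ̂` of orders `1, …, d - 1` vanish at the origin, and `|ρ̂|`
has a local maximum there. The partial derivative along the coordinates `j 0, …, j (k - 1)` is the
`k`-th derivative evaluated at the corresponding basis vectors. -/
structure AssumptionA2 (ρ : Rd d → ℝ) : Prop where
  derivZero : ∀ k : ℕ, 1 ≤ k → k < d → ∀ j : Fin k → Fin d,
    iteratedFDeriv ℝ k (fourierHat ρ) 0 (fun i => EuclideanSpace.single (j i) (1 : ℝ)) = 0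
  localMax : IsLocalMax (fun w => ‖fourierHat ρ w‖) 0

/-- The rescaled mollifier `ρ_ε = ε^{-d} ρ(ε^{-1} ·)`. -/
noncomputable def rescale (ρ : Rd d → ℝ) (ε : ℝ) (x : Rd d) : ℝ :=
  (ε ^ d)⁻¹ * ρ (ε⁻¹ • x)

end Mollifier

/-! ### Assumptions on the seed covariance -/

section Seed

variable {d : ℕ}

/-- `f` is a positive definite function: all matrices `(f (x i - x j))` are symmetric and positive
semidefinite. -/
def IsPositiveDefiniteFunction (f : Rd d → ℝ) : Prop :=
  ∀ (n : ℕ) (x : Fin n → Rd d), (Matrix.of fun i j => f (x i - x j)).PosSemidef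

/-- (K1): positive definite, radial, equal to `1` at the origin. -/
structure AssumptionK1 (K : Rd d → ℝ) : Prop where
  posDef : IsPositiveDefiniteFunction K
  radial : ∀ x y : Rd d, ‖x‖ = ‖y‖ → K x = K y
  one : K 0 = 1

/-- (K2): smooth with polynomial decay of some positive order. -/
structure AssumptionK2 (K : Rd d → ℝ) : Prop where
  smooth : ContDiff ℝ ∞ K
  decay : ∃ C > 0, ∃ a > 0, ∀ x : Rd d, |K x| ≤ C * (1 + ‖x‖) ^ (-a : ℝ)

/-- `Khat` is the Fourier transform of `K`, normalised such that
`K(x) = ∫ exp(i w·x) Khat(w) dw`. The function `K` need not be integrable, hence the Fourier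
transform is characterised by this inversion formula, which determines `Khat` almost
everywhere. -/
def IsFourierTransformOf (Khat K : Rd d → ℝ) : Prop :=
  Integrable Khat ∧
    ∀ x, (K x : ℂ) = ∫ w, Complex.exp (Complex.I * ((inner ℝ w x : ℝ) : ℂ)) * (Khat w : ℂ)

/-- (K3): the Fourier transform of `K` is supported in the unit ball, and its mass in the ball of
radius `|w| < 1` is comparable to `|w|^d`. -/
def AssumptionK3 (K : Rd d → ℝ) : Prop :=
  ∃ Khat : Rd d → ℝ, IsFourierTransformOf Khat K ∧
    (∀ w, 1 < ‖w‖ → Khat w = 0) ∧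
    ∃ c > 0, ∃ C > 0, ∀ w : Rd d, ‖w‖ < 1 →
      c * ‖w‖ ^ d ≤ ∫ η in Metric.closedBall (0 : Rd d) ‖w‖, Khat η ∧
      ∫ η in Metric.closedBall (0 : Rd d) ‖w‖, Khat η ≤ C * ‖w‖ ^ d

/-- `Kb` is the (continuous) positive definite function whose convolution with itself is `K`. -/
structure IsConvolutionRoot (Kb K : Rd d → ℝ) : Prop where
  continuous : Continuous Kb
  posDef : IsPositiveDefiniteFunction Kb
  conv : convolution Kb Kb (ContinuousLinearMap.mul ℝ ℝ) volume = K

end Seed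

/-! ### White noise -/

section WhiteNoise

variable {Ω : Type*} [MeasurableSpace Ω] {S : Type*} [MeasurableSpace S] {μ : Measure S}

/-- `ξ` is a (real Gaussian) white noise with control measure `μ`, i.e. the isonormal Gaussian
process over `L²(μ)`. -/
structure IsWhiteNoise (ξ : Lp ℝ 2 μ → Ω → ℝ) (P : Measure Ω) : Prop where
  measurable : ∀ f, Measurable (ξ f)
  gaussian : IsGaussianProcess ξ P
  centred : ∀ f, ∫ w, ξ f w ∂P = 0
  covariance : ∀ f g, ∫ w, ξ f w * ξ g w ∂P = inner ℝ f g

open Classical in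
/-- The integral `∫ f dξ` of a square integrable function against a white noise (and `0` if `f`
is not square integrable, which never happens for the integrands used below). -/
noncomputable def wienerIntegral (ξ : Lp ℝ 2 μ → Ω → ℝ) (f : S → ℝ) : Ω → ℝ :=
  if h : MemLp f 2 μ then ξ (h.toLp f) else 0

end WhiteNoise

/-- Lebesgue measure on `ℝ^d × (0, ∞)`, viewed as a measure on `ℝ^d × ℝ`. -/
noncomputable def spaceTime (d : ℕ) : Measure (Rd d × ℝ) :=
  (volume : Measure (Rd d)).prod ((volume : Measure ℝ).restrict (Ioi 0))

/-! ### The `⋆`-scale invariant field and its approximations -/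

section StarField

variable {d : ℕ} {Ω : Type*}

/-- The integrand `(y, r) ↦ Kb(e^r (y - x)) e^{dr/2}`. -/
noncomputable def starKernel (Kb : Rd d → ℝ) (x : Rd d) (p : Rd d × ℝ) : ℝ :=
  Kb (Real.exp p.2 • (p.1 - x)) * Real.exp (d * p.2 / 2)

/-- The martingale approximation
`X_t(x) = ∫_{ℝ^d} ∫_0^t Kb(e^r (y - x)) e^{dr/2} ξ(dy, dr)`. -/
noncomputable def martingaleApprox (Kb : Rd d → ℝ) (ξ : Lp ℝ 2 (spaceTime d) → Ω → ℝ)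
    (t : ℝ) (x : Rd d) : Ω → ℝ :=
  wienerIntegral ξ ({p : Rd d × ℝ | p.2 < t}.indicator (starKernel Kb x))

/-- The `⋆`-scale invariant field `X`, a random distribution, paired with a test function `φ`:
`X(φ) = ∫_{ℝ^d} ∫_0^∞ (∫ φ(z) Kb(e^r (y - z)) e^{dr/2} dz) ξ(dy, dr)`. -/
noncomputable def starField (Kb : Rd d → ℝ) (ξ : Lp ℝ 2 (spaceTime d) → Ω → ℝ)
    (φ : Rd d → ℝ) : Ω → ℝ :=
  wienerIntegral ξ (fun p => ∫ z, φ z * starKernel Kb z p)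

/-- The convolution approximation `(ρ_ε * X)(x) = X(ρ_ε(x - ·))`. -/
noncomputable def convApprox (ρ Kb : Rd d → ℝ) (ξ : Lp ℝ 2 (spaceTime d) → Ω → ℝ)
    (ε : ℝ) (x : Rd d) : Ω → ℝ :=
  starField Kb ξ (fun z => rescale ρ ε (x - z))

/-- The `σ`-algebra on `Ω` generated by a field `(Y x)`. -/
@[reducible] def fieldSigma (Y : Rd d → Ω → ℝ) : MeasurableSpace Ω :=
  MeasurableSpace.comap (fun w x => Y x w) MeasurableSpace.pi

/-- `ℱ_t = σ(X_s : s ∈ [0, t))`. -/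
@[reducible] noncomputable def starFiltration (Kb : Rd d → ℝ) (ξ : Lp ℝ 2 (spaceTime d) → Ω → ℝ) (t : ℝ) :
    MeasurableSpace Ω :=
  ⨆ s ∈ Ico (0 : ℝ) t, fieldSigma (martingaleApprox Kb ξ s)

/-- `ℱ_∞`, generated by all the `ℱ_t` with `t ≥ 0`. -/
@[reducible] noncomputable def starFiltrationTop (Kb : Rd d → ℝ) (ξ : Lp ℝ 2 (spaceTime d) → Ω → ℝ) : MeasurableSpace Ω :=
  ⨆ t ∈ Ici (0 : ℝ), starFiltration Kb ξ t

end StarField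

/-! ### Gaussian fields -/

section GaussianFields

variable {d : ℕ} {Ω : Type*} [MeasurableSpace Ω]

/-- A smooth, stationary, centred Gaussian field on `ℝ^d`. -/
structure IsSmoothStationaryGaussianField (Y : Rd d → Ω → ℝ) (P : Measure Ω) : Prop where
  measurable : ∀ x, Measurable (Y x)
  gaussian : IsGaussianProcess Y P
  centred : ∀ x, ∫ w, Y x w ∂P = 0
  smooth : ∀ w, ContDiff ℝ ∞ (fun x => Y x w)
  stationary : ∀ v : Rd d, IdentDistrib (fun w x => Y (x + v) w) (fun w x => Y x w) P P

/-- `E[Y(x) Y(y)] → 0` as `|x - y| → ∞`. -/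
def HasDecayingCorrelations (Y : Rd d → Ω → ℝ) (P : Measure Ω) : Prop :=
  Tendsto (fun p : Rd d × Rd d => ∫ w, Y p.1 w * Y p.2 w ∂P)
    (comap (fun p : Rd d × Rd d => ‖p.1 - p.2‖) atTop) (𝓝 0)

end GaussianFields

/-! ### Centred Gaussian processes with prescribed covariance -/

section CentredGaussian

variable {T Ω Ω' : Type*} [MeasurableSpace Ω] [MeasurableSpace Ω']

/-! All fields are centred, Gaussian and stationary, so the claimed equality in law is an identity
between covariances (`IsCentredGaussian.identDistrib`), hence between spectral densities. The
convolution root makes the Fourier transform of `K` nonnegative by Plancherel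
(`IsConvolutionRoot.fourier_nonneg`). Radiality of `K` makes it a function `k(|w|)`
(`exists_radial_of_radial_transform`). Put `m(R) = ∫_0^R y^{d-1} k(y) dy`. This is a constant `σ`
for `R ≥ 1`, and is comparable to `R^d` below.

Integrating `K(e^r ·)` over the scales `r > 0` gives the spectral density `R^{-d} m(R)` with `R =
|w|`. Integrating over `0 < r < t` gives `R^{-d} (m(R) - m(e^{-t} R))`. Let `g(w) = |ρ̂(a w)|²` and
`s = e^{-t} = ε/a`, so that mollification at scale `ε` multiplies the density by `g(s w)`. The
theorem is then the identity (`density_decomposition`) `m(R) g(sw) = [m(R) - m(sR)] + [σ (g(sw) - 1)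
+ m(sR)] + (σ - m(R)) (1 - g(sw))`. The first term is the martingale approximation. The second, up
to the factor `R^{-d}`, depends on `w` only through `sw`, so it is the density of a single field `W`
dilated by `e^t`. The third belongs to the error `Z`.

The last two terms must be nonnegative to be spectral densities. By (A2), `g ≤ 1` near the origin
and `1 - g(w)` is at most a constant times `(a|w|)^d`. For small `a` this is dominated by the lower
bound `m(R) ≥ const · R^d` from (K3), which makes the second term nonnegative for `|w| < 1`. For
`|w| ≥ 1` it reduces to `σ g`. The third term lives in the unit ball, and its density is there at
most a constant times `s^d`, so the variance of `Z` vanishes as `ε → 0`.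

It remains to realise these densities by fields with smooth paths (`exists_smooth_field`). Both are
divisible by `|p̂|²` for the test function `p = (1 - Δ) ρ_a`, with integrable quotient. A rough
field with the quotient as density is built as a Hilbert–Schmidt image of an isonormal process and
then convolved with `p`. Placing `W` and `Z` on separate factors of a product extension gives the
independence. -/

/-- `Y` is a centred Gaussian process with covariance function `C`. -/
structure IsCentredGaussian (Y : T → Ω → ℝ) (C : T → T → ℝ) (P : Measure Ω) : Prop where
  gaussian : IsGaussianProcess Y P
  centred : ∀ t, ∫ w, Y t w ∂P = 0
  covariance : ∀ s t, ∫ w, Y s w * Y t w ∂P = C s t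

lemma IsCentredGaussian.comp_right {S : Type*} {Y : T → Ω → ℝ} {C : T → T → ℝ} {P : Measure Ω}
    (hY : IsCentredGaussian Y C P) (f : S → T) :
    IsCentredGaussian (fun s => Y (f s)) (fun s t => C (f s) (f t)) P where
  gaussian := hY.gaussian.comp_right f
  centred s := hY.centred (f s)
  covariance s t := hY.covariance (f s) (f t)

lemma IsCentredGaussian.memLp {Y : T → Ω → ℝ} {C : T → T → ℝ} {P : Measure Ω}
    (hY : IsCentredGaussian Y C P) (t : T) : MemLp (Y t) 2 P :=
  (hY.gaussian.hasGaussianLaw_eval t).memLp_two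

lemma IsCentredGaussian.integral_dual {Y : T → Ω → ℝ} {C : T → T → ℝ} {P : Measure Ω}
    (hY : IsCentredGaussian Y C P) (I : Finset T) (L : StrongDual ℝ (I → ℝ)) :
    ∫ w, L (I.restrict (Y · w)) ∂P = 0 := by
  classical
  have h : ∀ w, L (I.restrict (Y · w)) = ∑ i : I, Y i w * L (Pi.single i 1) := by
    intro w
    conv_lhs => rw [pi_eq_sum_univ' (I.restrict (Y · w)), map_sum]
    refine Finset.sum_congr rfl fun i _ => ?_
    rw [map_smul, smul_eq_mul]
    congr 2
  have := hY.gaussian.isProbabilityMeasure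
  simp_rw [h]
  rw [integral_finsetSum _ fun (i : I) _ => ((hY.memLp i).integrable one_le_two).mul_const _]
  simp [integral_mul_const, hY.centred]

lemma IsCentredGaussian.variance_dual {Y : T → Ω → ℝ} {C : T → T → ℝ} {P : Measure Ω}
    [DecidableEq T] (hY : IsCentredGaussian Y C P) (I : Finset T) (L : StrongDual ℝ (I → ℝ)) :
    Var[fun w => L (I.restrict (Y · w)); P]
      = ∑ i : I, ∑ j : I, L (Pi.single i 1) * L (Pi.single j 1) * C i j := by
  have := hY.gaussian.isProbabilityMeasure
  have h : ∀ w, L (I.restrict (Y · w)) = ∑ i : I, Y i w * L (Pi.single i 1) := by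
    intro w
    conv_lhs => rw [pi_eq_sum_univ' (I.restrict (Y · w)), map_sum]
    refine Finset.sum_congr rfl fun i _ => ?_
    rw [map_smul, smul_eq_mul]
    congr 2
  have hm : AEMeasurable (fun w => L (I.restrict (Y · w))) P :=
    L.continuous.measurable.comp_aemeasurable (hY.gaussian.hasGaussianLaw I).aemeasurable
  rw [variance_of_integral_eq_zero hm (hY.integral_dual I L)]
  have h2 : ∀ w, L (I.restrict (Y · w)) ^ 2
      = ∑ i : I, ∑ j : I, L (Pi.single i 1) * L (Pi.single j 1) * (Y i w * Y j w) := by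
    intro w
    rw [h w, sq, Finset.sum_mul_sum]
    refine Finset.sum_congr rfl fun i _ => Finset.sum_congr rfl fun j _ => by ring
  simp_rw [h2]
  have hint : ∀ i j : I, Integrable (fun w => L (Pi.single i 1) * L (Pi.single j 1)
      * (Y i w * Y j w)) P := fun i j =>
    ((hY.memLp i).integrable_mul (hY.memLp j)).const_mul _
  rw [integral_finsetSum _ fun i _ => integrable_finsetSum _ fun j _ => hint i j]
  refine Finset.sum_congr rfl fun i _ => ?_
  rw [integral_finsetSum _ fun j _ => hint i j]
  refine Finset.sum_congr rfl fun j _ => ?_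
  rw [integral_const_mul, hY.covariance]

/-- Two centred Gaussian processes with the same covariance have the same law. -/
lemma IsCentredGaussian.identDistrib {Y : T → Ω → ℝ} {Z : T → Ω' → ℝ} {C : T → T → ℝ}
    {P : Measure Ω} {P' : Measure Ω'} (hY : IsCentredGaussian Y C P)
    (hZ : IsCentredGaussian Z C P') (mY : ∀ t, Measurable (Y t)) (mZ : ∀ t, Measurable (Z t)) :
    IdentDistrib (fun w t => Y t w) (fun w t => Z t w) P P' := by
  classical
  have := hY.gaussian.isProbabilityMeasure
  have := hZ.gaussian.isProbabilityMeasure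
  have mY' : AEMeasurable (fun w t => Y t w) P := (measurable_pi_lambda _ mY).aemeasurable
  have mZ' : AEMeasurable (fun w t => Z t w) P' := (measurable_pi_lambda _ mZ).aemeasurable
  refine ⟨mY', mZ', ?_⟩
  have hl := isProjectiveLimit_map mY'
  have hr := isProjectiveLimit_map mZ'
  -- A Gaussian law on `ℝ^I` is determined by the mean and variance of every linear functional,
  -- through its characteristic function. The finite-dimensional laws then determine the law on the
  -- product `σ`-algebra.
  have key : (fun I : Finset T => P.map (fun w => I.restrict (Y · w)))
      = fun I : Finset T => P'.map (fun w => I.restrict (Z · w)) := by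
    funext I
    have := (hY.gaussian.hasGaussianLaw I).isGaussian_map
    have := (hZ.gaussian.hasGaussianLaw I).isGaussian_map
    apply Measure.ext_of_charFunDual
    ext L
    rw [(hY.gaussian.hasGaussianLaw I).charFunDual_map_eq_fun,
      (hZ.gaussian.hasGaussianLaw I).charFunDual_map_eq_fun, hY.variance_dual I L,
      hZ.variance_dual I L]
    rw [hY.integral_dual I L, hZ.integral_dual I L]
  rw [key] at hl
  exact hl.unique hr

lemma IsCentredGaussian.measurePreserving {Y : T → Ω → ℝ} {C : T → T → ℝ}
    {P : Measure Ω} {P' : Measure Ω'} (hY : IsCentredGaussian Y C P) {f : Ω' → Ω}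
    (hf : MeasurePreserving f P' P) : IsCentredGaussian (fun t w => Y t (f w)) C P' where
  gaussian := ⟨fun I => ⟨by
    have := (hY.gaussian.hasGaussianLaw I).isGaussian_map
    have hm := (hY.gaussian.hasGaussianLaw I).aemeasurable
    rw [← hf.map_eq] at this hm
    rw [AEMeasurable.map_map_of_aemeasurable hm hf.measurable.aemeasurable] at this
    exact this⟩⟩
  centred t := by
    have hm := (hY.memLp t).aestronglyMeasurable
    rw [← hf.map_eq] at hm
    rw [← hY.centred t, ← hf.map_eq, integral_map hf.measurable.aemeasurable hm]
  covariance s t := by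
    have hm := ((hY.memLp s).aestronglyMeasurable.mul (hY.memLp t).aestronglyMeasurable)
    rw [← hf.map_eq] at hm
    rw [← hY.covariance s t, ← hf.map_eq]
    exact (integral_map hf.measurable.aemeasurable hm).symm

/-- The sum of three independent centred Gaussian processes. -/
lemma IsCentredGaussian.add_three {X Y Z : T → Ω → ℝ} {C₁ C₂ C₃ : T → T → ℝ} {P : Measure Ω}
    (hX : IsCentredGaussian X C₁ P) (hY : IsCentredGaussian Y C₂ P) (hZ : IsCentredGaussian Z C₃ P)
    (h : iIndepFun (β := fun _ : Fin 3 => T → ℝ)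
      ![fun w t => X t w, fun w t => Y t w, fun w t => Z t w] P) :
    IsCentredGaussian (fun t w => X t w + Y t w + Z t w) (fun s t => C₁ s t + C₂ s t + C₃ s t)
      P := by
  have := hX.gaussian.isProbabilityMeasure
  have hXY : ∀ s t, ∫ w, X s w * Y t w ∂P = 0 := fun s t => by
    have h1 : IndepFun (X s) (Y t) P := (h.indepFun (i := 0) (j := 1) (by decide)).comp
      (measurable_pi_apply s) (measurable_pi_apply t)
    exact (h1.integral_mul_eq_mul_integral (hX.memLp s).1 (hY.memLp t).1).trans
      (by rw [hX.centred, zero_mul])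
  have hXZ : ∀ s t, ∫ w, X s w * Z t w ∂P = 0 := fun s t => by
    have h1 : IndepFun (X s) (Z t) P := (h.indepFun (i := 0) (j := 2) (by decide)).comp
      (measurable_pi_apply s) (measurable_pi_apply t)
    exact (h1.integral_mul_eq_mul_integral (hX.memLp s).1 (hZ.memLp t).1).trans
      (by rw [hX.centred, zero_mul])
  have hYZ : ∀ s t, ∫ w, Y s w * Z t w ∂P = 0 := fun s t => by
    have h1 : IndepFun (Y s) (Z t) P := (h.indepFun (i := 1) (j := 2) (by decide)).comp
      (measurable_pi_apply s) (measurable_pi_apply t)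
    exact (h1.integral_mul_eq_mul_integral (hY.memLp s).1 (hZ.memLp t).1).trans
      (by rw [hY.centred, zero_mul])
  have hadd : ∀ {f g h : Ω → ℝ}, Integrable f P → Integrable g P → Integrable h P →
      ∫ w, (f w + g w + h w) ∂P = ∫ w, f w ∂P + ∫ w, g w ∂P + ∫ w, h w ∂P :=
    fun {f g h} hf hg hh => by
      rw [← integral_add hf hg]
      exact integral_add (hf.add hg) hh
  refine ⟨⟨fun I => ?_⟩, fun t => ?_, fun s t => ?_⟩
  · have h2 := h.comp (γ := fun _ => I → ℝ) (fun _ => I.restrict)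
      (fun _ => Finset.measurable_restrict I)
    have h3 := h2.hasGaussianLaw_fun_sum (E := I → ℝ) (fun i => by
      fin_cases i
      · exact hX.gaussian.hasGaussianLaw I
      · exact hY.gaussian.hasGaussianLaw I
      · exact hZ.gaussian.hasGaussianLaw I)
    simp only [Fin.sum_univ_three] at h3
    exact h3
  · have iX := (hX.memLp t).integrable one_le_two
    have iY := (hY.memLp t).integrable one_le_two
    have iZ := (hZ.memLp t).integrable one_le_two
    rw [hadd iX iY iZ, hX.centred, hY.centred, hZ.centred]
    simp
  · have e : ∀ w, (X s w + Y s w + Z s w) * (X t w + Y t w + Z t w)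
        = X s w * X t w + X s w * Y t w + X s w * Z t w + (X t w * Y s w + Y s w * Y t w
          + Y s w * Z t w) + (X t w * Z s w + Y t w * Z s w + Z s w * Z t w) := fun w => by ring
    simp_rw [e]
    have i1 := (hX.memLp s).integrable_mul (hX.memLp t)
    have i2 := (hX.memLp s).integrable_mul (hY.memLp t)
    have i3 := (hX.memLp s).integrable_mul (hZ.memLp t)
    have i4 := (hX.memLp t).integrable_mul (hY.memLp s)
    have i5 := (hY.memLp s).integrable_mul (hY.memLp t)
    have i6 := (hY.memLp s).integrable_mul (hZ.memLp t)
    have i7 := (hX.memLp t).integrable_mul (hZ.memLp s)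
    have i8 := (hY.memLp t).integrable_mul (hZ.memLp s)
    have i9 := (hZ.memLp s).integrable_mul (hZ.memLp t)
    simp only [Pi.mul_def] at i1 i2 i3 i4 i5 i6 i7 i8 i9
    have h9 := hadd ((i1.add i2).add i3) ((i4.add i5).add i6) ((i7.add i8).add i9)
    simp only [Pi.add_apply] at h9
    rw [h9, hadd i1 i2 i3, hadd i4 i5 i6, hadd i7 i8 i9, hXY, hXZ, hXY, hYZ, hXZ, hYZ,
      hX.covariance, hY.covariance, hZ.covariance]
    ring

end CentredGaussian

/-- A function of each of three independent coordinates. -/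
lemma iIndepFun_prod_three {Ω₁ Ω₂ Ω₃ T : Type*} [MeasurableSpace Ω₁] [MeasurableSpace Ω₂]
    [MeasurableSpace Ω₃] [MeasurableSpace T] (P₁ : Measure Ω₁) (P₂ : Measure Ω₂) (P₃ : Measure Ω₃)
    [IsProbabilityMeasure P₁] [IsProbabilityMeasure P₂] [IsProbabilityMeasure P₃]
    (f : Ω₁ → T) (g : Ω₂ → T) (h : Ω₃ → T) :
    iIndepFun (β := fun _ : Fin 3 => T) ![fun w : Ω₁ × Ω₂ × Ω₃ => f w.1, fun w => g w.2.1,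
      fun w => h w.2.2] (P₁.prod (P₂.prod P₃)) := by
  classical
  rw [iIndepFun_iff_measure_inter_preimage_eq_mul]
  intro S sets hsets
  have key : ∀ s : Fin 3 → Set T, (P₁.prod (P₂.prod P₃)) ({w | f w.1 ∈ s 0} ∩ {w | g w.2.1 ∈ s 1}
      ∩ {w | h w.2.2 ∈ s 2}) = P₁ (f ⁻¹' s 0) * (P₂ (g ⁻¹' s 1) * P₃ (h ⁻¹' s 2)) := by
    intro s
    -- The product formula for rectangles holds for arbitrary sides, so `f`, `g`, `h` need not be
    -- measurable.
    rw [← Measure.prod_prod, ← Measure.prod_prod]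
    congr 1
    ext w
    simp [and_assoc]
  have k0 : ∀ s : Set T, (P₁.prod (P₂.prod P₃)) {w | f w.1 ∈ s} = P₁ (f ⁻¹' s) := fun s => by
    simpa using key ![s, univ, univ]
  have k1 : ∀ s : Set T, (P₁.prod (P₂.prod P₃)) {w | g w.2.1 ∈ s} = P₂ (g ⁻¹' s) := fun s => by
    simpa using key ![univ, s, univ]
  have k2 : ∀ s : Set T, (P₁.prod (P₂.prod P₃)) {w | h w.2.2 ∈ s} = P₃ (h ⁻¹' s) := fun s => by
    simpa using key ![univ, univ, s]
  -- Filling the indices outside `S` with `univ` reduces every subfamily to the full triple.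
  let s' : Fin 3 → Set T := fun i => if i ∈ S then sets i else univ
  have e1 : (⋂ i ∈ S, (![fun w : Ω₁ × Ω₂ × Ω₃ => f w.1, fun w => g w.2.1,
      fun w => h w.2.2] : Fin 3 → Ω₁ × Ω₂ × Ω₃ → T) i ⁻¹' sets i)
      = {w | f w.1 ∈ s' 0} ∩ {w | g w.2.1 ∈ s' 1} ∩ {w | h w.2.2 ∈ s' 2} := by
    ext w
    simp only [mem_iInter, Fin.forall_fin_succ, s']
    by_cases h0 : (0 : Fin 3) ∈ S <;> by_cases h1 : (1 : Fin 3) ∈ S <;>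
      by_cases h2 : (2 : Fin 3) ∈ S <;> simp [h0, h1, h2, and_assoc]
  have e2 : ∏ i ∈ S, (P₁.prod (P₂.prod P₃)) ((![fun w : Ω₁ × Ω₂ × Ω₃ => f w.1, fun w => g w.2.1,
      fun w => h w.2.2] : Fin 3 → Ω₁ × Ω₂ × Ω₃ → T) i ⁻¹' sets i)
      = ∏ i : Fin 3, (P₁.prod (P₂.prod P₃)) ((![fun w : Ω₁ × Ω₂ × Ω₃ => f w.1, fun w => g w.2.1,
      fun w => h w.2.2] : Fin 3 → Ω₁ × Ω₂ × Ω₃ → T) i ⁻¹' s' i) := by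
    rw [← Finset.prod_subset (Finset.subset_univ S)]
    · refine Finset.prod_congr rfl fun i hi => by simp [s', hi]
    · intro i _ hi
      simp [s', hi]
  rw [e1, e2, key, Fin.prod_univ_three]
  simp only [Matrix.cons_val_zero, Matrix.cons_val_one, Matrix.cons_val]
  rw [mul_assoc]
  exact congr_arg₂ _ (k0 _).symm (congr_arg₂ _ (k1 _).symm (k2 _).symm)

/-! ### Isonormal Gaussian processes -/

section Isonormal

lemma integral_cexp_of_hasGaussianLaw {Ω : Type*} [MeasurableSpace Ω] {P : Measure Ω} {X : Ω → ℝ}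
    (hX : HasGaussianLaw X P) (h0 : ∫ w, X w ∂P = 0) :
    ∫ w, Complex.exp (Complex.I * X w) ∂P = Complex.exp (-((∫ w, X w ^ 2 ∂P : ℝ) : ℂ) / 2) := by
  have h1 := hX.charFun_map_eq (t := (1 : ℝ))
  rw [charFun_apply_real, integral_map hX.aemeasurable (by fun_prop)] at h1
  have h2 : Var[X; P] = ∫ w, X w ^ 2 ∂P := variance_of_integral_eq_zero hX.aemeasurable h0
  simp only [Complex.ofReal_one, one_mul] at h1
  rw [show (fun w => Complex.exp (Complex.I * X w)) = fun w => Complex.exp (X w * Complex.I) by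
    ext w; rw [mul_comm], h1]
  simp [h0, h2, neg_div]

lemma norm_cexp_I_mul_sub_le (a b : ℝ) :
    ‖Complex.exp (Complex.I * a) - Complex.exp (Complex.I * b)‖ ≤ |a - b| := by
  have h : Complex.exp (Complex.I * a) - Complex.exp (Complex.I * b)
      = Complex.exp (Complex.I * b) * (Complex.exp (Complex.I * (a - b : ℝ)) - 1) := by
    rw [mul_sub, ← Complex.exp_add, mul_one]
    congr 2
    push_cast
    ring
  rw [h, norm_mul, Complex.norm_exp_I_mul_ofReal, one_mul]
  exact Real.norm_exp_I_mul_ofReal_sub_one_le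

lemma integrable_cexp_I_mul {Ω : Type*} [MeasurableSpace Ω] {P : Measure Ω} [IsFiniteMeasure P]
    {X : Ω → ℝ} (hX : AEStronglyMeasurable X P) :
    Integrable (fun w => Complex.exp (Complex.I * X w)) P := by
  refine Integrable.of_bound (C := 1) ?_ (ae_of_all _ fun w => ?_)
  · exact (by fun_prop : Continuous fun x : ℝ => Complex.exp (Complex.I * x)).comp_aestronglyMeasurable
      hX
  · rw [Complex.norm_exp_I_mul_ofReal]

/-- Since `x ↦ e^{ix}` is 1-Lipschitz and the `L¹` norm is at most the `L²` norm on a probability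
space, the map is 1-Lipschitz. This lets characteristic functions be computed on a dense subspace.
-/
lemma continuous_integral_cexp_Lp {Ω : Type*} [MeasurableSpace Ω] (P : Measure Ω)
    [IsProbabilityMeasure P] :
    Continuous fun f : Lp ℝ 2 P => ∫ w, Complex.exp (Complex.I * f w) ∂P := by
  refine (LipschitzWith.of_dist_le_mul (K := 1) fun f g => ?_).continuous
  rw [dist_eq_norm, dist_eq_norm, ← integral_sub (integrable_cexp_I_mul (Lp.aestronglyMeasurable f))
    (integrable_cexp_I_mul (Lp.aestronglyMeasurable g))]
  have hfg : Integrable (f - g : Lp ℝ 2 P) P := (Lp.memLp (f - g)).integrable one_le_two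
  calc ‖∫ w, (Complex.exp (Complex.I * f w) - Complex.exp (Complex.I * g w)) ∂P‖
      ≤ ∫ w, |(f - g : Lp ℝ 2 P) w| ∂P := by
        refine norm_integral_le_of_norm_le hfg.abs ?_
        filter_upwards [Lp.coeFn_sub f g] with w hw
        rw [hw]
        exact norm_cexp_I_mul_sub_le _ _
    _ = (eLpNorm (f - g : Lp ℝ 2 P) 1 P).toReal := by
        rw [eLpNorm_one_eq_lintegral_enorm, ← integral_norm_eq_lintegral_enorm hfg.1]
        rfl
    _ ≤ (eLpNorm (f - g : Lp ℝ 2 P) 2 P).toReal :=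
        ENNReal.toReal_mono (Lp.eLpNorm_ne_top _)
          (eLpNorm_le_eLpNorm_of_exponent_le one_le_two hfg.1)
    _ = (1 : NNReal) * ‖f - g‖ := by simp [Lp.norm_def]

variable (H : Type) [NormedAddCommGroup H] [InnerProductSpace ℝ H] [CompleteSpace H]

/-- Every real Hilbert space carries an isonormal Gaussian process. -/
theorem exists_gaussian_isometry :
    ∃ (Ω : Type) (_ : MeasurableSpace Ω) (P : Measure Ω) (_ : IsProbabilityMeasure P)
      (I : H →ₗᵢ[ℝ] Lp ℝ 2 P),
      IsCentredGaussian (fun h => (I h : Ω → ℝ)) (fun h h' => inner ℝ h h') P := by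
  classical
  obtain ⟨s, b, -⟩ := exists_hilbertBasis ℝ H
  let P : Measure (s → ℝ) := Measure.infinitePi fun _ => gaussianReal 0 1
  have hlaw : ∀ i : s, P.map (fun w => w i) = gaussianReal 0 1 := fun i =>
    Measure.infinitePi_map_eval (μ := fun _ : s => gaussianReal 0 1) i
  have hgl : ∀ i : s, HasGaussianLaw (fun w : s → ℝ => w i) P := fun i => ⟨by
    rw [hlaw i]; infer_instance⟩
  have hind : iIndepFun (fun (i : s) (w : s → ℝ) => w i) P :=
    iIndepFun_infinitePi (X := fun _ x => x) (fun _ => measurable_id)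
  have hgp : IsGaussianProcess (fun (i : s) (w : s → ℝ) => w i) P := by
    refine ⟨fun I => ?_⟩
    exact iIndepFun.hasGaussianLaw (fun i : I => hgl i) (hind.precomp Subtype.val_injective)
  have hm : ∀ i : s, AEMeasurable (fun w : s → ℝ => w i) P := fun i =>
    (measurable_pi_apply i).aemeasurable
  have hmean : ∀ i : s, ∫ w, w i ∂P = 0 := fun i => by
    have h := integral_map (μ := P) (φ := fun w : s → ℝ => w i) (f := fun x : ℝ => x)
      (hm i) (by fun_prop)
    rw [← h, hlaw i]
    exact integral_id_gaussianReal
  have hsq : ∀ i : s, ∫ w, w i * w i ∂P = 1 := fun i => by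
    have h := variance_of_integral_eq_zero (μ := P) (X := fun w : s → ℝ => w i)
      (hm i) (hmean i)
    have h2 : Var[fun w : s → ℝ => w i; P] = 1 := by
      have h3 := variance_map (μ := P) (X := fun x : ℝ => x) (Y := fun w : s → ℝ => w i)
        (by fun_prop) (hm i)
      rw [hlaw i, variance_fun_id_gaussianReal] at h3
      simpa [Function.comp_def] using h3.symm
    rw [h2] at h
    rw [h]
    simp [sq]
  let g : s → Lp ℝ 2 P := fun i => (hgl i).memLp_two.toLp _
  have hgae : ∀ i, (g i : (s → ℝ) → ℝ) =ᵐ[P] fun w => w i := fun i => MemLp.coeFn_toLp _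
  have hon : Orthonormal ℝ g := by
    rw [orthonormal_iff_ite]
    intro i j
    rw [L2.inner_def]
    have : ∫ w, inner ℝ (g i w) (g j w) ∂P = ∫ w, w i * w j ∂P := by
      refine integral_congr_ae ?_
      filter_upwards [hgae i, hgae j] with w h1 h2
      rw [h1, h2]
      simp [mul_comm]
    rw [this]
    split_ifs with hij
    · subst hij; exact hsq i
    · have := (hind.indepFun hij).integral_mul_eq_mul_integral (hm i).aestronglyMeasurable
        (hm j).aestronglyMeasurable
      rw [hmean, zero_mul] at this
      exact this
  -- The isometry sends the basis vectors to independent standard normal coordinates.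
  let I : H →ₗᵢ[ℝ] Lp ℝ 2 P :=
    hon.orthogonalFamily.linearIsometry.comp b.repr.toLinearIsometry
  have hI : ∀ i, I (b i) = g i := by
    intro i
    change hon.orthogonalFamily.linearIsometry (b.repr (b i)) = g i
    rw [b.repr_self, hon.orthogonalFamily.linearIsometry_apply_single]
    simp
  -- Both sides are continuous in `h`. On finite combinations of basis vectors `I h` is a finite
  -- Gaussian sum, so the identity holds there and extends by density.
  have hchar : ∀ h : H, ∫ w, Complex.exp (Complex.I * I h w) ∂P
      = Complex.exp (-((‖h‖ ^ 2 : ℝ) : ℂ) / 2) := by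
    have hd : Dense (Submodule.span ℝ (range b) : Set H) := by
      rw [Submodule.dense_iff_topologicalClosure_eq_top]; exact b.dense_span
    have hc : Continuous fun h : H => Complex.exp (-((‖h‖ ^ 2 : ℝ) : ℂ) / 2) := by fun_prop
    refine congr_fun (Continuous.ext_on hd
      ((continuous_integral_cexp_Lp P).comp I.continuous) hc ?_)
    intro h hh
    obtain ⟨c, rfl⟩ := Finsupp.mem_span_range_iff_exists_finsupp.1 hh
    set h : H := c.sum fun i a => a • b i with hdef
    have hae : (I h : (s → ℝ) → ℝ) =ᵐ[P] fun w => ∑ i ∈ c.support, c i * w i := by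
      have h1 : I h = ∑ i ∈ c.support, c i • g i := by
        rw [hdef, Finsupp.sum, map_sum]
        simp_rw [map_smul, hI]
      rw [h1]
      refine (Lp.coeFn_fun_finsetSum _ _).trans ?_
      have h2 : ∀ᵐ w ∂P, ∀ i ∈ c.support, (c i • g i : Lp ℝ 2 P) w = c i * w i := by
        rw [Filter.eventually_all_finset]
        intro i _
        filter_upwards [Lp.coeFn_smul (c i) (g i), hgae i] with w h3 h4
        rw [h3, Pi.smul_apply, h4, smul_eq_mul]
      filter_upwards [h2] with w hw
      exact Finset.sum_congr rfl hw
    have hG : HasGaussianLaw (I h) P :=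
      ((hgp.smul c).hasGaussianLaw_fun_sum (I := c.support)).congr hae.symm
    have h0 : ∫ w, I h w ∂P = 0 := by
      rw [integral_congr_ae hae, integral_finsetSum _ fun i _ => (hgl i).integrable.const_mul _]
      simp [integral_const_mul, hmean]
    have hn : ∫ w, I h w ^ 2 ∂P = ‖h‖ ^ 2 := by
      rw [← I.norm_map h, ← real_inner_self_eq_norm_sq, L2.inner_def]
      simp [sq]
    exact (integral_cexp_of_hasGaussianLaw hG h0).trans (by rw [hn])
  have hlawI : ∀ h : H, P.map (I h) = gaussianReal 0 (‖h‖₊ ^ 2) := by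
    intro h
    have hm : AEMeasurable (I h) P := (Lp.aestronglyMeasurable (I h)).aemeasurable
    have : IsProbabilityMeasure (P.map (I h)) := Measure.isProbabilityMeasure_map hm
    refine Measure.ext_of_charFun ?_
    ext t
    rw [charFun_apply_real, integral_map hm (by fun_prop), charFun_gaussianReal]
    have h1 := hchar (t • h)
    have hs : (I (t • h) : (s → ℝ) → ℝ) =ᵐ[P] fun w => t * I h w := by
      rw [map_smul]
      filter_upwards [Lp.coeFn_smul t (I h)] with w hw
      rw [hw]; rfl
    calc ∫ w, Complex.exp (t * I h w * Complex.I) ∂P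
        = ∫ w, Complex.exp (Complex.I * I (t • h) w) ∂P := by
          refine integral_congr_ae ?_
          filter_upwards [hs] with w hw
          rw [hw]; push_cast; ring_nf
      _ = _ := by
          rw [h1, norm_smul]
          congr 1
          simp [mul_pow, ← Complex.ofReal_pow]
          ring
  refine ⟨s → ℝ, inferInstance, P, inferInstance, I, ⟨⟨fun S => ⟨?_⟩⟩, fun h => ?_, fun h h' => ?_⟩⟩
  · refine isGaussian_of_map_eq_gaussianReal fun L => ?_
    -- Cramér–Wold: a linear functional of finitely many values of `I` is again a value of `I`, by
    -- linearity, and so is a one-dimensional Gaussian.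
    let h' : H := ∑ x : S, L (Pi.single x 1) • (x : H)
    refine ⟨0, ‖h'‖₊ ^ 2, ?_⟩
    have hm : AEMeasurable (fun w => S.restrict fun h => I h w) P :=
      aemeasurable_pi_lambda _ fun x => (Lp.aestronglyMeasurable (I x)).aemeasurable
    rw [AEMeasurable.map_map_of_aemeasurable (by fun_prop) hm, ← hlawI h']
    refine Measure.map_congr ?_
    have h1 : I h' = ∑ x : S, L (Pi.single x 1) • I x := by
      rw [map_sum]
      simp_rw [map_smul]
    rw [h1]
    have h2 : ∀ᵐ w ∂P, ∀ x : S, (L (Pi.single x 1) • I x : Lp ℝ 2 P) w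
        = L (Pi.single x 1) * I x w := by
      rw [ae_all_iff]
      intro x
      filter_upwards [Lp.coeFn_smul (L (Pi.single x 1)) (I x)] with w h3
      rw [h3]; rfl
    filter_upwards [h2, Lp.coeFn_fun_finsetSum Finset.univ
      fun x : S => L (Pi.single x 1) • I x] with w h3 h4
    rw [h4]
    simp_rw [h3]
    rw [Function.comp_apply, pi_eq_sum_univ' (S.restrict fun h => I h w), map_sum]
    refine Finset.sum_congr rfl fun i _ => ?_
    rw [map_smul, smul_eq_mul, mul_comm]
    rfl
  · have h1 := integral_map (μ := P) (φ := I h) (f := fun x : ℝ => x)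
      (Lp.aestronglyMeasurable (I h)).aemeasurable (by fun_prop)
    rw [← h1, hlawI h]
    exact integral_id_gaussianReal
  · rw [← I.inner_map_map, L2.inner_def]
    exact integral_congr_ae (ae_of_all _ fun w => mul_comm _ _)

end Isonormal

/-! ### Hilbert–Schmidt images of isonormal processes -/

section HilbertSchmidt

/-- Distinct members lie at distance `√2`, so the balls of radius `1/2` around them are disjoint,
open and nonempty. Countability is what lets sums over a basis be treated as measurable limits of
sequences. -/
lemma Orthonormal.countable_of_separable {E ι : Type*} [NormedAddCommGroup E]
    [InnerProductSpace ℝ E] [TopologicalSpace.SeparableSpace E] {v : ι → E}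
    (hv : Orthonormal ℝ v) : Countable ι := by
  have hdist : ∀ i j, i ≠ j → 1 < dist (v i) (v j) := by
    intro i j hij
    have h : dist (v i) (v j) ^ 2 = 2 := by
      rw [dist_eq_norm, norm_sub_sq_real, hv.1 i, hv.1 j, hv.2 hij]
      norm_num
    nlinarith [dist_nonneg (x := v i) (y := v j)]
  have h : (univ : Set ι).Countable := by
    refine PairwiseDisjoint.countable_of_isOpen (s := fun i => Metric.ball (v i) (1 / 2)) ?_
      (fun i _ => Metric.isOpen_ball) (fun i _ => ⟨v i, Metric.mem_ball_self (by norm_num)⟩)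
    intro i _ j _ hij
    exact Metric.ball_disjoint_ball (by linarith [hdist i j hij])
  exact countable_univ_iff.1 h

variable {H E ι Ω : Type*} [NormedAddCommGroup H] [InnerProductSpace ℝ H]
  [NormedAddCommGroup E] [InnerProductSpace ℝ E] [MeasurableSpace Ω]

/-- The image of an isonormal process under the adjoint of a Hilbert–Schmidt operator is a
random vector. -/
theorem exists_randomVector [Countable ι] {P : Measure Ω} [IsProbabilityMeasure P]
    (I : H →ₗᵢ[ℝ] Lp ℝ 2 P) (b : HilbertBasis ι ℝ E) (A : E →L[ℝ] H)
    (hA : Summable fun j => ‖A (b j)‖ ^ 2) :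
    ∃ V : Ω → E, ∀ q, Measurable (fun w => inner ℝ q (V w)) ∧
      (fun w => inner ℝ q (V w)) =ᵐ[P] I (A q) := by
  classical
  let G : ι → Ω → ℝ := fun j => (Lp.aestronglyMeasurable (I (A (b j)))).mk _
  have hGm : ∀ j, Measurable (G j) := fun j =>
    (Lp.aestronglyMeasurable (I (A (b j)))).stronglyMeasurable_mk.measurable
  have hGae : ∀ j, I (A (b j)) =ᵐ[P] G j := fun j => (Lp.aestronglyMeasurable _).ae_eq_mk
  have hGsq : ∀ j, ∫⁻ w, ENNReal.ofReal (G j w ^ 2) ∂P = ENNReal.ofReal (‖A (b j)‖ ^ 2) := by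
    intro j
    have hint : Integrable (fun w => I (A (b j)) w ^ 2) P := (Lp.memLp (I (A (b j)))).integrable_sq
    rw [← I.norm_map (A (b j)), ← real_inner_self_eq_norm_sq, L2.inner_def]
    have : ∀ w, inner ℝ (I (A (b j)) w) (I (A (b j)) w) = I (A (b j)) w ^ 2 := fun w => by
      simp [sq]
    simp_rw [this]
    rw [ofReal_integral_eq_lintegral_ofReal hint (ae_of_all _ fun _ => sq_nonneg _)]
    refine lintegral_congr_ae ?_
    filter_upwards [hGae j] with w hw
    rw [hw]
  -- The expected sum of squares is the squared Hilbert–Schmidt norm of `A`, so this event has full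
  -- measure. Off it the coefficients are set to zero, which makes the random vector defined at
  -- every point.
  let S : Set Ω := {w | ∑' j, ENNReal.ofReal (G j w ^ 2) < ⊤}
  have hSm : MeasurableSet S := by
    refine measurableSet_lt (Measurable.tsum fun j => ?_) measurable_const
    exact ((hGm j).pow_const 2).ennreal_ofReal
  have hS : ∀ᵐ w ∂P, w ∈ S := by
    refine ae_lt_top (Measurable.tsum fun j => ((hGm j).pow_const 2).ennreal_ofReal) ?_
    rw [lintegral_tsum fun j => ((hGm j).pow_const 2).ennreal_ofReal.aemeasurable]
    simp_rw [hGsq]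
    rw [← ENNReal.ofReal_tsum_of_nonneg (fun _ => by positivity) hA]
    exact ENNReal.ofReal_ne_top
  let g : Ω → ι → ℝ := fun w j => if w ∈ S then G j w else 0
  have hgm : ∀ j, Measurable fun w => g w j := fun j =>
    Measurable.ite hSm (hGm j) measurable_const
  have hgae : ∀ j, I (A (b j)) =ᵐ[P] fun w => g w j := fun j => by
    filter_upwards [hGae j, hS] with w h1 h2
    simp [g, h1, h2]
  have hmem : ∀ w, Memℓp (g w) 2 := by
    intro w
    by_cases hw : w ∈ S
    · rw [memℓp_gen_iff (by norm_num)]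
      have h1 : Summable fun j => G j w ^ 2 := by
        have h2 := ENNReal.summable_toReal (ne_of_lt hw)
        simpa [ENNReal.toReal_ofReal (sq_nonneg _)] using h2
      simpa [g, hw] using h1
    · have : g w = 0 := by funext j; simp [g, hw]
      rw [this]
      exact zero_memℓp
  let V : Ω → E := fun w => b.repr.symm ⟨g w, hmem w⟩
  obtain ⟨s, hs⟩ := exists_seq_tendsto (atTop : Filter (Finset ι))
  refine ⟨V, fun q => ?_⟩
  have hV : ∀ w, Tendsto (fun n => ∑ j ∈ s n, inner ℝ q (b j) * g w j) atTop
      (𝓝 (inner ℝ q (V w))) := by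
    intro w
    have h := b.hasSum_inner_mul_inner q (V w)
    have h2 : ∀ j, inner ℝ (b j) (V w) = g w j := fun j => by
      rw [← b.repr_apply_apply, LinearIsometryEquiv.apply_symm_apply]
    simp_rw [h2] at h
    have h3 : Tendsto (fun t : Finset ι => ∑ j ∈ t, inner ℝ q (b j) * g w j) atTop
        (𝓝 (inner ℝ q (V w))) := by simpa [HasSum] using h
    exact h3.comp hs
  refine ⟨measurable_of_tendsto_metrizable
    (fun n => Finset.measurable_fun_sum _ fun j _ => (hgm j).const_mul _)
    (tendsto_pi_nhds.2 hV), ?_⟩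
  -- The partial sums converge pointwise to the pairing with `V`, and in `L²` to `I (A q)`.
  -- Uniqueness of limits in measure identifies the two almost everywhere.
  have h1 : TendstoInMeasure P (fun n w => ∑ j ∈ s n, inner ℝ q (b j) * g w j) atTop
      (fun w => inner ℝ q (V w)) :=
    tendstoInMeasure_of_tendsto_ae
      (fun n => (Finset.measurable_fun_sum _ fun j _ =>
        (hgm j).const_mul _).aestronglyMeasurable) (ae_of_all _ hV)
  have h2 : TendstoInMeasure P (fun n w => ∑ j ∈ s n, inner ℝ q (b j) * g w j) atTop
      (I (A q)) := by
    have h3 : Tendsto (fun n => I (A (∑ j ∈ s n, inner ℝ (b j) q • b j))) atTop (𝓝 (I (A q))) := by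
      have h4 : HasSum (fun j => inner ℝ (b j) q • b j) q := by
        simpa [b.repr_apply_apply] using b.hasSum_repr q
      have h5 : Tendsto (fun t : Finset ι => ∑ j ∈ t, inner ℝ (b j) q • b j) atTop (𝓝 q) := by
        simpa only [HasSum, SummationFilter.unconditional_filter] using h4
      exact ((I.continuous.comp A.continuous).tendsto q).comp (h5.comp hs)
    refine TendstoInMeasure.congr_left (fun n => ?_) (tendstoInMeasure_of_tendsto_Lp h3)
    have h5 : I (A (∑ j ∈ s n, inner ℝ (b j) q • b j))
        = ∑ j ∈ s n, inner ℝ (b j) q • I (A (b j)) := by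
      simp_rw [map_sum, map_smul]
    rw [h5]
    have h6 : ∀ᵐ w ∂P, ∀ j ∈ s n, (inner ℝ (b j) q • I (A (b j)) : Lp ℝ 2 P) w
        = inner ℝ q (b j) * g w j := by
      rw [Filter.eventually_all_finset]
      intro j _
      filter_upwards [Lp.coeFn_smul (inner ℝ (b j) q) (I (A (b j))), hgae j] with w h7 h8
      rw [h7, Pi.smul_apply, h8, smul_eq_mul, real_inner_comm]
    filter_upwards [Lp.coeFn_fun_finsetSum (s n) fun j => inner ℝ (b j) q • I (A (b j)),
      h6] with w h7 h8
    rw [h7]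
    exact Finset.sum_congr rfl h8
  exact tendstoInMeasure_ae_unique h1 h2

end HilbertSchmidt

/-! ### The Fourier transform of real functions -/

section FourierHat

variable {d : ℕ}

open FourierTransform in
lemma fourierHat_eq_fourier (f : Rd d → ℝ) (w : Rd d) :
    fourierHat f w = 𝓕 (fun x => (f x : ℂ)) ((2 * Real.pi)⁻¹ • w) := by
  rw [fourierHat, Real.fourier_eq']
  congr 1
  ext x
  rw [smul_eq_mul, inner_smul_right, real_inner_comm]
  congr 2
  push_cast
  field_simp

lemma norm_cexp_neg_I_mul (r : ℝ) : ‖Complex.exp (-(Complex.I * (r : ℂ)))‖ = 1 := by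
  rw [show -(Complex.I * (r : ℂ)) = Complex.I * ((-r : ℝ) : ℂ) by push_cast; ring,
    Complex.norm_exp_I_mul_ofReal]

lemma integrable_fourierHat_integrand {f : Rd d → ℝ} (hf : Integrable f) (w : Rd d) :
    Integrable fun x => Complex.exp (-(Complex.I * ((inner ℝ w x : ℝ) : ℂ))) * (f x : ℂ) := by
  refine (hf.ofReal (𝕜 := ℂ)).bdd_mul (c := 1) ?_ (ae_of_all _ fun x => ?_)
  · exact (by fun_prop : Continuous fun x : Rd d =>
      Complex.exp (-(Complex.I * ((inner ℝ w x : ℝ) : ℂ)))).aestronglyMeasurable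
  · exact (norm_cexp_neg_I_mul _).le

lemma continuous_fourierHat {f : Rd d → ℝ} (hf : Integrable f) : Continuous (fourierHat f) := by
  refine continuous_of_dominated (bound := fun x => ‖f x‖) (fun w => ?_) (fun w => ?_) hf.norm ?_
  · exact (integrable_fourierHat_integrand hf w).1
  · refine ae_of_all _ fun x => ?_
    rw [norm_mul, norm_cexp_neg_I_mul, one_mul, Complex.norm_real]
  · exact ae_of_all _ fun x => by fun_prop

lemma norm_fourierHat_le (f : Rd d → ℝ) (w : Rd d) : ‖fourierHat f w‖ ≤ ∫ x, ‖f x‖ := by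
  refine (norm_integral_le_integral_norm _).trans (le_of_eq ?_)
  congr 1
  ext x
  rw [norm_mul, norm_cexp_neg_I_mul, one_mul, Complex.norm_real]

lemma fourierHat_re {f : Rd d → ℝ} (hf : Integrable f) (w : Rd d) :
    (fourierHat f w).re = ∫ x, Real.cos (inner ℝ w x) * f x := by
  rw [fourierHat]
  have h := integral_re (integrable_fourierHat_integrand hf w)
  simp only [RCLike.re_to_complex] at h
  rw [← h]
  congr 1
  ext x
  rw [show -(Complex.I * ((inner ℝ w x : ℝ) : ℂ)) = ((-(inner ℝ w x) : ℝ) : ℂ) * Complex.I by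
    push_cast; ring, Complex.re_mul_ofReal, Complex.exp_ofReal_mul_I_re, Real.cos_neg]

lemma fourierHat_im {f : Rd d → ℝ} (hf : Integrable f) (w : Rd d) :
    (fourierHat f w).im = -∫ x, Real.sin (inner ℝ w x) * f x := by
  rw [fourierHat]
  have h := integral_im (integrable_fourierHat_integrand hf w)
  simp only [RCLike.im_to_complex] at h
  rw [← h, ← integral_neg]
  congr 1
  ext x
  rw [show -(Complex.I * ((inner ℝ w x : ℝ) : ℂ)) = ((-(inner ℝ w x) : ℝ) : ℂ) * Complex.I by
    push_cast; ring, Complex.im_mul_ofReal, Complex.exp_ofReal_mul_I_im, Real.sin_neg, neg_mul]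

/-- The transform of a reflected and translated function. -/
lemma fourierHat_reflect_translate (f : Rd d → ℝ) (x w : Rd d) :
    fourierHat (fun y => f (x - y)) w
      = Complex.exp (-(Complex.I * ((inner ℝ w x : ℝ) : ℂ)))
        * (starRingEnd ℂ) (fourierHat f w) := by
  rw [fourierHat, fourierHat, ← integral_conj, ← integral_const_mul,
    ← integral_sub_left_eq_self _ volume x]
  congr 1
  ext y
  rw [map_mul, Complex.conj_ofReal, ← Complex.exp_conj, ← mul_assoc, ← Complex.exp_add,
    sub_sub_cancel, inner_sub_right]
  congr 2
  simp [mul_sub]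
  ring

end FourierHat

/-! ### Smooth Gaussian fields with prescribed spectral density -/

section SmoothField

lemma inner_toLp_toLp {S F : Type*} [MeasurableSpace S] {μ : Measure S} [NormedAddCommGroup F]
    [InnerProductSpace ℝ F] {f g : S → F} (hf : MemLp f 2 μ) (hg : MemLp g 2 μ) :
    inner ℝ (hf.toLp f) (hg.toLp g) = ∫ x, inner ℝ (f x) (g x) ∂μ := by
  rw [L2.inner_def]
  refine integral_congr_ae ?_
  filter_upwards [hf.coeFn_toLp, hg.coeFn_toLp] with x h1 h2
  rw [h1, h2]

lemma norm_toLp_sq {S F : Type*} [MeasurableSpace S] {μ : Measure S} [NormedAddCommGroup F]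
    [InnerProductSpace ℝ F] {f : S → F} (hf : MemLp f 2 μ) :
    ‖hf.toLp f‖ ^ 2 = ∫ x, ‖f x‖ ^ 2 ∂μ := by
  rw [← real_inner_self_eq_norm_sq, inner_toLp_toLp]
  simp_rw [real_inner_self_eq_norm_sq]

variable {d : ℕ}

lemma fourierHat_congr_ae {f g : Rd d → ℝ} (h : f =ᵐ[volume] g) (w : Rd d) :
    fourierHat f w = fourierHat g w := by
  refine integral_congr_ae ?_
  filter_upwards [h] with y hy
  rw [hy]

lemma fourierHat_add {f g : Rd d → ℝ} (hf : Integrable f) (hg : Integrable g) (w : Rd d) :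
    fourierHat (fun y => f y + g y) w = fourierHat f w + fourierHat g w := by
  rw [fourierHat, fourierHat, fourierHat, ← integral_add
    (integrable_fourierHat_integrand hf w) (integrable_fourierHat_integrand hg w)]
  congr 1
  ext y
  push_cast
  ring

lemma fourierHat_const_mul (r : ℝ) (f : Rd d → ℝ) (w : Rd d) :
    fourierHat (fun y => r * f y) w = r * fourierHat f w := by
  rw [fourierHat, fourierHat, ← integral_const_mul]
  congr 1
  ext y
  push_cast
  ring

lemma memLp_exp_neg_norm_sq : MemLp (fun y : Rd d => Real.exp (-‖y‖ ^ 2)) 2 := by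
  have hc : Continuous fun y : Rd d => Real.exp (-‖y‖ ^ 2) := by fun_prop
  rw [memLp_two_iff_integrable_sq hc.aestronglyMeasurable]
  have h := GaussianFourier.integrable_cexp_neg_mul_sq_norm_add (V := Rd d) (b := 2)
    (by norm_num) 0 0
  refine (integrable_norm_iff (by fun_prop)).1 (h.norm.congr (ae_of_all _ fun y => ?_))
  dsimp only
  rw [Real.norm_eq_abs, abs_of_nonneg (by positivity), ← Real.exp_nat_mul, Complex.norm_exp]
  congr 1
  simp [← Complex.ofReal_pow]

/-- The operator `b ↦ √u · (n b)^` with a Gaussian weight `n`. -/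
lemma exists_weightedFourier {u : Rd d → ℝ} (hu0 : ∀ w, 0 ≤ u w) (hu : Integrable u) :
    ∃ A : Lp ℝ 2 (volume : Measure (Rd d)) →L[ℝ] Lp ℂ 2 (volume : Measure (Rd d)),
      (∀ b, A b =ᵐ[volume] fun w => (√(u w) : ℂ)
        * fourierHat (fun y => Real.exp (-‖y‖ ^ 2) * b y) w) ∧
      ∀ b, ‖A b‖ ^ 2 = ∫ w, u w * ‖fourierHat (fun y => Real.exp (-‖y‖ ^ 2) * b y) w‖ ^ 2 := by
  set N : Lp ℝ 2 (volume : Measure (Rd d)) := memLp_exp_neg_norm_sq.toLp _ with hN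
  have hint : ∀ b : Lp ℝ 2 (volume : Measure (Rd d)),
      Integrable fun y => Real.exp (-‖y‖ ^ 2) * b y := fun b =>
    memLp_exp_neg_norm_sq.integrable_mul (Lp.memLp b)
  -- Cauchy–Schwarz against the Gaussian weight: `n b` is integrable, so its transform is defined
  -- pointwise and bounded by `‖n‖ ‖b‖`.
  have hbd : ∀ (b : Lp ℝ 2 (volume : Measure (Rd d))) w,
      ‖fourierHat (fun y => Real.exp (-‖y‖ ^ 2) * b y) w‖ ≤ ‖N‖ * ‖b‖ := by
    intro b w
    refine (norm_fourierHat_le _ w).trans ?_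
    have h1 : ∫ y, ‖Real.exp (-‖y‖ ^ 2) * b y‖ = inner ℝ N (Lp.memLp b).norm.toLp := by
      rw [hN, inner_toLp_toLp]
      refine integral_congr_ae (ae_of_all _ fun y => ?_)
      change ‖Real.exp (-‖y‖ ^ 2) * b y‖ = ‖b y‖ * Real.exp (-‖y‖ ^ 2)
      rw [norm_mul, Real.norm_eq_abs, abs_of_pos (Real.exp_pos _), mul_comm]
    rw [h1]
    refine (real_inner_le_norm _ _).trans (le_of_eq ?_)
    congr 1
    rw [Lp.norm_toLp, eLpNorm_norm, Lp.norm_def]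
  have hsq : Integrable fun w => √(u w) ^ 2 := by
    simpa only [Real.sq_sqrt (hu0 _)] using hu
  have hsm : AEStronglyMeasurable (fun w => √(u w)) volume :=
    Real.continuous_sqrt.comp_aestronglyMeasurable hu.1
  have hs2 : MemLp (fun w => (√(u w) : ℂ)) 2 :=
    ((memLp_two_iff_integrable_sq hsm).2 hsq).ofReal
  have hmem : ∀ b : Lp ℝ 2 (volume : Measure (Rd d)), MemLp (fun w => (√(u w) : ℂ)
      * fourierHat (fun y => Real.exp (-‖y‖ ^ 2) * b y) w) 2 := by
    intro b
    refine (hs2.const_mul ((‖N‖ * ‖b‖ : ℝ) : ℂ)).mono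
      (hs2.1.mul (continuous_fourierHat (hint b)).aestronglyMeasurable) (ae_of_all _ fun w => ?_)
    rw [norm_mul, norm_mul, mul_comm, Complex.norm_real (‖N‖ * ‖b‖), Real.norm_eq_abs,
      abs_of_nonneg (by positivity)]
    exact mul_le_mul_of_nonneg_right (hbd b w) (norm_nonneg _)
  have hnorm : ∀ b, ‖(hmem b).toLp _‖ ^ 2
      = ∫ w, u w * ‖fourierHat (fun y => Real.exp (-‖y‖ ^ 2) * b y) w‖ ^ 2 := by
    intro b
    rw [norm_toLp_sq]
    congr 1
    ext w
    rw [norm_mul, mul_pow, Complex.norm_real, Real.norm_eq_abs, sq_abs, Real.sq_sqrt (hu0 w)]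
  let A₀ : Lp ℝ 2 (volume : Measure (Rd d)) →ₗ[ℝ] Lp ℂ 2 (volume : Measure (Rd d)) :=
    { toFun := fun b => (hmem b).toLp _
      map_add' := fun b c => by
        rw [← MemLp.toLp_add]
        refine MemLp.toLp_congr _ _ (ae_of_all _ fun w => ?_)
        rw [Pi.add_apply, ← mul_add]
        rw [← fourierHat_add (hint b) (hint c)]
        refine congr_arg _ (fourierHat_congr_ae ?_ w)
        filter_upwards [Lp.coeFn_add b c] with y hy
        rw [hy, Pi.add_apply, mul_add]
      map_smul' := fun r b => by
        rw [RingHom.id_apply, ← MemLp.toLp_const_smul]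
        refine MemLp.toLp_congr _ _ (ae_of_all _ fun w => ?_)
        rw [Pi.smul_apply, Complex.real_smul, mul_left_comm]
        rw [← fourierHat_const_mul]
        refine congr_arg _ (fourierHat_congr_ae ?_ w)
        filter_upwards [Lp.coeFn_smul r b] with y hy
        rw [hy, Pi.smul_apply, smul_eq_mul, mul_left_comm] }
  have hA₀ : ∀ b, ‖A₀ b‖ ≤ (‖N‖ * √(∫ w, u w)) * ‖b‖ := by
    intro b
    refine abs_le_of_sq_le_sq' ?_ (by positivity) |>.2
    change ‖(hmem b).toLp _‖ ^ 2 ≤ _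
    rw [hnorm]
    have hui : 0 ≤ ∫ w, u w := integral_nonneg hu0
    calc ∫ w, u w * ‖fourierHat (fun y => Real.exp (-‖y‖ ^ 2) * b y) w‖ ^ 2
        ≤ ∫ w, u w * (‖N‖ * ‖b‖) ^ 2 := by
          refine integral_mono_of_nonneg (ae_of_all _ fun w => mul_nonneg (hu0 w) (by positivity))
            (hu.mul_const _) (ae_of_all _ fun w => ?_)
          have := hbd b w
          have := hu0 w
          dsimp only
          gcongr
      _ = (‖N‖ * √(∫ w, u w) * ‖b‖) ^ 2 := by
          rw [integral_mul_const, mul_pow, mul_pow, mul_pow, Real.sq_sqrt hui]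
          ring
  exact ⟨A₀.mkContinuous _ hA₀, fun b => (hmem b).coeFn_toLp, fun b => hnorm b⟩

/-- There is a smooth Gaussian field with spectral density `|p^|² u`, defined on any probability
space that carries an isonormal process over `L²`. -/
theorem exists_smooth_field {Ω : Type*} [MeasurableSpace Ω] {P : Measure Ω} [IsProbabilityMeasure P]
    (I : Lp ℂ 2 (volume : Measure (Rd d)) →ₗᵢ[ℝ] Lp ℝ 2 P)
    (hI : IsCentredGaussian (fun h => (I h : Ω → ℝ)) (fun h h' => inner ℝ h h') P)
    {p : Rd d → ℝ} (hp : ContDiff ℝ ∞ p) (hpc : HasCompactSupport p)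
    {u : Rd d → ℝ} (hu0 : ∀ w, 0 ≤ u w) (hu : Integrable u) :
    ∃ Y : Rd d → Ω → ℝ, (∀ x, Measurable (Y x)) ∧ (∀ o, ContDiff ℝ ∞ fun x => Y x o) ∧
      IsCentredGaussian Y
        (fun x y => ∫ w, ‖fourierHat p w‖ ^ 2 * u w * Real.cos (inner ℝ w (x - y))) P := by
  obtain ⟨A, hA, hAn⟩ := exists_weightedFourier hu0 hu
  obtain ⟨s, b, -⟩ := exists_hilbertBasis ℝ (Lp ℝ 2 (volume : Measure (Rd d)))
  have : Fact ((2 : ENNReal) ≠ ⊤) := ⟨by norm_num⟩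
  have : Countable s := b.orthonormal.countable_of_separable
  set N : Lp ℝ 2 (volume : Measure (Rd d)) := memLp_exp_neg_norm_sq.toLp _ with hN
  have hint : ∀ b : Lp ℝ 2 (volume : Measure (Rd d)),
      Integrable fun y => Real.exp (-‖y‖ ^ 2) * b y := fun b =>
    memLp_exp_neg_norm_sq.integrable_mul (Lp.memLp b)
  -- The real and imaginary parts of the transform of `n b` at `w` are, up to sign, inner products
  -- of `b` with `n cos(w·y)` and `n sin(w·y)`. Both vectors have norm at most `‖n‖`.
  have hcos : ∀ (c : Rd d → ℝ), Continuous c → (∀ y, |c y| ≤ 1) →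
      ∃ q : Lp ℝ 2 (volume : Measure (Rd d)), ‖q‖ ≤ ‖N‖ ∧ ∀ b : Lp ℝ 2 (volume : Measure (Rd d)),
        inner ℝ b q = ∫ y, c y * (Real.exp (-‖y‖ ^ 2) * b y) := by
    intro c hc hc1
    have hm : MemLp (fun y : Rd d => c y * Real.exp (-‖y‖ ^ 2)) 2 := by
      refine memLp_exp_neg_norm_sq.mono ?_ (ae_of_all _ fun y => ?_)
      · exact (by fun_prop : Continuous fun y : Rd d =>
          c y * Real.exp (-‖y‖ ^ 2)).aestronglyMeasurable
      · rw [norm_mul]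
        exact mul_le_of_le_one_left (norm_nonneg _) (hc1 y)
    refine ⟨hm.toLp _, ?_, fun b => ?_⟩
    · refine abs_le_of_sq_le_sq' ?_ (norm_nonneg _) |>.2
      rw [hN, norm_toLp_sq, norm_toLp_sq]
      refine integral_mono_of_nonneg (ae_of_all _ fun _ => by positivity)
        memLp_exp_neg_norm_sq.norm.integrable_sq (ae_of_all _ fun y => ?_)
      dsimp only
      gcongr
      rw [norm_mul]
      exact mul_le_of_le_one_left (norm_nonneg _) (hc1 y)
    · rw [L2.inner_def]
      refine integral_congr_ae ?_
      filter_upwards [hm.coeFn_toLp] with y hy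
      rw [hy]
      simp only [RCLike.inner_apply, conj_trivial]
      ring
  -- Bessel's inequality for the cosine and the sine vector bounds the basis sum uniformly in `w`.
  -- Integrating against `u` then gives the Hilbert–Schmidt property.
  have hbessel : ∀ (t : Finset s) (w : Rd d),
      ∑ j ∈ t, ‖fourierHat (fun y => Real.exp (-‖y‖ ^ 2) * b j y) w‖ ^ 2 ≤ 2 * ‖N‖ ^ 2 := by
    intro t w
    obtain ⟨q₁, hq₁, hq₁'⟩ := hcos (fun y => Real.cos (inner ℝ w y)) (by fun_prop)
      (fun y => Real.abs_cos_le_one _)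
    obtain ⟨q₂, hq₂, hq₂'⟩ := hcos (fun y => Real.sin (inner ℝ w y)) (by fun_prop)
      (fun y => Real.abs_sin_le_one _)
    have h : ∀ j, ‖fourierHat (fun y => Real.exp (-‖y‖ ^ 2) * b j y) w‖ ^ 2
        = ‖inner ℝ (b j) q₁‖ ^ 2 + ‖inner ℝ (b j) q₂‖ ^ 2 := by
      intro j
      rw [← Complex.normSq_eq_norm_sq, Complex.normSq_apply, fourierHat_re (hint _),
        fourierHat_im (hint _), hq₁', hq₂', Real.norm_eq_abs, Real.norm_eq_abs, sq_abs, sq_abs]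
      ring
    simp_rw [h]
    rw [Finset.sum_add_distrib]
    have h1 := b.orthonormal.sum_inner_products_le (x := q₁) (s := t)
    have h2 := b.orthonormal.sum_inner_products_le (x := q₂) (s := t)
    have h3 : ‖q₁‖ ^ 2 ≤ ‖N‖ ^ 2 := by gcongr
    have h4 : ‖q₂‖ ^ 2 ≤ ‖N‖ ^ 2 := by gcongr
    linarith
  have hHS : Summable fun j => ‖A (b j)‖ ^ 2 := by
    refine summable_of_sum_le (c := (∫ w, u w) * (2 * ‖N‖ ^ 2)) (fun _ => by positivity) fun t => ?_
    simp_rw [hAn]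
    have hi : ∀ j ∈ t, Integrable fun w =>
        u w * ‖fourierHat (fun y => Real.exp (-‖y‖ ^ 2) * b j y) w‖ ^ 2 := by
      intro j _
      refine hu.mul_bdd (c := (∫ y, ‖Real.exp (-‖y‖ ^ 2) * b j y‖) ^ 2) ?_ (ae_of_all _ fun w => ?_)
      · exact ((continuous_fourierHat (hint _)).norm.pow 2).aestronglyMeasurable
      · rw [norm_pow, norm_norm]
        gcongr
        exact norm_fourierHat_le _ w
    rw [← integral_finsetSum _ hi, ← integral_mul_const]
    refine integral_mono (integrable_finsetSum _ hi) (hu.mul_const _) fun w => ?_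
    dsimp only
    rw [← Finset.mul_sum]
    exact mul_le_mul_of_nonneg_left (hbessel t w) (hu0 w)
  obtain ⟨V, hV⟩ := exists_randomVector I b A hHS
  -- The factor `exp(|y|²)` cancels the Gaussian weight in `A`. It is harmless because `p` has
  -- compact support.
  have hq : ∀ x : Rd d, MemLp (fun y => p (x - y) * Real.exp (‖y‖ ^ 2)) 2 := by
    intro x
    refine Continuous.memLp_of_hasCompactSupport ?_ ?_
    · have := hp.continuous
      fun_prop
    · exact (hpc.comp_homeomorph (Homeomorph.subLeft x)).mul_right
  let Y : Rd d → Ω → ℝ := fun x o => inner ℝ ((hq x).toLp _) (V o)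
  -- Each path is the convolution of a locally integrable function with the test function `p`. Since
  -- `V o` lies in `L²` for every `o`, all paths are smooth, not merely almost all.
  have hY : ∀ o, (fun x => Y x o)
      = convolution (fun y => Real.exp (‖y‖ ^ 2) * V o y) p (ContinuousLinearMap.mul ℝ ℝ)
        volume := by
    intro o
    ext x
    rw [convolution_def]
    change inner ℝ ((hq x).toLp _) (V o) = _
    rw [L2.inner_def]
    refine integral_congr_ae ?_
    filter_upwards [(hq x).coeFn_toLp] with y hy
    rw [hy]
    simp only [RCLike.inner_apply, conj_trivial, ContinuousLinearMap.mul_apply']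
    ring
  have hAq : ∀ x, A ((hq x).toLp _) =ᵐ[volume] fun w => (√(u w) : ℂ)
      * (Complex.exp (-(Complex.I * ((inner ℝ w x : ℝ) : ℂ)))
        * (starRingEnd ℂ) (fourierHat p w)) := by
    intro x
    filter_upwards [hA ((hq x).toLp _)] with w hw
    rw [hw, ← fourierHat_reflect_translate]
    congr 1
    rw [fourierHat, fourierHat]
    refine integral_congr_ae ?_
    filter_upwards [(hq x).coeFn_toLp] with y hy
    rw [hy, mul_left_comm, ← Real.exp_add, neg_add_cancel, Real.exp_zero, mul_one]
  refine ⟨Y, fun x => (hV _).1, fun o => ?_, ?_⟩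
  · rw [hY o]
    refine hpc.contDiff_convolution_right _ ?_ hp
    have hc : Continuous fun y : Rd d => Real.exp (‖y‖ ^ 2) := by fun_prop
    have hl : LocallyIntegrable (V o) (volume : Measure (Rd d)) :=
      (Lp.memLp (V o)).locallyIntegrable one_le_two
    exact hl.continuous_mul hc
  · have h1 := hI.comp_right fun x => A ((hq x).toLp _)
    refine ⟨h1.gaussian.congr fun x => (hV _).2.symm, fun x => ?_, fun x y => ?_⟩
    · rw [← h1.centred x]
      exact integral_congr_ae (hV _).2
    · have h2 := h1.covariance x y
      have h3 : ∫ o, Y x o * Y y o ∂P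
          = ∫ o, I (A ((hq x).toLp _)) o * I (A ((hq y).toLp _)) o ∂P := by
        refine integral_congr_ae ?_
        filter_upwards [(hV ((hq x).toLp _)).2, (hV ((hq y).toLp _)).2] with o h4 h5
        rw [← h4, ← h5]
      rw [h3, h2, L2.inner_def]
      refine integral_congr_ae ?_
      filter_upwards [hAq x, hAq y] with w h4 h5
      rw [h4, h5, Complex.inner]
      have e : (starRingEnd ℂ) ((√(u w) : ℂ) * (Complex.exp (-(Complex.I * ((inner ℝ w x : ℝ) : ℂ)))
            * (starRingEnd ℂ) (fourierHat p w)))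
          * ((√(u w) : ℂ) * (Complex.exp (-(Complex.I * ((inner ℝ w y : ℝ) : ℂ)))
            * (starRingEnd ℂ) (fourierHat p w)))
          = ((‖fourierHat p w‖ ^ 2 * u w : ℝ) : ℂ)
            * Complex.exp (((inner ℝ w (x - y) : ℝ) : ℂ) * Complex.I) := by
        have e1 : Complex.exp (((inner ℝ w (x - y) : ℝ) : ℂ) * Complex.I)
            = (starRingEnd ℂ) (Complex.exp (-(Complex.I * ((inner ℝ w x : ℝ) : ℂ))))
              * Complex.exp (-(Complex.I * ((inner ℝ w y : ℝ) : ℂ))) := by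
          rw [← Complex.exp_conj, ← Complex.exp_add, inner_sub_right]
          congr 1
          simp
          ring
        have e2 : ((‖fourierHat p w‖ ^ 2 * u w : ℝ) : ℂ)
            = fourierHat p w * (starRingEnd ℂ) (fourierHat p w) * ((√(u w) : ℂ) * (√(u w) : ℂ)) := by
          rw [Complex.mul_conj, Complex.normSq_eq_norm_sq, ← Complex.ofReal_mul √(u w),
            Real.mul_self_sqrt (hu0 w)]
          push_cast
          ring
        rw [e1, e2]
        simp only [map_mul, Complex.conj_conj, Complex.conj_ofReal]
        ring
      rw [mul_comm _ ((starRingEnd ℂ) _), e, Complex.re_ofReal_mul, Complex.exp_ofReal_mul_I_re]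

end SmoothField

/-! ### Uniqueness and positivity of spectral densities -/

section Uniqueness

variable {d : ℕ}

lemma integrable_cexp_inner_mul {f : Rd d → ℝ} (hf : Integrable f) (x : Rd d) :
    Integrable fun w => Complex.exp (Complex.I * ((inner ℝ w x : ℝ) : ℂ)) * (f w : ℂ) := by
  refine (hf.ofReal (𝕜 := ℂ)).bdd_mul (c := 1) ?_ (ae_of_all _ fun w => ?_)
  · exact (by fun_prop : Continuous fun w : Rd d =>
      Complex.exp (Complex.I * ((inner ℝ w x : ℝ) : ℂ))).aestronglyMeasurable
  · exact (Complex.norm_exp_I_mul_ofReal _).le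

lemma charFun_withDensity_ofReal {f : Rd d → ℝ} (hf : Integrable f) (x : Rd d) :
    charFun (volume.withDensity fun w => ENNReal.ofReal (f w)) x
      = ∫ w, Complex.exp (Complex.I * ((inner ℝ w x : ℝ) : ℂ)) * ((max (f w) 0 : ℝ) : ℂ) := by
  rw [charFun_apply, integral_withDensity_eq_integral_toReal_smul₀
    hf.1.aemeasurable.ennreal_ofReal (ae_of_all _ fun _ => ENNReal.ofReal_lt_top)]
  congr 1
  ext w
  rw [ENNReal.toReal_ofReal', Complex.real_smul, mul_comm, mul_comm Complex.I]

/-- Integrable functions are determined by their Fourier transform. -/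
lemma ae_eq_of_integral_cexp_eq {f g : Rd d → ℝ} (hf : Integrable f) (hg : Integrable g)
    (h : ∀ x : Rd d, ∫ w, Complex.exp (Complex.I * ((inner ℝ w x : ℝ) : ℂ)) * (f w : ℂ)
      = ∫ w, Complex.exp (Complex.I * ((inner ℝ w x : ℝ) : ℂ)) * (g w : ℂ)) :
    f =ᵐ[volume] g := by
  set D : Rd d → ℝ := fun w => f w - g w with hD
  have hDi : Integrable D := hf.sub hg
  have hN : Integrable fun w => -D w := hDi.neg
  have fin1 : IsFiniteMeasure (volume.withDensity fun w => ENNReal.ofReal (D w)) :=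
    isFiniteMeasure_withDensity_ofReal hDi.2
  have fin2 : IsFiniteMeasure (volume.withDensity fun w => ENNReal.ofReal (-D w)) :=
    isFiniteMeasure_withDensity_ofReal hN.2
  -- The positive and negative parts of `D = f - g` are densities of finite measures. The difference
  -- of their characteristic functions is the transform of `D`, which is zero.
  have key : volume.withDensity (fun w => ENNReal.ofReal (D w))
      = volume.withDensity fun w => ENNReal.ofReal (-D w) := by
    refine Measure.ext_of_charFun ?_
    ext x
    rw [charFun_withDensity_ofReal hDi, charFun_withDensity_ofReal hN, ← sub_eq_zero,
      ← integral_sub (integrable_cexp_inner_mul hDi.pos_part x)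
        (integrable_cexp_inner_mul hN.pos_part x)]
    have h2 := h x
    rw [← sub_eq_zero, ← integral_sub (integrable_cexp_inner_mul hf x)
      (integrable_cexp_inner_mul hg x)] at h2
    rw [← h2]
    congr 1
    ext w
    rw [← mul_sub, ← mul_sub, ← Complex.ofReal_sub, ← Complex.ofReal_sub]
    congr 2
    change max (D w) 0 - max (-D w) 0 = D w
    rcases le_total 0 (D w) with h0 | h0
    · rw [max_eq_left h0, max_eq_right (by linarith), sub_zero]
    · rw [max_eq_right h0, max_eq_left (by linarith)]; ring
  have h3 : (fun w => ENNReal.ofReal (D w)) =ᵐ[volume] fun w => ENNReal.ofReal (-D w) :=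
    (withDensity_eq_iff hDi.1.aemeasurable.ennreal_ofReal hN.1.aemeasurable.ennreal_ofReal
      (by
        have := fin1.measure_univ_lt_top
        rw [withDensity_apply _ MeasurableSet.univ, Measure.restrict_univ] at this
        exact this.ne)).1 key
  filter_upwards [h3] with w hw
  -- At each point at most one of the two parts is nonzero, so their equality forces both to vanish.
  have : D w = 0 := by
    rcases le_total 0 (D w) with h0 | h0
    · rw [ENNReal.ofReal_of_nonpos (by linarith : -D w ≤ 0), ENNReal.ofReal_eq_zero] at hw
      linarith
    · rw [ENNReal.ofReal_of_nonpos h0, eq_comm, ENNReal.ofReal_eq_zero] at hw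
      linarith
  simp only [hD] at this
  linarith

lemma IsPositiveDefiniteFunction.even {f : Rd d → ℝ} (hf : IsPositiveDefiniteFunction f)
    (x : Rd d) : f (-x) = f x := by
  have h := (hf 2 ![x, 0]).1.apply 0 1
  simpa using h

lemma IsConvolutionRoot.conv_apply {Kb K : Rd d → ℝ} (h : IsConvolutionRoot Kb K) (x : Rd d) :
    K x = ∫ y, Kb y * Kb (x - y) := by
  rw [← h.conv, convolution_def]
  rfl

/-- By evenness, the convolution at the origin is `∫ Kb²`. Were `Kb²` not integrable, this integral
would take the default value `0`, contradicting `K 0 = 1`. -/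
lemma IsConvolutionRoot.memLp {Kb K : Rd d → ℝ} (h : IsConvolutionRoot Kb K) (h1 : K 0 = 1) :
    MemLp Kb 2 := by
  rw [memLp_two_iff_integrable_sq h.continuous.aestronglyMeasurable]
  have h2 := h.conv_apply 0
  simp only [zero_sub, h.posDef.even, h1] at h2
  by_contra h3
  rw [integral_undef (by simpa only [sq] using h3)] at h2
  exact one_ne_zero h2

lemma IsConvolutionRoot.conv_translate {Kb K : Rd d → ℝ} (h : IsConvolutionRoot Kb K) (x : Rd d) :
    K x = ∫ y, Kb y * Kb (y - x) := by
  rw [h.conv_apply]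
  congr 1
  ext y
  rw [← h.posDef.even (x - y), neg_sub]

open FourierTransform SchwartzMap in
lemma fourier_compSubConst (f : 𝓢(Rd d, ℂ)) (x w : Rd d) :
    𝓕 (f.compSubConstCLM ℝ x) w
      = Complex.exp (Complex.I * ((inner ℝ w ((-(2 * Real.pi)) • x) : ℝ) : ℂ)) * 𝓕 f w := by
  have h6 := congr_fun (VectorFourier.fourierIntegral_comp_add_right Real.fourierChar volume
    (innerₗ (Rd d)) (f : Rd d → ℂ) (-x)) w
  have h7 : ((f : Rd d → ℂ) ∘ fun v => v + -x) = f.compSubConstCLM ℝ x := by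
    ext y
    simp [sub_eq_add_neg]
  rw [h7] at h6
  rw [fourier_coe, fourier_coe]
  refine h6.trans ?_
  rw [Circle.smul_def, smul_eq_mul, Real.fourierChar_apply]
  congr 1
  congr 1
  rw [innerₗ_apply_apply, inner_neg_left, inner_smul_right, real_inner_comm]
  push_cast
  ring

open FourierTransform SchwartzMap in
/-- The autocorrelation of a square integrable function has a nonnegative spectral density. -/
lemma exists_spectralDensity_autocorrelation (F : Lp ℂ 2 (volume : Measure (Rd d))) :
    ∃ G : Lp ℂ 2 (volume : Measure (Rd d)), ∀ x : Rd d,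
      ∫ y, (starRingEnd ℂ) (F y) * F (y - x)
        = ∫ w, Complex.exp (Complex.I * ((inner ℝ w ((-(2 * Real.pi)) • x) : ℝ) : ℂ))
          * ((‖G w‖ ^ 2 : ℝ) : ℂ) := by
  refine ⟨𝓕 F, fun x => ?_⟩
  let T : Lp ℂ 2 (volume : Measure (Rd d)) → Lp ℂ 2 (volume : Measure (Rd d)) :=
    Lp.compMeasurePreserving (fun y => y - x) (measurePreserving_sub_right volume x)
  have hT : ∀ F, T F =ᵐ[volume] fun y => F (y - x) := fun F =>
    Lp.coeFn_compMeasurePreserving F (measurePreserving_sub_right volume x)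
  have hTc : Continuous T :=
    (Lp.isometry_compMeasurePreserving (measurePreserving_sub_right volume x)).continuous
  let e : Rd d → ℂ := fun w => Complex.exp (Complex.I * ((inner ℝ w ((-(2 * Real.pi)) • x) : ℝ) : ℂ))
  have hec : Continuous e := by fun_prop
  have he1 : ∀ w, ‖e w‖ = 1 := fun w => Complex.norm_exp_I_mul_ofReal _
  have hmem : ∀ F : Lp ℂ 2 (volume : Measure (Rd d)), MemLp (fun w => e w * F w) 2 := fun F => by
    refine (Lp.memLp F).mono (hec.aestronglyMeasurable.mul (Lp.aestronglyMeasurable F))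
      (ae_of_all _ fun w => ?_)
    rw [norm_mul, he1, one_mul]
  let M : Lp ℂ 2 (volume : Measure (Rd d)) → Lp ℂ 2 (volume : Measure (Rd d)) :=
    fun F => (hmem F).toLp _
  have hMc : Continuous M := by
    refine (LipschitzWith.of_dist_le_mul (K := 1) fun F G => ?_).continuous
    rw [dist_eq_norm, dist_eq_norm, NNReal.coe_one, one_mul, ← MemLp.toLp_sub]
    refine Lp.norm_le_norm_of_ae_le ?_
    filter_upwards [MemLp.coeFn_toLp ((hmem F).sub (hmem G)), Lp.coeFn_sub F G] with w h1 h2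
    rw [h1, h2, Pi.sub_apply, Pi.sub_apply, ← mul_sub, norm_mul, he1, one_mul]
  -- Translation becomes modulation under the Fourier transform. The identity is checked on Schwartz
  -- functions and extended by density; Plancherel applied to `⟨F, T F⟩` then yields the density `|𝓕
  -- F|²`.
  have key : ∀ F : Lp ℂ 2 (volume : Measure (Rd d)), 𝓕 (T F) = M (𝓕 F) := by
    intro F
    have hcF : Continuous fun F : Lp ℂ 2 (volume : Measure (Rd d)) => 𝓕 F :=
      ContinuousFourier.continuous_fourier
    refine congr_fun ((denseRange_toLpCLM (F := ℂ) (μ := (volume : Measure (Rd d))) (p := 2)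
      ENNReal.ofNat_ne_top).equalizer (hcF.comp hTc) (hMc.comp hcF) ?_) F
    funext f
    change 𝓕 (T (f.toLp 2)) = M (𝓕 (f.toLp 2))
    have h1 : T (f.toLp 2) = (f.compSubConstCLM ℝ x).toLp 2 := by
      refine Lp.ext ?_
      have h0 : ∀ᵐ y, (f.toLp 2 : Lp ℂ 2 (volume : Measure (Rd d))) y = f y := f.coeFn_toLp 2 volume
      filter_upwards [hT (f.toLp 2), (f.compSubConstCLM ℝ x).coeFn_toLp 2 volume,
        (measurePreserving_sub_right volume x).quasiMeasurePreserving.ae h0] with y h2 h3 h4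
      rw [h2, h3, h4, compSubConstCLM_apply]
    rw [h1, toLp_fourier_eq, toLp_fourier_eq]
    refine Lp.ext ?_
    filter_upwards [(𝓕 (f.compSubConstCLM ℝ x)).coeFn_toLp 2 volume, (𝓕 f).coeFn_toLp 2 volume,
      (hmem ((𝓕 f).toLp 2)).coeFn_toLp] with w h2 h3 h4
    rw [h2, h4, h3, fourier_compSubConst]
  have h1 : ∫ y, (starRingEnd ℂ) (F y) * F (y - x) = inner ℂ F (T F) := by
    rw [L2.inner_def]
    refine integral_congr_ae ?_
    filter_upwards [hT F] with y hy
    rw [hy, RCLike.inner_apply, mul_comm]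
  rw [h1, ← Lp.inner_fourier_eq, key, L2.inner_def]
  refine integral_congr_ae ?_
  filter_upwards [(hmem (𝓕 F)).coeFn_toLp] with w hw
  change inner ℂ (𝓕 F w) (M (𝓕 F) w) = _
  rw [hw, RCLike.inner_apply, mul_assoc, Complex.mul_conj, Complex.normSq_eq_norm_sq]

/-- A function with a convolution root has a nonnegative spectral density. -/
lemma IsConvolutionRoot.fourier_nonneg {Kb K Khat : Rd d → ℝ} (h : IsConvolutionRoot Kb K)
    (h1 : K 0 = 1) (hF : IsFourierTransformOf Khat K) : ∀ᵐ w, 0 ≤ Khat w := by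
  have hm : MemLp (fun y => (Kb y : ℂ)) 2 := (h.memLp h1).ofReal
  obtain ⟨G, hG⟩ := exists_spectralDensity_autocorrelation (hm.toLp _)
  have hc : (-(2 * Real.pi))⁻¹ ≠ 0 := by
    have := Real.pi_pos
    exact inv_ne_zero (by linarith)
  -- The dilation by `-(2π)⁻¹`, with its Jacobian, converts between the kernel `e^{-2πi w·x}` and
  -- the normalisation of `IsFourierTransformOf`.
  let g : Rd d → ℝ := fun w => |((-(2 * Real.pi))⁻¹) ^ d| * ‖G ((-(2 * Real.pi))⁻¹ • w)‖ ^ 2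
  have hgi : Integrable g := by
    refine Integrable.const_mul ?_ _
    have := (Lp.memLp G).norm.integrable_sq
    exact this.comp_smul hc
  have hKx : ∀ x, (K x : ℂ)
      = ∫ w, Complex.exp (Complex.I * ((inner ℝ w x : ℝ) : ℂ)) * (g w : ℂ) := by
    intro x
    rw [h.conv_translate, ← integral_complex_ofReal]
    have h2 : ∫ y, ((Kb y * Kb (y - x) : ℝ) : ℂ)
        = ∫ y, (starRingEnd ℂ) ((hm.toLp _) y) * (hm.toLp _) (y - x) := by
      refine integral_congr_ae ?_
      filter_upwards [hm.coeFn_toLp, (measurePreserving_sub_right volume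
        x).quasiMeasurePreserving.ae hm.coeFn_toLp] with y h3 h4
      rw [h3, h4, Complex.conj_ofReal]
      push_cast
      rfl
    rw [h2, hG x]
    have h5 := Measure.integral_comp_smul (volume : Measure (Rd d)) (fun w =>
      Complex.exp (Complex.I * ((inner ℝ w ((-(2 * Real.pi)) • x) : ℝ) : ℂ))
          * ((‖G w‖ ^ 2 : ℝ) : ℂ)) (-(2 * Real.pi))⁻¹
    have h6 : |((((-(2 * Real.pi))⁻¹) ^ d)⁻¹ : ℝ)| ≠ 0 := by positivity
    rw [finrank_euclideanSpace_fin] at h5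
    rw [← inv_smul_smul₀ h6 (∫ w, Complex.exp (Complex.I * ((inner ℝ w ((-(2 * Real.pi)) • x) : ℝ)
      : ℂ)) * ((‖G w‖ ^ 2 : ℝ) : ℂ)), ← h5, ← integral_smul]
    congr 1
    ext w
    rw [inner_smul_left, inner_smul_right, Complex.real_smul]
    simp only [g, conj_trivial, abs_inv, inv_inv]
    rw [inv_mul_cancel_left₀ (fun h0 => hc (by rw [h0, inv_zero]))]
    push_cast
    ring
  have h8 := ae_eq_of_integral_cexp_eq hF.1 hgi fun x => by rw [← hF.2 x, ← hKx x]
  filter_upwards [h8] with w hw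
  rw [hw]
  positivity

end Uniqueness

/-! ### Radial spectral densities -/

section Radial

variable {d : ℕ}

lemma integrable_cos_inner_mul {f : Rd d → ℝ} (hf : Integrable f) (x : Rd d) :
    Integrable fun w => Real.cos (inner ℝ w x) * f w := by
  refine hf.bdd_mul (c := 1) ?_ (ae_of_all _ fun w => Real.abs_cos_le_one _)
  exact (by fun_prop : Continuous fun w : Rd d => Real.cos (inner ℝ w x)).aestronglyMeasurable

lemma integral_cexp_inner_re {f : Rd d → ℝ} (hf : Integrable f) (x : Rd d) :
    (∫ w, Complex.exp (Complex.I * ((inner ℝ w x : ℝ) : ℂ)) * (f w : ℂ)).re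
      = ∫ w, Real.cos (inner ℝ w x) * f w := by
  have h := integral_re (integrable_cexp_inner_mul hf x)
  simp only [RCLike.re_to_complex] at h
  rw [← h]
  congr 1
  ext w
  rw [Complex.re_mul_ofReal, mul_comm Complex.I, Complex.exp_ofReal_mul_I_re]

lemma IsFourierTransformOf.eq_cos {Khat K : Rd d → ℝ} (h : IsFourierTransformOf Khat K) (x : Rd d) :
    K x = ∫ w, Real.cos (inner ℝ w x) * Khat w := by
  rw [← integral_cexp_inner_re h.1, ← h.2, Complex.ofReal_re]

/-- The transform of an even function is real. -/
lemma integral_cexp_inner_of_even {f : Rd d → ℝ} (hf : Integrable f) (he : ∀ w, f (-w) = f w)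
    (x : Rd d) :
    ∫ w, Complex.exp (Complex.I * ((inner ℝ w x : ℝ) : ℂ)) * (f w : ℂ)
      = ((∫ w, Real.cos (inner ℝ w x) * f w : ℝ) : ℂ) := by
  rw [← integral_cexp_inner_re hf]
  refine (Complex.conj_eq_iff_re.1 ?_).symm
  rw [← integral_conj, ← integral_neg_eq_self]
  congr 1
  ext w
  rw [map_mul, Complex.conj_ofReal, ← Complex.exp_conj, he, inner_neg_left]
  simp

lemma exists_isometry_of_norm_eq {x y : Rd d} (h : ‖x‖ = ‖y‖) :
    ∃ A : Rd d ≃ₗᵢ[ℝ] Rd d, A x = y := ⟨_, Submodule.reflection_sub h⟩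

/-- A reflection carrying `x` to `y` preserves Lebesgue measure and the norm of `w`. -/
lemma integral_cos_radial {g : ℝ → ℝ} {x y : Rd d} (h : ‖x‖ = ‖y‖) :
    ∫ w : Rd d, Real.cos (inner ℝ w x) * g ‖w‖ = ∫ w : Rd d, Real.cos (inner ℝ w y) * g ‖w‖ := by
  obtain ⟨A, rfl⟩ := exists_isometry_of_norm_eq h
  rw [← A.measurePreserving.integral_comp A.toHomeomorph.measurableEmbedding
    (fun w : Rd d => Real.cos (inner ℝ w (A x)) * g ‖w‖)]
  simp

lemma nontrivial_Rd (hd : 1 ≤ d) : Nontrivial (Rd d) :=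
  Module.nontrivial_of_finrank_pos (R := ℝ) (by rw [finrank_euclideanSpace_fin]; exact hd)

lemma integral_norm_polar (hd : 1 ≤ d) (g : ℝ → ℝ) :
    ∫ w : Rd d, g ‖w‖ = (d * volume.real (Metric.ball (0 : Rd d) 1))
      * ∫ y in Ioi (0 : ℝ), y ^ (d - 1) * g y := by
  have := nontrivial_Rd hd
  rw [integral_fun_norm_addHaar volume g, finrank_euclideanSpace_fin, nsmul_eq_mul, smul_eq_mul,
    mul_assoc]
  simp only [smul_eq_mul]

lemma setIntegral_closedBall_norm (hd : 1 ≤ d) (g : ℝ → ℝ) (R : ℝ) :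
    ∫ w in Metric.closedBall (0 : Rd d) R, g ‖w‖ = (d * volume.real (Metric.ball (0 : Rd d) 1))
      * ∫ y in Ioc (0 : ℝ) R, y ^ (d - 1) * g y := by
  have h1 : ∫ w in Metric.closedBall (0 : Rd d) R, g ‖w‖
      = ∫ w : Rd d, (Iic R).indicator g ‖w‖ := by
    rw [← integral_indicator Metric.isClosed_closedBall.measurableSet]
    congr 1
    ext w
    simp [indicator]
  have h2 : ∫ y in Ioi (0 : ℝ), y ^ (d - 1) * (Iic R).indicator g y
      = ∫ y in Ioc (0 : ℝ) R, y ^ (d - 1) * g y := by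
    rw [← Ioi_inter_Iic, ← setIntegral_indicator measurableSet_Iic]
    congr 1
    ext y
    by_cases hy : y ∈ Iic R <;> simp [hy]
  rw [h1, integral_norm_polar hd, h2]

lemma sphereConst_pos (hd : 1 ≤ d) : 0 < d * volume.real (Metric.ball (0 : Rd d) 1) := by
  have h1 : (0 : ℝ) < d := by exact_mod_cast hd
  have h2 : 0 < volume.real (Metric.ball (0 : Rd d) 1) :=
    ENNReal.toReal_pos (Metric.measure_ball_pos volume _ one_pos).ne' measure_ball_lt_top.ne
  positivity

/-- A continuous radial function whose integrals over all centred balls vanish is zero. -/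
lemma eq_zero_of_setIntegral_closedBall (hd : 1 ≤ d) {D : Rd d → ℝ} (hc : Continuous D)
    (hr : ∀ x y, ‖x‖ = ‖y‖ → D x = D y)
    (h0 : ∀ R > 0, ∫ x in Metric.closedBall (0 : Rd d) R, D x = 0) (x : Rd d) : D x = 0 := by
  let e : Rd d := EuclideanSpace.single ⟨0, hd⟩ 1
  have he : ‖e‖ = 1 := by simp [e]
  let δ : ℝ → ℝ := fun s => D (s • e)
  have hδ : Continuous δ := by fun_prop
  have hDδ : ∀ x, D x = δ ‖x‖ := fun x => hr _ _ (by simp [norm_smul, he])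
  have h1 : ∀ R > 0, ∫ y in (0 : ℝ)..R, y ^ (d - 1) * δ y = 0 := by
    intro R hR
    have h2 := h0 R hR
    simp_rw [hDδ] at h2
    rw [setIntegral_closedBall_norm hd] at h2
    rw [intervalIntegral.integral_of_le hR.le]
    exact (mul_eq_zero.1 h2).resolve_left (sphereConst_pos hd).ne'
  have h2 : ∀ R > 0, δ R = 0 := by
    intro R hR
    have hcont : Continuous fun y => y ^ (d - 1) * δ y := by fun_prop
    have h3 := intervalIntegral.integral_hasDerivAt_right (hcont.intervalIntegrable 0 R)
      (hcont.stronglyMeasurableAtFilter _ _) hcont.continuousAt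
    -- In polar coordinates the ball integrals vanish for all radii. Differentiating in the radius
    -- gives `R^{d-1} δ(R) = 0`.
    have h4 : HasDerivAt (fun u => ∫ y in (0 : ℝ)..u, y ^ (d - 1) * δ y) 0 R := by
      refine (hasDerivAt_const R (0 : ℝ)).congr_of_eventuallyEq ?_
      filter_upwards [lt_mem_nhds hR] with s hs
      exact h1 s hs
    have h5 := h3.unique h4
    exact (mul_eq_zero.1 h5).resolve_left (by positivity)
  -- The derivative argument covers only positive radii; the origin follows by continuity.
  have h3 : closure (Ioi (0 : ℝ)) ⊆ {s | δ s = 0} :=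
    closure_minimal (fun s hs => h2 s hs) (isClosed_eq hδ continuous_const)
  rw [hDδ]
  rw [closure_Ioi] at h3
  exact h3 (norm_nonneg x)

lemma continuous_integral_cos {f : Rd d → ℝ} (hf : Integrable f) :
    Continuous fun x => ∫ w, Real.cos (inner ℝ w x) * f w := by
  refine continuous_of_dominated (bound := fun w => ‖f w‖)
    (fun x => (integrable_cos_inner_mul hf x).1) (fun x => ae_of_all _ fun w => ?_) hf.norm
    (ae_of_all _ fun w => by fun_prop)
  rw [norm_mul]
  exact mul_le_of_le_one_left (norm_nonneg _) (Real.abs_cos_le_one _)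

lemma setIntegral_closedBall_integral_cos {f : Rd d → ℝ} (hf : Integrable f) (R : ℝ) :
    ∫ x in Metric.closedBall (0 : Rd d) R, ∫ w, Real.cos (inner ℝ w x) * f w
      = ∫ w, (∫ x in Metric.closedBall (0 : Rd d) R, Real.cos (inner ℝ w x)) * f w := by
  rw [integral_integral_swap]
  · simp_rw [integral_mul_const]
  · have : IsFiniteMeasure (volume.restrict (Metric.closedBall (0 : Rd d) R)) :=
      ⟨by rw [Measure.restrict_apply_univ]; exact measure_closedBall_lt_top⟩
    have h1 : Integrable (fun p : Rd d × Rd d => f p.2)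
        ((volume.restrict (Metric.closedBall (0 : Rd d) R)).prod volume) := hf.comp_snd _
    refine h1.bdd_mul (c := 1) ?_ (ae_of_all _ fun p => Real.abs_cos_le_one _)
    exact (by fun_prop : Continuous fun p : Rd d × Rd d =>
      Real.cos (inner ℝ p.2 p.1)).aestronglyMeasurable

/-- The conditional expectation of a function given the norm. -/
lemma exists_condExp_norm {μ : Measure (Rd d)} [IsFiniteMeasure μ] {f : Rd d → ℝ}
    (hf : Integrable f μ) :
    ∃ k : ℝ → ℝ, Measurable k ∧ Integrable (fun w => k ‖w‖) μ ∧
      ∀ j : ℝ → ℝ, Measurable j → (∃ c, ∀ s, |j s| ≤ c) →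
        ∫ w, j ‖w‖ * f w ∂μ = ∫ w, j ‖w‖ * k ‖w‖ ∂μ := by
  have hm : MeasurableSpace.comap (fun w : Rd d => ‖w‖) inferInstance
    ≤ (inferInstance : MeasurableSpace (Rd d)) := measurable_norm.comap_le
  obtain ⟨k, hk, hkeq⟩ := (stronglyMeasurable_condExp (μ := μ)
    (m := MeasurableSpace.comap (fun w : Rd d => ‖w‖) inferInstance)
    (f := f)).measurable.exists_eq_measurable_comp
  refine ⟨k, hk, ?_, ?_⟩
  · have h1 : Integrable (μ[f | MeasurableSpace.comap (fun w : Rd d => ‖w‖) inferInstance]) μ :=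
      integrable_condExp
    rw [hkeq] at h1
    exact h1
  · rintro j hj ⟨c, hc⟩
    have h3 := condExp_stronglyMeasurable_mul_of_bound hm
      (f := fun w : Rd d => j ‖w‖) (hj.comp (comap_measurable _)).stronglyMeasurable hf c
      (ae_of_all _ fun w => hc ‖w‖)
    have h4 := integral_condExp (μ := μ) (f := (fun w : Rd d => j ‖w‖) * f) hm
    refine (h4.symm.trans (integral_congr_ae h3)).trans ?_
    rw [hkeq]
    rfl

/-- An integrable function supported in the unit ball whose Fourier transform is radial is
radial itself. -/
theorem exists_radial_of_radial_transform (hd : 1 ≤ d) {K Khat : Rd d → ℝ}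
    (hF : IsFourierTransformOf Khat K) (hr : ∀ x y : Rd d, ‖x‖ = ‖y‖ → K x = K y)
    (hs : ∀ w, 1 < ‖w‖ → Khat w = 0) :
    ∃ k : ℝ → ℝ, Measurable k ∧ Khat =ᵐ[volume] fun w => k ‖w‖ := by
  let B : Set (Rd d) := Metric.closedBall 0 1
  have hB : MeasurableSet B := Metric.isClosed_closedBall.measurableSet
  let μ : Measure (Rd d) := volume.restrict B
  have : IsFiniteMeasure μ :=
    ⟨by rw [Measure.restrict_apply_univ]; exact measure_closedBall_lt_top⟩
  -- The candidate profile is the conditional expectation of `Khat` given `|w|`, under Lebesgue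
  -- measure on the unit ball. It is radial by construction and has the same integrals as `Khat`
  -- against bounded radial functions.
  obtain ⟨k, hk, hki, hkmom⟩ := exists_condExp_norm (hF.1.restrict (s := B))
  let k' : ℝ → ℝ := (Iic 1).indicator k
  have hk' : Measurable k' := hk.indicator measurableSet_Iic
  have hk'B : (fun w : Rd d => k' ‖w‖) = B.indicator fun w => k ‖w‖ := by
    ext w
    simp [k', B, indicator]
  have hkint : Integrable fun w : Rd d => k' ‖w‖ := by
    rw [hk'B, integrable_indicator_iff hB]
    exact hki
  have hmom : ∀ j : ℝ → ℝ, Measurable j → (∃ c, ∀ s, |j s| ≤ c) →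
      ∫ w : Rd d, j ‖w‖ * Khat w = ∫ w : Rd d, j ‖w‖ * k' ‖w‖ := by
    intro j hj hc
    have h1 : ∫ w : Rd d, j ‖w‖ * Khat w = ∫ w : Rd d, j ‖w‖ * Khat w ∂μ := by
      rw [setIntegral_eq_integral_of_forall_compl_eq_zero]
      intro w hw
      rw [hs w (by simpa [B] using hw), mul_zero]
    have h2 : ∫ w : Rd d, j ‖w‖ * k' ‖w‖ = ∫ w, j ‖w‖ * k ‖w‖ ∂μ := by
      rw [← integral_indicator hB]
      congr 1
      ext w
      rw [congr_fun hk'B w]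
      by_cases hw : w ∈ B <;> simp [hw]
    rw [h1, h2, hkmom j hj hc]
  -- The difference of the two transforms is continuous and radial. By Fubini its integral over a
  -- ball pairs `Khat - k'(|·|)` with a bounded radial function of `w`, hence vanishes.
  have hcos : ∀ x, K x = ∫ w, Real.cos (inner ℝ w x) * k' ‖w‖ := by
    intro x
    rw [← sub_eq_zero]
    refine eq_zero_of_setIntegral_closedBall hd
      (D := fun x => K x - ∫ w, Real.cos (inner ℝ w x) * k' ‖w‖) ?_ ?_ ?_ x
    · refine Continuous.sub ?_ (continuous_integral_cos hkint)
      rw [show K = fun x => _ from funext hF.eq_cos]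
      exact continuous_integral_cos hF.1
    · intro x y hxy
      rw [hr x y hxy, integral_cos_radial hxy]
    · intro R _
      have hfin : IsFiniteMeasure (volume.restrict (Metric.closedBall (0 : Rd d) R)) :=
        ⟨by rw [Measure.restrict_apply_univ]; exact measure_closedBall_lt_top⟩
      simp_rw [hF.eq_cos]
      have hb : ∀ {f : Rd d → ℝ}, Integrable f →
          IntegrableOn (fun x => ∫ w, Real.cos (inner ℝ w x) * f w) (Metric.closedBall 0 R) :=
        fun hf => (continuous_integral_cos hf).continuousOn.integrableOn_compact
          (isCompact_closedBall _ _)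
      rw [integral_sub (hb hF.1) (hb hkint), setIntegral_closedBall_integral_cos hF.1,
        setIntegral_closedBall_integral_cos hkint, sub_eq_zero]
      let e : Rd d := EuclideanSpace.single ⟨0, hd⟩ 1
      have he : ‖e‖ = 1 := by simp [e]
      let j : ℝ → ℝ := fun s => ∫ x in Metric.closedBall (0 : Rd d) R, Real.cos (inner ℝ (s • e) x)
      have hj : ∀ w : Rd d, ∫ x in Metric.closedBall (0 : Rd d) R, Real.cos (inner ℝ w x)
          = j ‖w‖ := by
        intro w
        have h1 : ∀ v : Rd d, ∫ x in Metric.closedBall (0 : Rd d) R, Real.cos (inner ℝ v x)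
            = ∫ x : Rd d, Real.cos (inner ℝ x v) * (Iic R).indicator 1 ‖x‖ := by
          intro v
          rw [← integral_indicator Metric.isClosed_closedBall.measurableSet]
          congr 1
          ext x
          rw [real_inner_comm]
          simp [indicator]
        rw [h1, integral_cos_radial (y := ‖w‖ • e) (by simp [norm_smul, he]), ← h1]
      simp_rw [hj]
      refine hmom j ?_ ⟨volume.real (Metric.closedBall (0 : Rd d) R), fun s => ?_⟩
      · refine (continuous_of_dominated (bound := fun _ => 1) (fun s => ?_)
          (fun s => ae_of_all _ fun x => Real.abs_cos_le_one _) (integrable_const _)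
          (ae_of_all _ fun x => by fun_prop)).measurable
        exact (by fun_prop : Continuous fun x : Rd d =>
          Real.cos (inner ℝ (s • e) x)).aestronglyMeasurable
      · have h1 := norm_setIntegral_le_of_norm_le_const (μ := volume)
          (f := fun x : Rd d => Real.cos (inner ℝ (s • e) x)) (C := 1)
          (measure_closedBall_lt_top (x := (0 : Rd d)) (r := R))
          (fun x _ => Real.abs_cos_le_one _)
        rwa [one_mul] at h1
  refine ⟨k', hk', ae_eq_of_integral_cexp_eq hF.1 hkint fun x => ?_⟩
  rw [← hF.2, hcos x, integral_cexp_inner_of_even hkint (fun w => by rw [norm_neg])]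

end Radial

/-! ### Fourier transforms of test functions -/

section TestFunctions

variable {d : ℕ}

lemma fourierHat_fderiv {f : Rd d → ℝ} (hf : ContDiff ℝ ∞ f) (hc : HasCompactSupport f)
    (v w : Rd d) :
    fourierHat (fun x => fderiv ℝ f x v) w = Complex.I * ((inner ℝ w v : ℝ) : ℂ) * fourierHat f w := by
  have hf1 : Continuous fun x => fderiv ℝ f x v :=
    (hf.continuous_fderiv (by simp)).clm_apply continuous_const
  have hfi : Integrable f := hf.continuous.integrable_of_hasCompactSupport hc
  have hfi1 : Integrable fun x => fderiv ℝ f x v :=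
    hf1.integrable_of_hasCompactSupport (hc.fderiv_apply ℝ v)
  let e : Rd d → ℂ := fun x => Complex.exp (-(Complex.I * ((inner ℝ w x : ℝ) : ℂ)))
  let e' : Rd d → Rd d →L[ℝ] ℂ := fun x =>
    (e x * (-Complex.I)) • Complex.ofRealCLM.comp (innerSL ℝ w)
  have he : ∀ x, HasFDerivAt e (e' x) x := by
    intro x
    have h1 : HasFDerivAt (fun x : Rd d => -(Complex.I * ((inner ℝ w x : ℝ) : ℂ)))
        ((-Complex.I) • Complex.ofRealCLM.comp (innerSL ℝ w)) x := by
      have h2 := ((-Complex.I) • Complex.ofRealCLM.comp (innerSL ℝ w)).hasFDerivAt (x := x)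
      refine h2.congr_of_eventuallyEq (Eventually.of_forall fun y => ?_)
      simp
    have h3 := h1.cexp
    rw [smul_smul] at h3
    exact h3
  have hg : ∀ x, HasFDerivAt (fun x => (f x : ℂ)) (Complex.ofRealCLM.comp (fderiv ℝ f x)) x :=
    fun x => Complex.ofRealCLM.hasFDerivAt.comp x
      (hf.differentiable (by simp)).differentiableAt.hasFDerivAt
  have h := integral_bilinear_hasFDerivAt_right_eq_neg_left_of_integrable
    (μ := (volume : Measure (Rd d))) (B := ContinuousLinearMap.mul ℝ ℂ) (f := e) (f' := e')
    (g := fun x => (f x : ℂ)) (g' := fun x => Complex.ofRealCLM.comp (fderiv ℝ f x)) (v := v)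
    ?_ ?_ ?_ (fun x _ => he x) (fun x _ => hg x)
  · simp only [ContinuousLinearMap.mul_apply', ContinuousLinearMap.comp_apply,
      Complex.ofRealCLM_apply] at h
    rw [fourierHat, h, fourierHat, ← integral_neg, ← integral_const_mul]
    congr 1
    ext x
    simp [e', e]
    ring
  · have h1 := (integrable_fourierHat_integrand hfi w).const_mul
      (-Complex.I * ((inner ℝ w v : ℝ) : ℂ))
    refine h1.congr (ae_of_all _ fun x => ?_)
    simp [e', e]
    ring
  · exact integrable_fourierHat_integrand hfi1 w
  · exact integrable_fourierHat_integrand hfi w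

lemma fourierHat_sub {f g : Rd d → ℝ} (hf : Integrable f) (hg : Integrable g) (w : Rd d) :
    fourierHat (fun y => f y - g y) w = fourierHat f w - fourierHat g w := by
  have h := fourierHat_add hf (hg.const_mul (-1)) w
  rw [fourierHat_const_mul] at h
  simpa [sub_eq_add_neg] using h

lemma fourierHat_finset_sum {ι : Type*} (s : Finset ι) {f : ι → Rd d → ℝ}
    (hf : ∀ i ∈ s, Integrable (f i)) (w : Rd d) :
    fourierHat (fun y => ∑ i ∈ s, f i y) w = ∑ i ∈ s, fourierHat (f i) w := by
  simp only [fourierHat]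
  rw [← integral_finsetSum _ fun i hi => integrable_fourierHat_integrand (hf i hi) w]
  congr 1
  ext y
  push_cast
  rw [Finset.mul_sum]

/-- The Fourier transform of `(1 - Δ) f`. -/
lemma exists_fourierHat_one_add_sq {f : Rd d → ℝ} (hf : ContDiff ℝ ∞ f)
    (hc : HasCompactSupport f) :
    ∃ p : Rd d → ℝ, ContDiff ℝ ∞ p ∧ HasCompactSupport p ∧
      ∀ w, fourierHat p w = ((1 + ‖w‖ ^ 2 : ℝ) : ℂ) * fourierHat f w := by
  let e : Fin d → Rd d := fun i => EuclideanSpace.single i 1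
  let g : Fin d → Rd d → ℝ := fun i x => fderiv ℝ f x (e i)
  let h : Fin d → Rd d → ℝ := fun i x => fderiv ℝ (g i) x (e i)
  have hD : ∀ {f : Rd d → ℝ}, ContDiff ℝ ∞ f → ∀ v, ContDiff ℝ ∞ fun x => fderiv ℝ f x v :=
    fun hf v => (hf.fderiv_right (m := ∞) (by simp)).clm_apply contDiff_const
  have hg : ∀ i, ContDiff ℝ ∞ (g i) := fun i => hD hf _
  have hh : ∀ i, ContDiff ℝ ∞ (h i) := fun i => hD (hg i) _
  have hgc : ∀ i, HasCompactSupport (g i) := fun i => hc.fderiv_apply ℝ _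
  have hhc : ∀ i, HasCompactSupport (h i) := fun i => (hgc i).fderiv_apply ℝ _
  have hhi : ∀ i, Integrable (h i) := fun i =>
    (hh i).continuous.integrable_of_hasCompactSupport (hhc i)
  have hfi : Integrable f := hf.continuous.integrable_of_hasCompactSupport hc
  -- Here `h i` is the second partial derivative in direction `i`. Each derivative contributes a
  -- factor `i w_i`, so `-Δ` becomes multiplication by `|w|²`.
  refine ⟨fun x => f x - ∑ i, h i x, ?_, ?_, fun w => ?_⟩
  · exact hf.sub (ContDiff.sum fun i _ => hh i)
  · refine hc.sub ?_
    refine HasCompactSupport.of_support_subset_isCompact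
      (isCompact_iUnion fun i => (hhc i).isCompact) fun x hx => ?_
    obtain ⟨i, -, hi⟩ := Finset.exists_ne_zero_of_sum_ne_zero (Function.mem_support.1 hx)
    exact mem_iUnion.2 ⟨i, subset_tsupport _ hi⟩
  · rw [fourierHat_sub hfi (integrable_finsetSum _ fun i _ => hhi i),
      fourierHat_finset_sum _ fun i _ => hhi i]
    have h1 : ∀ i, fourierHat (h i) w = -((w i ^ 2 : ℝ) : ℂ) * fourierHat f w := by
      intro i
      rw [fourierHat_fderiv (hg i) (hgc i), fourierHat_fderiv hf hc, ← mul_assoc]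
      congr 1
      have h2 : inner ℝ w (e i) = w i := by simp [e, EuclideanSpace.inner_single_right]
      rw [h2, mul_mul_mul_comm, Complex.I_mul_I]
      push_cast
      ring
    simp_rw [h1]
    rw [← Finset.sum_mul, EuclideanSpace.norm_sq_eq]
    simp_rw [Real.norm_eq_abs, sq_abs]
    push_cast
    simp
    ring

lemma fourierHat_rescale (f : Rd d → ℝ) {ε : ℝ} (hε : 0 < ε) (w : Rd d) :
    fourierHat (rescale f ε) w = fourierHat f (ε • w) := by
  have h := Measure.integral_comp_smul (volume : Measure (Rd d))
    (fun x => Complex.exp (-(Complex.I * ((inner ℝ w (ε • x) : ℝ) : ℂ))) * (f x : ℂ)) ε⁻¹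
  rw [finrank_euclideanSpace_fin] at h
  have h2 : |(ε⁻¹ ^ d)⁻¹| = ε ^ d := by
    rw [inv_pow, inv_inv, abs_of_pos (by positivity)]
  rw [h2] at h
  have h3 : fourierHat f (ε • w)
      = ∫ x, Complex.exp (-(Complex.I * ((inner ℝ w (ε • x) : ℝ) : ℂ))) * (f x : ℂ) := by
    simp_rw [fourierHat, inner_smul_left, inner_smul_right]
    rfl
  have hne : ε ^ d ≠ 0 := by positivity
  rw [h3, ← inv_smul_smul₀ hne (∫ x, Complex.exp (-(Complex.I * ((inner ℝ w (ε • x) : ℝ) : ℂ)))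
    * (f x : ℂ)), ← h, ← integral_smul, fourierHat]
  congr 1
  ext x
  rw [smul_inv_smul₀ hε.ne', rescale, Complex.real_smul]
  push_cast
  ring

lemma contDiff_rescale {f : Rd d → ℝ} (hf : ContDiff ℝ ∞ f) (ε : ℝ) : ContDiff ℝ ∞ (rescale f ε) :=
  contDiff_const.mul (hf.comp (contDiff_const_smul _))

lemma hasCompactSupport_rescale {f : Rd d → ℝ} (hf : HasCompactSupport f) {ε : ℝ} (hε : 0 < ε) :
    HasCompactSupport (rescale f ε) :=
  (hf.comp_smul (inv_ne_zero hε.ne')).mul_left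

open FourierTransform in
lemma contDiff_fourierHat {f : Rd d → ℝ} (hf : ContDiff ℝ ∞ f) (hc : HasCompactSupport f) :
    ContDiff ℝ ∞ (fourierHat f) := by
  have h1 : ContDiff ℝ ∞ fun x => (f x : ℂ) := Complex.ofRealCLM.contDiff.comp hf
  have h2 : HasCompactSupport fun x => (f x : ℂ) := hc.comp_left Complex.ofReal_zero
  have h3 : fourierHat f = fun w => 𝓕 (h2.toSchwartzMap h1) ((2 * Real.pi)⁻¹ • w) := by
    ext w
    rw [fourierHat_eq_fourier, SchwartzMap.fourier_coe]
    rfl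
  rw [h3]
  exact ((𝓕 (h2.toSchwartzMap h1)).smooth ⊤).comp (contDiff_const_smul _)

lemma fourierHat_zero (f : Rd d → ℝ) : fourierHat f 0 = ((∫ x, f x : ℝ) : ℂ) := by
  rw [fourierHat, ← integral_complex_ofReal]
  simp

/-- Quadratic decay of the transform of a test function. -/
lemma exists_norm_fourierHat_le {f : Rd d → ℝ} (hf : ContDiff ℝ ∞ f) (hc : HasCompactSupport f) :
    ∃ C, ∀ w, ‖fourierHat f w‖ * (1 + ‖w‖ ^ 2) ≤ C := by
  obtain ⟨p, -, -, hp⟩ := exists_fourierHat_one_add_sq hf hc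
  refine ⟨∫ x, ‖p x‖, fun w => ?_⟩
  have h := norm_fourierHat_le p w
  rwa [hp, norm_mul, Complex.norm_real, Real.norm_eq_abs, abs_of_pos (by positivity),
    mul_comm] at h

/-- Vanishing derivatives of orders `1, …, d - 1` at the origin give a Taylor bound of order `d`. -/
lemma exists_taylor_bound (hd : 1 ≤ d) {F : Rd d → ℂ} (hF : ContDiff ℝ ∞ F)
    (h0 : ∀ k : ℕ, 1 ≤ k → k < d → ∀ j : Fin k → Fin d,
      iteratedFDeriv ℝ k F 0 (fun i => EuclideanSpace.single (j i) (1 : ℝ)) = 0) :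
    ∃ C ≥ 0, ∀ w, ‖w‖ ≤ 1 → ‖F w - F 0‖ ≤ C * ‖w‖ ^ d := by
  obtain ⟨n, rfl⟩ : ∃ n, d = n + 1 := ⟨d - 1, by omega⟩
  have hcont : Continuous fun w => iteratedFDeriv ℝ (n + 1) F w :=
    hF.continuous_iteratedFDeriv (m := n + 1) (by exact_mod_cast le_top)
  obtain ⟨M, hM⟩ := (isCompact_closedBall (0 : Rd (n + 1)) 1).exists_bound_of_continuousOn
    hcont.continuousOn
  have hM0 : 0 ≤ M := (norm_nonneg _).trans (hM 0 (by simp))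
  refine ⟨M, hM0, fun w hw => ?_⟩
  have h1 := map_add_eq_sum_add_integral_iteratedFDeriv (f := F) (x := 0) (y := w) (n := n)
    (fun t _ => (hF.of_le (by exact_mod_cast le_top)).contDiffAt)
  -- A multilinear map vanishing on all tuples of basis vectors is zero. Hence only the constant
  -- term and the order-`d` integral remainder survive in Taylor's formula.
  have hz : ∀ k : ℕ, 1 ≤ k → k < n + 1 → iteratedFDeriv ℝ k F 0 = 0 := by
    intro k hk hk'
    have h2 : (iteratedFDeriv ℝ k F 0).toMultilinearMap = 0 :=
      Module.Basis.ext_multilinear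
        (fun _ => (EuclideanSpace.basisFun (Fin (n + 1)) ℝ).toBasis) fun v => by
          simpa using h0 k hk hk' v
    exact ContinuousMultilinearMap.toMultilinearMap_injective h2
  rw [Finset.sum_range_succ', Finset.sum_eq_zero, zero_add, zero_add] at h1
  · simp only [Nat.factorial_zero, Nat.cast_one, inv_one, one_smul, iteratedFDeriv_zero_apply] at h1
    rw [h1, add_sub_cancel_left, norm_smul]
    have h3 : ‖∫ t in (0 : ℝ)..1, (1 - t) ^ n • iteratedFDeriv ℝ (n + 1) F (0 + t • w)
        (fun _ => w)‖ ≤ M * ‖w‖ ^ (n + 1) * |1 - 0| := by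
      refine intervalIntegral.norm_integral_le_of_norm_le_const fun t ht => ?_
      rw [uIoc_of_le zero_le_one] at ht
      rw [norm_smul, norm_pow, Real.norm_eq_abs, abs_of_nonneg (by linarith [ht.2])]
      have h4 : (1 - t) ^ n ≤ 1 := pow_le_one₀ (by linarith [ht.2]) (by linarith [ht.1])
      have h5 : ‖iteratedFDeriv ℝ (n + 1) F (0 + t • w) (fun _ => w)‖ ≤ M * ‖w‖ ^ (n + 1) := by
        refine (ContinuousMultilinearMap.le_opNorm _ _).trans ?_
        rw [Finset.prod_const, Finset.card_univ, Fintype.card_fin]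
        gcongr
        refine hM _ ?_
        rw [zero_add, mem_closedBall_zero_iff, norm_smul, Real.norm_eq_abs, abs_of_pos ht.1]
        exact mul_le_one₀ ht.2 (norm_nonneg _) hw
      calc (1 - t) ^ n * ‖iteratedFDeriv ℝ (n + 1) F (0 + t • w) (fun _ => w)‖
          ≤ 1 * (M * ‖w‖ ^ (n + 1)) := by gcongr
        _ = M * ‖w‖ ^ (n + 1) := one_mul _
    have h6 : ‖((n.factorial : ℝ))⁻¹‖ ≤ 1 := by
      rw [norm_inv, Real.norm_natCast]
      exact inv_le_one_of_one_le₀ (by exact_mod_cast n.factorial_pos)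
    calc _ ≤ 1 * (M * ‖w‖ ^ (n + 1) * |1 - 0|) := by gcongr
      _ = M * ‖w‖ ^ (n + 1) := by simp
  · intro k hk
    rw [Finset.mem_range] at hk
    rw [hz (k + 1) (by omega) (by omega)]
    simp

/-- The behaviour at the origin of the transform of a mollifier satisfying (A1) and (A2). -/
lemma exists_mollifier_bounds (hd : 1 ≤ d) {ρ : Rd d → ℝ} (hA1 : AssumptionA1 ρ)
    (hA2 : AssumptionA2 ρ) :
    ∃ r ∈ Ioo (0 : ℝ) 1, ∃ C > 0, ∀ w, ‖w‖ ≤ r → ‖fourierHat ρ w‖ ^ 2 ≤ 1 ∧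
      1 / 2 ≤ ‖fourierHat ρ w‖ ^ 2 ∧ 1 - ‖fourierHat ρ w‖ ^ 2 ≤ C * ‖w‖ ^ d := by
  have hF := contDiff_fourierHat hA1.smooth hA1.compactSupport
  have h0 : fourierHat ρ 0 = 1 := by rw [fourierHat_zero, hA1.unitMass]; simp
  obtain ⟨C, hC, hT⟩ := exists_taylor_bound hd hF hA2.derivZero
  have h1 : ∀ᶠ w in 𝓝 (0 : Rd d), ‖fourierHat ρ w‖ ≤ 1 := by
    have := hA2.localMax
    simp only [IsLocalMax, IsMaxFilter, h0, norm_one] at this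
    exact this
  have h2 : ∀ᶠ w in 𝓝 (0 : Rd d), 1 / 2 < ‖fourierHat ρ w‖ ^ 2 := by
    have hc : Continuous fun w => ‖fourierHat ρ w‖ ^ 2 := hF.continuous.norm.pow 2
    refine hc.continuousAt.eventually (lt_mem_nhds ?_)
    change 1 / 2 < ‖fourierHat ρ 0‖ ^ 2
    rw [h0]
    norm_num
  obtain ⟨r, hr, hb⟩ := Metric.eventually_nhds_iff_ball.1 (h1.and h2)
  -- The radius stays strictly inside the neighbourhood of (A2) and below one, where the Taylor
  -- bound applies. Since `|ρ̂| ≤ 1` there, `1 - |ρ̂|² ≤ 2 (1 - |ρ̂|)`, which costs the factor 2.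
  -- The extra `+ 1` only keeps the constant positive.
  refine ⟨min (r / 2) (1 / 2), ⟨by positivity, ?_⟩, 2 * C + 1, by positivity, fun w hw => ?_⟩
  · exact (min_le_right _ _).trans_lt (by norm_num)
  have hw1 : ‖w‖ < r := by linarith [hw.trans (min_le_left _ _)]
  have hw2 : ‖w‖ ≤ 1 := by linarith [hw.trans (min_le_right _ _)]
  obtain ⟨h3, h4⟩ := hb w (by simpa using hw1)
  refine ⟨pow_le_one₀ (norm_nonneg _) h3, h4.le, ?_⟩
  have h5 := hT w hw2
  rw [h0] at h5
  have h6 : 1 - ‖fourierHat ρ w‖ ≤ ‖fourierHat ρ w - 1‖ := by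
    have := norm_sub_norm_le (1 : ℂ) (fourierHat ρ w)
    rwa [norm_one, norm_sub_rev] at this
  have h7 : 0 ≤ ‖w‖ ^ d := by positivity
  nlinarith [norm_nonneg (fourierHat ρ w)]

end TestFunctions

/-! ### Radial profiles and their mixtures over scales -/

section RadialProfile

variable {d : ℕ}

/-- The mass `∫_{0 < y ≤ R} y^{d-1} k(y) dy` of a radial profile. -/
noncomputable def radialMass (d : ℕ) (k : ℝ → ℝ) (R : ℝ) : ℝ :=
  ∫ y in Ioc (0 : ℝ) R, y ^ (d - 1) * k y

/-- A nonnegative profile whose mass is constant equal to `σ` beyond radius one and comparable to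
`R^d` below. -/
structure IsRadialProfile (d : ℕ) (σ c C : ℝ) (k : ℝ → ℝ) : Prop where
  measurable : Measurable k
  nonneg : ∀ y, 0 ≤ k y
  integrableOn : IntegrableOn (fun y => y ^ (d - 1) * k y) (Ioi 0)
  total : ∀ R, 1 ≤ R → radialMass d k R = σ
  lower : ∀ R, 0 < R → R < 1 → c * R ^ d ≤ radialMass d k R
  upper : ∀ R, 0 < R → R < 1 → radialMass d k R ≤ C * R ^ d

/-- The spectral density `R ↦ R^{-d} ∫_0^R y^{d-1} k(y) dy` of the scale mixture of `k`. -/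
noncomputable def scaleDensity (d : ℕ) (k : ℝ → ℝ) (R : ℝ) : ℝ := (R ^ d)⁻¹ * radialMass d k R

namespace IsRadialProfile

variable {σ c C : ℝ} {k : ℝ → ℝ}

lemma integrableOn_Ioc (h : IsRadialProfile d σ c C k) (R : ℝ) :
    IntegrableOn (fun y => y ^ (d - 1) * k y) (Ioc 0 R) :=
  h.integrableOn.mono_set Ioc_subset_Ioi_self

lemma mono (h : IsRadialProfile d σ c C k) : Monotone (radialMass d k) := by
  intro R R' hR
  refine setIntegral_mono_set (h.integrableOn_Ioc R') ?_ (Ioc_subset_Ioc_right hR).eventuallyLE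
  filter_upwards [ae_restrict_mem measurableSet_Ioc] with y hy
  exact mul_nonneg (pow_nonneg hy.1.le _) (h.nonneg y)

lemma mass_nonneg (h : IsRadialProfile d σ c C k) (R : ℝ) : 0 ≤ radialMass d k R :=
  setIntegral_nonneg measurableSet_Ioc fun y hy => mul_nonneg (pow_nonneg hy.1.le _) (h.nonneg y)

lemma mass_le (h : IsRadialProfile d σ c C k) (R : ℝ) : radialMass d k R ≤ σ := by
  rw [← h.total (max R 1) (le_max_right _ _)]
  exact h.mono (le_max_left _ _)

lemma sigma_nonneg (h : IsRadialProfile d σ c C k) : 0 ≤ σ := (h.mass_nonneg 0).trans (h.mass_le 0)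

lemma measurable_mass (h : IsRadialProfile d σ c C k) : Measurable (radialMass d k) :=
  h.mono.measurable

lemma measurable_scaleDensity (h : IsRadialProfile d σ c C k) : Measurable (scaleDensity d k) :=
  (measurable_id.pow_const d).inv.mul h.measurable_mass

lemma scaleDensity_nonneg (h : IsRadialProfile d σ c C k) {R : ℝ} (hR : 0 ≤ R) :
    0 ≤ scaleDensity d k R :=
  mul_nonneg (inv_nonneg.2 (pow_nonneg hR _)) (h.mass_nonneg R)

lemma scaleDensity_le (h : IsRadialProfile d σ c C k) {R : ℝ} (hR : 0 < R) :
    scaleDensity d k R ≤ max C σ := by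
  rw [scaleDensity, inv_mul_le_iff₀ (by positivity)]
  rcases lt_or_ge R 1 with h1 | h1
  · refine (h.upper R hR h1).trans ?_
    rw [mul_comm]
    exact mul_le_mul_of_nonneg_left (le_max_left _ _) (by positivity)
  · refine (h.mass_le R).trans ?_
    have h2 : σ ≤ max C σ := le_max_right _ _
    have h3 : 1 ≤ R ^ d := one_le_pow₀ h1
    nlinarith [h.sigma_nonneg]

/-- Bounded near the origin and of order `R^{-d}` at infinity: the two regimes are joined in one
bound, with `1 + R ≤ 2` below radius one and `1 + R ≤ 2R` above. -/
lemma scaleDensity_le_one_add (h : IsRadialProfile d σ c C k) {R : ℝ} (hR : 0 < R) :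
    scaleDensity d k R ≤ 2 ^ d * max C σ * ((1 + R) ^ d)⁻¹ := by
  have hs := h.sigma_nonneg
  have h2 : σ ≤ max C σ := le_max_right _ _
  rw [← div_eq_mul_inv, le_div_iff₀ (by positivity)]
  rcases lt_or_ge R 1 with h1 | h1
  · have h3 : (1 + R) ^ d ≤ 2 ^ d := pow_le_pow_left₀ (by positivity) (by linarith) _
    calc scaleDensity d k R * (1 + R) ^ d ≤ max C σ * 2 ^ d :=
          mul_le_mul (h.scaleDensity_le hR) h3 (by positivity) (hs.trans h2)
      _ = _ := by ring
  · have h3 : (1 + R) ^ d ≤ (2 * R) ^ d := pow_le_pow_left₀ (by positivity) (by linarith) _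
    have h4 : radialMass d k R ≤ max C σ := (h.mass_le R).trans h2
    calc scaleDensity d k R * (1 + R) ^ d ≤ scaleDensity d k R * (2 * R) ^ d :=
          mul_le_mul_of_nonneg_left h3 (h.scaleDensity_nonneg hR.le)
      _ = 2 ^ d * radialMass d k R := by
          rw [scaleDensity, mul_pow]
          field_simp
      _ ≤ _ := mul_le_mul_of_nonneg_left h4 (by positivity)

lemma ae_norm_pos (hd : 1 ≤ d) : ∀ᵐ w : Rd d, 0 < ‖w‖ := by
  have := nontrivial_Rd hd
  have : ∀ᵐ w : Rd d, w ∉ ({0} : Set (Rd d)) := measure_eq_zero_iff_ae_notMem.1 (by simp)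
  filter_upwards [this] with w hw
  exact norm_pos_iff.2 hw

/-- A decay of order `|w|^{-d}` alone diverges logarithmically, as befits a log-correlated field.
The quartic denominator, matching two factors with quadratic Fourier decay, is more than enough. -/
lemma integrable_scaleDensity_div (hd : 1 ≤ d) (h : IsRadialProfile d σ c C k) :
    Integrable fun w : Rd d => scaleDensity d k ‖w‖ / (1 + ‖w‖ ^ 2) ^ 2 := by
  have h1 : Integrable fun w : Rd d =>
      -- Any exponent above `d` would do; `d + 2` follows from `(1 + R)² ≤ 2 (1 + R²)²`.
      (2 ^ d * max C σ * 2) * (1 + ‖w‖) ^ (-((d + 2 : ℕ) : ℝ)) := by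
    refine (integrable_one_add_norm ?_).const_mul _
    rw [finrank_euclideanSpace_fin]
    push_cast
    linarith
  refine h1.mono' ?_ ?_
  · exact ((h.measurable_scaleDensity.comp measurable_norm).div
      (by fun_prop)).aestronglyMeasurable
  · filter_upwards [ae_norm_pos hd] with w hw
    have hM : 0 ≤ max C σ := h.sigma_nonneg.trans (le_max_right _ _)
    have h2 := h.scaleDensity_nonneg hw.le
    rw [Real.norm_of_nonneg (by positivity), Real.rpow_neg (by positivity), Real.rpow_natCast,
      div_le_iff₀ (by positivity)]
    refine (h.scaleDensity_le_one_add hw).trans ?_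
    rw [pow_add, mul_inv]
    have h3 : 1 ≤ 2 * ((1 + ‖w‖) ^ 2)⁻¹ * (1 + ‖w‖ ^ 2) ^ 2 := by
      rw [mul_assoc, mul_comm, mul_assoc, ← div_eq_inv_mul, le_div_iff₀ (by positivity)]
      nlinarith [sq_nonneg (‖w‖ - 1), sq_nonneg (‖w‖ ^ 2)]
    calc 2 ^ d * max C σ * ((1 + ‖w‖) ^ d)⁻¹
        ≤ 2 ^ d * max C σ * ((1 + ‖w‖) ^ d)⁻¹ *
          (2 * ((1 + ‖w‖) ^ 2)⁻¹ * (1 + ‖w‖ ^ 2) ^ 2) :=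
          le_mul_of_one_le_right (by positivity) h3
      _ = _ := by ring

end IsRadialProfile

section ScaleIntegral

variable {k : ℝ → ℝ}

lemma hasDerivAt_exp_neg_mul (R r : ℝ) :
    HasDerivAt (fun r : ℝ => Real.exp (-r) * R) (-(Real.exp (-r) * R)) r := by
  exact (((hasDerivAt_neg r).exp).mul_const R).congr_deriv (by ring)

lemma injective_exp_neg_mul {R : ℝ} (hR : 0 < R) :
    Function.Injective fun r : ℝ => Real.exp (-r) * R := by
  intro r r' h
  have := mul_right_cancel₀ hR.ne' h
  simpa using this

lemma abs_deriv_smul_eq (hd : 1 ≤ d) {R : ℝ} (hR : 0 < R) (r : ℝ) :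
    |(-(Real.exp (-r) * R))| • ((Real.exp (-r) * R) ^ (d - 1) * k (Real.exp (-r) * R))
      = R ^ d * (Real.exp (-(d * r)) * k (Real.exp (-r) * R)) := by
  have h1 : Real.exp (-(d * r)) = Real.exp (-r) ^ d := by
    rw [← Real.exp_nat_mul]
    ring_nf
  obtain ⟨e, rfl⟩ : ∃ e, d = e + 1 := ⟨d - 1, by omega⟩
  rw [abs_neg, abs_of_pos (by positivity), smul_eq_mul, h1, Nat.add_sub_cancel]
  ring

/-- Substitution `y = e^{-r} R`: the Jacobian supplies one power of `y`, and the factor `e^{-dr} =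
(y/R)^d` supplies the rest. -/
lemma setIntegral_exp_scale (hd : 1 ≤ d) {R : ℝ} (hR : 0 < R) {S : Set ℝ}
    (hS : MeasurableSet S) :
    ∫ r in S, Real.exp (-(d * r)) * k (Real.exp (-r) * R)
      = (R ^ d)⁻¹ * ∫ y in (fun r : ℝ => Real.exp (-r) * R) '' S, y ^ (d - 1) * k y := by
  rw [integral_image_eq_integral_abs_deriv_smul hS
    (fun r _ => (hasDerivAt_exp_neg_mul R r).hasDerivWithinAt) (injective_exp_neg_mul hR).injOn]
  simp_rw [abs_deriv_smul_eq hd hR]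
  rw [integral_const_mul, inv_mul_cancel_left₀ (by positivity)]

lemma integrableOn_exp_scale (hd : 1 ≤ d) {R : ℝ} (hR : 0 < R) {S : Set ℝ} (hS : MeasurableSet S)
    (h : IntegrableOn (fun y => y ^ (d - 1) * k y) (Ioi 0)) :
    IntegrableOn (fun r => Real.exp (-(d * r)) * k (Real.exp (-r) * R)) S := by
  have h1 : IntegrableOn (fun y => y ^ (d - 1) * k y)
      ((fun r : ℝ => Real.exp (-r) * R) '' S) := by
    refine h.mono_set ?_
    rintro _ ⟨r, -, rfl⟩
    exact mul_pos (Real.exp_pos _) hR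
  rw [integrableOn_image_iff_integrableOn_abs_deriv_smul hS
    (fun r _ => (hasDerivAt_exp_neg_mul R r).hasDerivWithinAt)
    (injective_exp_neg_mul hR).injOn] at h1
  simp_rw [abs_deriv_smul_eq hd hR] at h1
  refine (h1.const_mul (R ^ d)⁻¹).congr (ae_of_all _ fun r => ?_)
  exact inv_mul_cancel_left₀ (by positivity) _

lemma image_exp_neg_mul {R : ℝ} (hR : 0 < R) {S T : Set ℝ}
    (h : ∀ y, y ∈ T ↔ 0 < y ∧ Real.log (R / y) ∈ S) :
    (fun r : ℝ => Real.exp (-r) * R) '' S = T := by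
  ext y
  rw [h]
  constructor
  · rintro ⟨r, hr, rfl⟩
    refine ⟨by positivity, ?_⟩
    rwa [div_mul_cancel_right₀ hR.ne', Real.exp_neg, inv_inv, Real.log_exp]
  · rintro ⟨hy, hr⟩
    refine ⟨_, hr, ?_⟩
    simp only
    rw [Real.exp_neg, Real.exp_log (by positivity)]
    field_simp

lemma setIntegral_Ioi_exp_scale (hd : 1 ≤ d) {R : ℝ} (hR : 0 < R) :
    ∫ r in Ioi (0 : ℝ), Real.exp (-(d * r)) * k (Real.exp (-r) * R) = scaleDensity d k R := by
  rw [setIntegral_exp_scale hd hR measurableSet_Ioi, image_exp_neg_mul (T := Ioo 0 R) hR,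
    scaleDensity, radialMass, integral_Ioc_eq_integral_Ioo]
  intro y
  refine ⟨fun hy => ⟨hy.1, Real.log_pos ?_⟩, fun hy => ⟨hy.1, ?_⟩⟩
  · rw [one_lt_div hy.1]
    exact hy.2
  · have := (Real.log_pos_iff (by have := hy.1; positivity)).1 hy.2
    rwa [one_lt_div hy.1] at this

/-- Under `y = e^{-r} R` the scales `0 < r < t` sweep the radii between `e^{-t} R` and `R`, so a
difference of radial masses appears. -/
lemma setIntegral_Ioo_exp_scale (hd : 1 ≤ d) {R t : ℝ} (hR : 0 < R) (ht : 0 ≤ t)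
    (h : IntegrableOn (fun y => y ^ (d - 1) * k y) (Ioi 0)) :
    ∫ r in Ioo (0 : ℝ) t, Real.exp (-(d * r)) * k (Real.exp (-r) * R)
      = (R ^ d)⁻¹ * (radialMass d k R - radialMass d k (Real.exp (-t) * R)) := by
  have hpos : 0 < Real.exp (-t) * R := by positivity
  have hle : Real.exp (-t) * R ≤ R :=
    mul_le_of_le_one_left hR.le (Real.exp_le_one_iff.2 (by linarith))
  rw [setIntegral_exp_scale hd hR measurableSet_Ioo,
    image_exp_neg_mul (T := Ioo (Real.exp (-t) * R) R) hR, ← integral_Ioc_eq_integral_Ioo]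
  · congr 1
    rw [radialMass, radialMass, ← Ioc_union_Ioc_eq_Ioc hpos.le hle,
      setIntegral_union (Ioc_disjoint_Ioc_of_le le_rfl) measurableSet_Ioc
        (h.mono_set Ioc_subset_Ioi_self) (h.mono_set fun y hy => hpos.trans hy.1)]
    ring
  · intro y
    have key : ∀ y, 0 < y → ((Real.exp (-t) * R < y) ↔ Real.log (R / y) < t) := by
      intro y hy
      rw [Real.log_lt_iff_lt_exp (by positivity), div_lt_iff₀ hy, Real.exp_neg,
        inv_mul_lt_iff₀ (Real.exp_pos _)]
    have key2 : ∀ y, 0 < y → (y < R ↔ 0 < Real.log (R / y)) := by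
      intro y hy
      rw [Real.log_pos_iff (by positivity), one_lt_div hy]
    constructor
    · intro hy
      have h0 := hpos.trans hy.1
      exact ⟨h0, (key2 y h0).1 hy.2, (key y h0).1 hy.1⟩
    · rintro ⟨h0, h1, h2⟩
      exact ⟨(key y h0).2 h2, (key2 y h0).2 h1⟩

lemma integral_comp_exp_smul (f : Rd d → ℝ) (r : ℝ) :
    ∫ w, f (Real.exp r • w) * k ‖w‖
      = ∫ w, f w * (Real.exp (-(d * r)) * k (Real.exp (-r) * ‖w‖)) := by
  have h := Measure.integral_comp_smul (volume : Measure (Rd d))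
    (fun w => f w * k (Real.exp (-r) * ‖w‖)) (Real.exp r)
  rw [finrank_euclideanSpace_fin] at h
  have h1 : ∀ w : Rd d, Real.exp (-r) * ‖Real.exp r • w‖ = ‖w‖ := by
    intro w
    rw [norm_smul, Real.norm_of_nonneg (Real.exp_pos _).le, ← mul_assoc, ← Real.exp_add]
    simp
  simp only [h1] at h
  rw [h, abs_of_pos (by positivity), smul_eq_mul, ← integral_const_mul]
  congr 1
  ext w
  have h2 : (Real.exp r ^ d)⁻¹ = Real.exp (-(d * r)) := by
    rw [← Real.exp_nat_mul, Real.exp_neg]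
  rw [h2]
  ring

/-- Fubini and scaling: mixing dilates of a radial spectral density. -/
lemma integrable_and_integral_scale_mixture (hd : 1 ≤ d) (hk : Measurable k)
    (hk0 : ∀ y, 0 ≤ k y) (hki : IntegrableOn (fun y => y ^ (d - 1) * k y) (Ioi 0)) {S : Set ℝ}
    (hS : MeasurableSet S) {f : Rd d → ℝ} (hf : Measurable f)
    (hfi : Integrable fun w =>
      f w * ∫ r in S, Real.exp (-(d * r)) * k (Real.exp (-r) * ‖w‖)) :
    IntegrableOn (fun r => ∫ w, f (Real.exp r • w) * k ‖w‖) S ∧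
    ∫ r in S, ∫ w, f (Real.exp r • w) * k ‖w‖
      = ∫ w, f w * ∫ r in S, Real.exp (-(d * r)) * k (Real.exp (-r) * ‖w‖) := by
  have hprod : Integrable (Function.uncurry fun (r : ℝ) (w : Rd d) =>
      f w * (Real.exp (-(d * r)) * k (Real.exp (-r) * ‖w‖)))
      ((volume.restrict S).prod volume) := by
    have hm : Measurable (Function.uncurry fun (r : ℝ) (w : Rd d) =>
      f w * (Real.exp (-(d * r)) * k (Real.exp (-r) * ‖w‖))) := by
      refine (hf.comp measurable_snd).mul (Measurable.mul (by fun_prop) (hk.comp (by fun_prop)))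
    -- Because `k` is nonnegative, the integral over scales of the absolute value is `|f|` times the
    -- same inner integral. Hence `hfi` is exactly the absolute integrability that Fubini requires.
    rw [integrable_prod_iff' hm.aestronglyMeasurable]
    constructor
    · filter_upwards [IsRadialProfile.ae_norm_pos hd] with w hw
      exact (integrableOn_exp_scale hd hw hS hki).const_mul (f w)
    · refine hfi.norm.congr (ae_of_all _ fun w => ?_)
      have h0 : ∀ r, 0 ≤ Real.exp (-(d * r)) * k (Real.exp (-r) * ‖w‖) := fun r =>
        mul_nonneg (Real.exp_pos _).le (hk0 _)
      simp only [Function.uncurry, norm_mul, integral_const_mul]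
      rw [Real.norm_of_nonneg (integral_nonneg h0)]
      congr 2
      ext r
      rw [← norm_mul, Real.norm_of_nonneg (h0 r)]
  simp_rw [integral_comp_exp_smul]
  refine ⟨hprod.integral_prod_left, ?_⟩
  rw [integral_integral_swap hprod]
  simp_rw [integral_const_mul]

end ScaleIntegral

/-- The radial profile of the spectral density of the seed covariance. -/
theorem exists_radialProfile (hd : 1 ≤ d) {K Khat : Rd d → ℝ} (hF : IsFourierTransformOf Khat K)
    (hK1 : AssumptionK1 K) (hs : ∀ w, 1 < ‖w‖ → Khat w = 0) (h0 : ∀ᵐ w, 0 ≤ Khat w) {c C : ℝ}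
    (hb : ∀ w : Rd d, ‖w‖ < 1 →
      c * ‖w‖ ^ d ≤ ∫ η in Metric.closedBall (0 : Rd d) ‖w‖, Khat η ∧
      ∫ η in Metric.closedBall (0 : Rd d) ‖w‖, Khat η ≤ C * ‖w‖ ^ d) :
    ∃ k, IsRadialProfile d (d * volume.real (Metric.ball (0 : Rd d) 1))⁻¹
        (c / (d * volume.real (Metric.ball (0 : Rd d) 1)))
        (C / (d * volume.real (Metric.ball (0 : Rd d) 1))) k ∧
      Integrable (fun w : Rd d => k ‖w‖) ∧
      ∀ x : Rd d, K x = ∫ w : Rd d, Real.cos (inner ℝ w x) * k ‖w‖ := by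
  have := nontrivial_Rd hd
  obtain ⟨k₀, hk₀, hkeq⟩ := exists_radial_of_radial_transform hd hF hK1.radial hs
  -- Truncating at radius one and taking the positive part changes the profile only on a null set of
  -- frequencies, and makes its nonnegativity hold everywhere.
  let k : ℝ → ℝ := (Iic 1).indicator fun y => max (k₀ y) 0
  have hk : Measurable k := (hk₀.max measurable_const).indicator measurableSet_Iic
  have hkn : ∀ y, 0 ≤ k y := fun y => indicator_nonneg (fun _ _ => le_max_right _ _) y
  have heq : Khat =ᵐ[volume] fun w => k ‖w‖ := by
    filter_upwards [hkeq, h0] with w h1 h2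
    simp only [k]
    by_cases hw : ‖w‖ ≤ 1
    · rw [indicator_of_mem (show ‖w‖ ∈ Iic (1 : ℝ) from hw), ← h1, max_eq_left h2]
    · rw [indicator_of_notMem (show ‖w‖ ∉ Iic (1 : ℝ) from hw), hs w (not_le.1 hw)]
  have hki : Integrable (fun w : Rd d => k ‖w‖) := hF.1.congr heq
  have hK : ∀ x, K x = ∫ w : Rd d, Real.cos (inner ℝ w x) * k ‖w‖ := by
    intro x
    rw [hF.eq_cos x]
    refine integral_congr_ae ?_
    filter_upwards [heq] with w hw
    rw [hw]
  have hs0 := sphereConst_pos hd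
  set s := d * volume.real (Metric.ball (0 : Rd d) 1) with hsdef
  have hball : ∀ R, radialMass d k R = (∫ w in Metric.closedBall (0 : Rd d) R, Khat w) / s := by
    intro R
    rw [setIntegral_congr_ae (g := fun w => k ‖w‖) Metric.isClosed_closedBall.measurableSet
      (heq.mono fun w hw _ => hw), setIntegral_closedBall_norm hd, radialMass, ← hsdef,
      mul_div_cancel_left₀ _ hs0.ne']
  have hnorm : ∀ R, 0 < R → ∃ w : Rd d, ‖w‖ = R := fun R hR => exists_norm_eq _ hR.le
  refine ⟨k, ⟨hk, hkn, ?_, ?_, ?_, ?_⟩, hki, hK⟩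
  · have := (integrable_fun_norm_addHaar (volume : Measure (Rd d)) (f := k)).1 hki
    rw [finrank_euclideanSpace_fin] at this
    simpa only [smul_eq_mul] using this
  · intro R hR
    -- Beyond radius one the ball carries the whole mass of `Khat`, which is `K 0 = 1`. Dividing by
    -- the surface area of the unit sphere gives `σ`.
    have h1 := hK 0
    simp only [inner_zero_right, Real.cos_zero, one_mul, hK1.one] at h1
    rw [hball, setIntegral_eq_integral_of_forall_compl_eq_zero, integral_congr_ae heq, ← h1,
      one_div]
    intro w hw
    refine hs w (hR.trans_lt ?_)
    simpa using hw
  · intro R hR hR1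
    obtain ⟨w, rfl⟩ := hnorm R hR
    rw [hball, div_mul_eq_mul_div]
    exact div_le_div_of_nonneg_right (hb w hR1).1 hs0.le
  · intro R hR hR1
    obtain ⟨w, rfl⟩ := hnorm R hR
    rw [hball, div_mul_eq_mul_div]
    exact div_le_div_of_nonneg_right (hb w hR1).2 hs0.le

end RadialProfile

/-! ### Wiener integrals as centred Gaussian processes -/

section WhiteNoiseIntegral

variable {Ω S T : Type*} [MeasurableSpace Ω] [MeasurableSpace S] {μ : Measure S}
  {ξ : Lp ℝ 2 μ → Ω → ℝ} {P : Measure Ω}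

lemma IsWhiteNoise.measurable_wienerIntegral (hξ : IsWhiteNoise ξ P) (f : S → ℝ) :
    Measurable (wienerIntegral ξ f) := by
  unfold wienerIntegral
  split_ifs with h
  · exact hξ.measurable _
  · exact measurable_const

lemma IsWhiteNoise.isCentredGaussian (hξ : IsWhiteNoise ξ P) {F : T → S → ℝ}
    (hF : ∀ t, MemLp (F t) 2 μ) :
    IsCentredGaussian (fun t => wienerIntegral ξ (F t)) (fun s t => ∫ x, F s x * F t x ∂μ) P := by
  have h : (fun t => wienerIntegral ξ (F t)) = fun t => ξ ((hF t).toLp (F t)) := by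
    funext t
    exact dif_pos (hF t)
  rw [h]
  refine ⟨hξ.gaussian.comp_right _, fun t => hξ.centred _, fun s t => ?_⟩
  rw [hξ.covariance, inner_toLp_toLp]
  simp_rw [real_inner_eq_re_inner, RCLike.inner_apply]
  simp [mul_comm]

end WhiteNoiseIntegral

/-! ### The star kernel in space-time -/

section SpaceTime

variable {d : ℕ}

lemma memLp_two_spaceTime {g : Rd d × ℝ → ℝ} (hg : AEStronglyMeasurable g (spaceTime d))
    (h1 : ∀ r, Integrable fun y => g (y, r) * g (y, r))
    (h2 : IntegrableOn (fun r => ∫ y, g (y, r) * g (y, r)) (Ioi 0)) :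
    MemLp g 2 (spaceTime d) := by
  rw [memLp_two_iff_integrable_sq hg, spaceTime, integrable_prod_iff' (f := fun p => g p ^ 2)
    (hg.pow 2)]
  simp_rw [sq]
  refine ⟨ae_of_all _ h1, h2.congr (ae_of_all _ fun r => ?_)⟩
  simp only [norm_mul, Real.norm_eq_abs, abs_mul_abs_self]

lemma integral_mul_spaceTime {g h : Rd d × ℝ → ℝ} (hg : MemLp g 2 (spaceTime d))
    (hh : MemLp h 2 (spaceTime d)) :
    ∫ p, g p * h p ∂(spaceTime d) = ∫ r in Ioi (0 : ℝ), ∫ y, g (y, r) * h (y, r) :=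
  integral_prod_symm _ (hg.integrable_mul hh)

lemma continuous_starKernel {Kb : Rd d → ℝ} (h : Continuous Kb) :
    Continuous fun q : Rd d × Rd d × ℝ => starKernel Kb q.1 q.2 := by
  unfold starKernel
  fun_prop

lemma IsConvolutionRoot.memLp_starKernel {Kb K : Rd d → ℝ} (h : IsConvolutionRoot Kb K)
    (hK : AssumptionK1 K) (x : Rd d) (r : ℝ) : MemLp (fun y => starKernel Kb x (y, r)) 2 := by
  have h1 : MemLp (fun y => Kb (Real.exp r • y)) 2 := by
    have hc : Continuous fun y => Kb (Real.exp r • y) :=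
      h.continuous.comp (continuous_const_smul _)
    rw [memLp_two_iff_integrable_sq hc.aestronglyMeasurable]
    exact (h.memLp hK.one).integrable_sq.comp_smul (Real.exp_pos r).ne'
  exact (h1.comp_measurePreserving (measurePreserving_sub_right volume x)).mul_const
    (Real.exp (d * r / 2))

/-- The product of the two factors `e^{dr/2}` cancels the Jacobian of `y ↦ e^r (y - x)`, leaving the
autocorrelation of `Kb` at `e^r (x' - x)`. This equals `K` by the root property and evenness. -/
lemma IsConvolutionRoot.integral_starKernel {Kb K : Rd d → ℝ} (h : IsConvolutionRoot Kb K)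
    (hK : AssumptionK1 K) (x x' : Rd d) (r : ℝ) :
    ∫ y, starKernel Kb x (y, r) * starKernel Kb x' (y, r) = K (Real.exp r • (x - x')) := by
  have h1 := Measure.integral_comp_smul (volume : Measure (Rd d))
    (fun u => Kb u * Kb (u - Real.exp r • (x' - x))) (Real.exp r)
  rw [← h.conv_translate, finrank_euclideanSpace_fin, abs_of_pos (by positivity), smul_eq_mul,
    ← integral_sub_right_eq_self _ x] at h1
  have h2 : ∀ y, starKernel Kb x (y, r) * starKernel Kb x' (y, r) = Real.exp r ^ d *
      (Kb (Real.exp r • (y - x)) * Kb (Real.exp r • (y - x) - Real.exp r • (x' - x))) := by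
    intro y
    have h3 : Real.exp (d * r / 2) * Real.exp (d * r / 2) = Real.exp r ^ d := by
      rw [← Real.exp_add, ← Real.exp_nat_mul]
      ring_nf
    rw [← smul_sub, sub_sub_sub_cancel_right, ← h3]
    unfold starKernel
    ring
  simp_rw [h2]
  rw [integral_const_mul, h1, mul_inv_cancel_left₀ (by positivity), ← hK.posDef.even, ← smul_neg,
    neg_sub]

end SpaceTime

/-! ### Covariance of the martingale approximation -/

section MartingaleCovariance

variable {d : ℕ} {σ c C : ℝ} {k : ℝ → ℝ}

/-- The spectral density of the martingale approximation. -/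
noncomputable def truncatedDensity (d : ℕ) (k : ℝ → ℝ) (t R : ℝ) : ℝ :=
  (R ^ d)⁻¹ * (radialMass d k R - radialMass d k (Real.exp (-t) * R))

/-- The radial mass is constant beyond radius one, so the density vanishes once `e^{-t} |w| ≥ 1`. On
the remaining ball it is bounded by the bound on `scaleDensity`. -/
lemma IsRadialProfile.integrable_truncatedDensity (hd : 1 ≤ d) (h : IsRadialProfile d σ c C k)
    {t : ℝ} (ht : 0 ≤ t) : Integrable fun w : Rd d => truncatedDensity d k t ‖w‖ := by
  have hm : Measurable (truncatedDensity d k t) :=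
    (measurable_id.pow_const d).inv.mul
      (h.measurable_mass.sub (h.measurable_mass.comp (measurable_const_mul _)))
  have h1 : Integrable ((Metric.closedBall (0 : Rd d) (Real.exp t)).indicator
      fun _ => max C σ) :=
    (integrable_indicator_iff Metric.isClosed_closedBall.measurableSet).2
      (integrableOn_const measure_closedBall_lt_top.ne)
  refine h1.mono' (hm.comp measurable_norm).aestronglyMeasurable ?_
  filter_upwards [IsRadialProfile.ae_norm_pos hd] with w hw
  have h2 : Real.exp (-t) * ‖w‖ ≤ ‖w‖ :=
    mul_le_of_le_one_left hw.le (Real.exp_le_one_iff.2 (by linarith))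
  have h3 : 0 ≤ radialMass d k ‖w‖ - radialMass d k (Real.exp (-t) * ‖w‖) :=
    sub_nonneg.2 (h.mono h2)
  rw [truncatedDensity, Real.norm_of_nonneg (by positivity)]
  by_cases hb : ‖w‖ ≤ Real.exp t
  · rw [indicator_of_mem (by simpa using hb)]
    refine le_trans ?_ (h.scaleDensity_le hw)
    exact mul_le_mul_of_nonneg_left (by linarith [h.mass_nonneg (Real.exp (-t) * ‖w‖)])
      (by positivity)
  · rw [indicator_of_notMem (by simpa using hb)]
    have h4 : 1 ≤ Real.exp (-t) * ‖w‖ := by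
      rw [Real.exp_neg, ← div_eq_inv_mul, one_le_div (Real.exp_pos _)]
      exact (not_le.1 hb).le
    rw [h.total _ h4, h.total _ (h4.trans h2), sub_self, mul_zero]

lemma IsRadialProfile.integral_seed_scale (hd : 1 ≤ d) (h : IsRadialProfile d σ c C k)
    {K : Rd d → ℝ} (hK : ∀ x : Rd d, K x = ∫ w : Rd d, Real.cos (inner ℝ w x) * k ‖w‖)
    {t : ℝ} (ht : 0 ≤ t) (x : Rd d) :
    ∫ r in Ioo (0 : ℝ) t, K (Real.exp r • x)
      = ∫ w : Rd d, Real.cos (inner ℝ w x) * truncatedDensity d k t ‖w‖ := by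
  have heq : ∀ᵐ w : Rd d, Real.cos (inner ℝ w x) * truncatedDensity d k t ‖w‖
      = Real.cos (inner ℝ w x)
        * ∫ r in Ioo (0 : ℝ) t, Real.exp (-(d * r)) * k (Real.exp (-r) * ‖w‖) := by
    filter_upwards [IsRadialProfile.ae_norm_pos hd] with w hw
    rw [setIntegral_Ioo_exp_scale hd hw ht h.integrableOn, truncatedDensity]
  rw [integral_congr_ae heq, ← (integrable_and_integral_scale_mixture hd h.measurable h.nonneg
    h.integrableOn measurableSet_Ioo (f := fun w => Real.cos (inner ℝ w x)) (by fun_prop)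
    ((integrable_cos_inner_mul (h.integrable_truncatedDensity hd ht) x).congr heq)).2]
  simp_rw [hK, inner_smul_left, inner_smul_right]
  simp

lemma IsConvolutionRoot.memLp_martingale {Kb K : Rd d → ℝ} (hKb : IsConvolutionRoot Kb K)
    (hK1 : AssumptionK1 K) (t : ℝ) (x : Rd d) :
    MemLp ({p : Rd d × ℝ | p.2 < t}.indicator (starKernel Kb x)) 2 (spaceTime d) := by
  have hS : MeasurableSet {p : Rd d × ℝ | p.2 < t} := measurableSet_lt measurable_snd
    measurable_const
  have hc : Continuous (starKernel Kb x) :=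
    (continuous_starKernel hKb.continuous).comp (Continuous.prodMk_right x)
  have hsec : ∀ r, (fun y => {p : Rd d × ℝ | p.2 < t}.indicator (starKernel Kb x) (y, r)
      * {p : Rd d × ℝ | p.2 < t}.indicator (starKernel Kb x) (y, r))
      = fun y => (Iio t).indicator (fun _ => (1 : ℝ)) r
        * (starKernel Kb x (y, r) * starKernel Kb x (y, r)) := by
    intro r
    ext y
    by_cases hr : r < t <;> simp [indicator, hr]
  refine memLp_two_spaceTime (hc.stronglyMeasurable.indicator hS).aestronglyMeasurable
    (fun r => ?_) ?_
  · rw [hsec]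
    exact ((hKb.memLp_starKernel hK1 x r).integrable_mul
      (hKb.memLp_starKernel hK1 x r)).const_mul _
  · simp_rw [hsec, integral_const_mul, hKb.integral_starKernel hK1, sub_self, smul_zero, hK1.one,
      mul_one]
    rw [IntegrableOn, integrable_indicator_iff measurableSet_Iio, IntegrableOn,
      Measure.restrict_restrict measurableSet_Iio, ← IntegrableOn]
    exact integrableOn_const ((measure_mono (t := Ioo 0 t) fun r hr => ⟨hr.2, hr.1⟩).trans_lt
      measure_Ioo_lt_top).ne

/-- The martingale approximation as a Gaussian field. -/
theorem IsWhiteNoise.isCentredGaussian_martingaleApprox {Ω : Type*} [MeasurableSpace Ω]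
    {P : Measure Ω} {ξ : Lp ℝ 2 (spaceTime d) → Ω → ℝ} (hξ : IsWhiteNoise ξ P) (hd : 1 ≤ d)
    (h : IsRadialProfile d σ c C k) {Kb K : Rd d → ℝ} (hKb : IsConvolutionRoot Kb K)
    (hK1 : AssumptionK1 K)
    (hK : ∀ x : Rd d, K x = ∫ w : Rd d, Real.cos (inner ℝ w x) * k ‖w‖) {t : ℝ} (ht : 0 ≤ t) :
    IsCentredGaussian (martingaleApprox Kb ξ t)
      (fun x y => ∫ w : Rd d, truncatedDensity d k t ‖w‖ * Real.cos (inner ℝ w (x - y))) P := by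
  have hG := hξ.isCentredGaussian (hKb.memLp_martingale hK1 t)
  refine ⟨hG.gaussian, hG.centred, fun x y => (hG.covariance x y).trans ?_⟩
  rw [integral_mul_spaceTime (hKb.memLp_martingale hK1 t x) (hKb.memLp_martingale hK1 t y)]
  simp_rw [mul_comm (truncatedDensity d k t _)]
  rw [← h.integral_seed_scale hd hK ht]
  have hsec : ∀ r, ∫ z, {p : Rd d × ℝ | p.2 < t}.indicator (starKernel Kb x) (z, r)
      * {p : Rd d × ℝ | p.2 < t}.indicator (starKernel Kb y) (z, r)
      = (Iio t).indicator (fun r => K (Real.exp r • (x - y))) r := by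
    intro r
    rw [indicator_apply, ← hKb.integral_starKernel hK1]
    by_cases hr : r < t <;> simp [indicator, hr]
  simp_rw [hsec]
  rw [integral_indicator measurableSet_Iio, Measure.restrict_restrict measurableSet_Iio]
  congr 2
  ext r
  simp [and_comm]

end MartingaleCovariance

/-! ### Covariance of the convolution approximation -/

section ConvolutionCovariance

variable {d : ℕ} {σ c C : ℝ} {k : ℝ → ℝ}

/-- Integrating a field of normalised square integrable functions against integrable weights. -/
lemma integrable_and_integral_superposition {E : Type*} [MeasurableSpace E] {ν : Measure E}
    [SFinite ν] {φ ψ : E → ℝ} (hφ : Integrable φ ν) (hψ : Integrable ψ ν) {S : Type*}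
    [MeasurableSpace S] {μ : Measure S} [SFinite μ] {J : E → S → ℝ}
    (hJm : Measurable (Function.uncurry J)) (hJ : ∀ z, MemLp (J z) 2 μ)
    (hJ1 : ∀ z, ∫ y, J z y * J z y ∂μ = 1) :
    Integrable (fun y => (∫ z, φ z * J z y ∂ν) * ∫ z, ψ z * J z y ∂ν) μ ∧
    ∫ y, (∫ z, φ z * J z y ∂ν) * (∫ z, ψ z * J z y ∂ν) ∂μ
      = ∫ q, φ q.1 * ψ q.2 * ∫ y, J q.1 y * J q.2 y ∂μ ∂(ν.prod ν) := by
  let T : (E × E) × S → ℝ := fun p => φ p.1.1 * ψ p.1.2 * (J p.1.1 p.2 * J p.1.2 p.2)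
  have hJJ : ∀ z z', Integrable (fun y => J z y * J z' y) μ := fun z z' =>
    (hJ z).integrable_mul (hJ z')
  have hφψ : Integrable (fun q : E × E => φ q.1 * ψ q.2) (ν.prod ν) := hφ.mul_prod hψ
  have hTm : AEStronglyMeasurable T ((ν.prod ν).prod μ) := by
    refine AEStronglyMeasurable.mul ?_ ?_
    · exact hφψ.1.comp_fst
    · refine (Measurable.mul ?_ ?_).aestronglyMeasurable
      · exact hJm.comp ((measurable_fst.comp measurable_fst).prodMk measurable_snd)
      · exact hJm.comp ((measurable_snd.comp measurable_fst).prodMk measurable_snd)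
  have hT : Integrable T ((ν.prod ν).prod μ) := by
    rw [integrable_prod_iff hTm]
    refine ⟨ae_of_all _ fun q => (hJJ q.1 q.2).const_mul (φ q.1 * ψ q.2), ?_⟩
    refine hφψ.norm.mono' hTm.norm.integral_prod_right' (ae_of_all _ fun q => ?_)
    rw [Real.norm_of_nonneg (integral_nonneg fun y => norm_nonneg _)]
    have h1 : ∀ y, ‖T (q, y)‖ = ‖φ q.1 * ψ q.2‖ * ‖J q.1 y * J q.2 y‖ := fun y => norm_mul _ _
    simp_rw [h1]
    rw [integral_const_mul]
    refine mul_le_of_le_one_right (norm_nonneg _) ?_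
    -- By `|ab| ≤ (a² + b²)/2` and the normalisation, the inner integral is at most one. Absolute
    -- integrability of the triple integrand then reduces to that of `φ ⊗ ψ`.
    calc ∫ y, ‖J q.1 y * J q.2 y‖ ∂μ
        ≤ ∫ y, (1 / 2) * (J q.1 y * J q.1 y + J q.2 y * J q.2 y) ∂μ := by
          refine integral_mono (hJJ _ _).norm (((hJJ _ _).add (hJJ _ _)).const_mul _) fun y => ?_
          simp only [norm_mul, Real.norm_eq_abs]
          nlinarith [sq_nonneg (|J q.1 y| - |J q.2 y|), abs_mul_abs_self (J q.1 y),
            abs_mul_abs_self (J q.2 y)]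
      _ = 1 := by
          rw [integral_const_mul, integral_add (hJJ _ _) (hJJ _ _), hJ1, hJ1]
          norm_num
  have hsplit : ∀ y, ∫ q, T (q, y) ∂(ν.prod ν)
      = (∫ z, φ z * J z y ∂ν) * ∫ z, ψ z * J z y ∂ν := by
    intro y
    rw [← integral_prod_mul]
    congr 1
    ext q
    simp only [T]
    ring
  constructor
  · refine hT.integral_prod_right.congr (ae_of_all _ fun y => ?_)
    exact hsplit y
  · simp_rw [← hsplit]
    rw [integral_integral_swap (f := fun y q => T (q, y)) hT.swap]
    simp_rw [T, integral_const_mul]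

/-- The cross spectral density of two functions. -/
noncomputable def crossSpectrum (φ ψ : Rd d → ℝ) (w : Rd d) : ℝ :=
  (fourierHat φ w * (starRingEnd ℂ) (fourierHat ψ w)).re

/-- The addition formula for the cosine splits the double integral into products of the real and of
the imaginary parts of the two transforms. -/
lemma integral_cos_inner_sub {φ ψ : Rd d → ℝ} (hφ : Integrable φ) (hψ : Integrable ψ) (w : Rd d) :
    ∫ q : Rd d × Rd d, φ q.1 * ψ q.2 * Real.cos (inner ℝ w (q.1 - q.2))
        ∂((volume : Measure (Rd d)).prod volume)
      = crossSpectrum φ ψ w := by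
  have hs : ∀ {f : Rd d → ℝ}, Integrable f → Integrable fun x => Real.sin (inner ℝ w x) * f x := by
    intro f hf
    refine hf.bdd_mul (c := 1) ?_ (ae_of_all _ fun x => Real.abs_sin_le_one _)
    exact (by fun_prop : Continuous fun x : Rd d => Real.sin (inner ℝ w x)).aestronglyMeasurable
  have hc : ∀ {f : Rd d → ℝ}, Integrable f → Integrable fun x => Real.cos (inner ℝ w x) * f x := by
    intro f hf
    refine hf.bdd_mul (c := 1) ?_ (ae_of_all _ fun x => Real.abs_cos_le_one _)
    exact (by fun_prop : Continuous fun x : Rd d => Real.cos (inner ℝ w x)).aestronglyMeasurable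
  have h1 : ∀ q : Rd d × Rd d, φ q.1 * ψ q.2 * Real.cos (inner ℝ w (q.1 - q.2))
      = (Real.cos (inner ℝ w q.1) * φ q.1) * (Real.cos (inner ℝ w q.2) * ψ q.2)
        + (Real.sin (inner ℝ w q.1) * φ q.1) * (Real.sin (inner ℝ w q.2) * ψ q.2) := by
    intro q
    rw [inner_sub_right, Real.cos_sub]
    ring
  simp_rw [h1]
  rw [integral_add ((hc hφ).mul_prod (hc hψ)) ((hs hφ).mul_prod (hs hψ)), integral_prod_mul
    (fun x : Rd d => Real.cos (inner ℝ w x) * φ x) fun x : Rd d => Real.cos (inner ℝ w x) * ψ x,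
    integral_prod_mul (fun x : Rd d => Real.sin (inner ℝ w x) * φ x)
      fun x : Rd d => Real.sin (inner ℝ w x) * ψ x,
    crossSpectrum, Complex.mul_re, Complex.conj_re, Complex.conj_im, fourierHat_re hφ,
    fourierHat_re hψ, fourierHat_im hφ, fourierHat_im hψ]
  ring

lemma integral_seed_superposition {φ ψ : Rd d → ℝ} (hφ : Integrable φ) (hψ : Integrable ψ)
    {K : Rd d → ℝ} (hki : Integrable fun w : Rd d => k ‖w‖)
    (hK : ∀ x : Rd d, K x = ∫ w : Rd d, Real.cos (inner ℝ w x) * k ‖w‖) (s : ℝ) :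
    ∫ q : Rd d × Rd d, φ q.1 * ψ q.2 * K (s • (q.1 - q.2))
        ∂((volume : Measure (Rd d)).prod volume)
      = ∫ w : Rd d, crossSpectrum φ ψ (s • w) * k ‖w‖ := by
  simp_rw [hK, ← integral_const_mul]
  rw [integral_integral_swap]
  · congr 1
    ext w
    rw [← integral_cos_inner_sub hφ hψ, ← integral_mul_const]
    congr 1
    ext q
    rw [inner_smul_left, inner_smul_right]
    simp only [conj_trivial]
    ring
  · have h1 : Integrable (fun p : (Rd d × Rd d) × Rd d => (φ p.1.1 * ψ p.1.2) * k ‖p.2‖)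
        (((volume : Measure (Rd d)).prod volume).prod volume) :=
      (hφ.mul_prod hψ).mul_prod hki
    have h2 := h1.bdd_mul (c := 1)
      (f := fun p : (Rd d × Rd d) × Rd d => Real.cos (inner ℝ p.2 (s • (p.1.1 - p.1.2))))
      (by fun_prop : Continuous fun p : (Rd d × Rd d) × Rd d =>
        Real.cos (inner ℝ p.2 (s • (p.1.1 - p.1.2)))).aestronglyMeasurable
      (ae_of_all _ fun p => Real.abs_cos_le_one _)
    refine h2.congr (ae_of_all _ fun p => ?_)
    simp only [Function.uncurry]
    ring

lemma continuous_crossSpectrum {φ ψ : Rd d → ℝ} (hφ : Integrable φ) (hψ : Integrable ψ) :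
    Continuous (crossSpectrum φ ψ) :=
  Complex.continuous_re.comp ((continuous_fourierHat hφ).mul
    (Complex.continuous_conj.comp (continuous_fourierHat hψ)))

/-- Each transform of a test function decays quadratically, so together they provide the quartic
denominator that makes the tail `|w|^{-d}` integrable. -/
lemma integrable_crossSpectrum_mul (hd : 1 ≤ d) (h : IsRadialProfile d σ c C k)
    {φ ψ : Rd d → ℝ} (hφ : ContDiff ℝ ∞ φ) (hφc : HasCompactSupport φ) (hψ : ContDiff ℝ ∞ ψ)
    (hψc : HasCompactSupport ψ) :
    Integrable fun w => crossSpectrum φ ψ w * scaleDensity d k ‖w‖ := by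
  obtain ⟨A, hA⟩ := exists_norm_fourierHat_le hφ hφc
  obtain ⟨B, hB⟩ := exists_norm_fourierHat_le hψ hψc
  have hA0 : 0 ≤ A := le_trans (by positivity) (hA 0)
  refine ((h.integrable_scaleDensity_div hd).const_mul (A * B)).mono' ?_ ?_
  · exact ((continuous_crossSpectrum (hφ.continuous.integrable_of_hasCompactSupport hφc)
      (hψ.continuous.integrable_of_hasCompactSupport hψc)).measurable.mul
      (h.measurable_scaleDensity.comp measurable_norm)).aestronglyMeasurable
  · refine ae_of_all _ fun w => ?_
    have h1 : |crossSpectrum φ ψ w| ≤ ‖fourierHat φ w‖ * ‖fourierHat ψ w‖ := by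
      refine (Complex.abs_re_le_norm _).trans (le_of_eq ?_)
      rw [norm_mul, RCLike.norm_conj]
    have h2 := h.scaleDensity_nonneg (norm_nonneg w)
    have h3 : ‖fourierHat φ w‖ * ‖fourierHat ψ w‖ * (1 + ‖w‖ ^ 2) ^ 2 ≤ A * B := by
      calc _ = (‖fourierHat φ w‖ * (1 + ‖w‖ ^ 2)) * (‖fourierHat ψ w‖ * (1 + ‖w‖ ^ 2)) := by ring
        _ ≤ A * B := mul_le_mul (hA w) (hB w) (by positivity) hA0
    rw [norm_mul, Real.norm_eq_abs, Real.norm_of_nonneg h2, ← mul_div_assoc,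
      le_div_iff₀ (by positivity)]
    calc |crossSpectrum φ ψ w| * scaleDensity d k ‖w‖ * (1 + ‖w‖ ^ 2) ^ 2
        ≤ (‖fourierHat φ w‖ * ‖fourierHat ψ w‖) * scaleDensity d k ‖w‖ * (1 + ‖w‖ ^ 2) ^ 2 := by
          gcongr
      _ = (‖fourierHat φ w‖ * ‖fourierHat ψ w‖ * (1 + ‖w‖ ^ 2) ^ 2) * scaleDensity d k ‖w‖ := by
          ring
      _ ≤ _ := mul_le_mul_of_nonneg_right h3 h2

/-- The integrand of the field tested against a smooth function is square integrable, and the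
covariance is given by the spectral density. -/
theorem memLp_and_integral_starField (hd : 1 ≤ d) (h : IsRadialProfile d σ c C k)
    {Kb K : Rd d → ℝ} (hKb : IsConvolutionRoot Kb K) (hK1 : AssumptionK1 K)
    (hki : Integrable fun w : Rd d => k ‖w‖)
    (hK : ∀ x : Rd d, K x = ∫ w : Rd d, Real.cos (inner ℝ w x) * k ‖w‖) :
    (∀ {φ : Rd d → ℝ}, ContDiff ℝ ∞ φ → HasCompactSupport φ →
      MemLp (fun p => ∫ z, φ z * starKernel Kb z p) 2 (spaceTime d)) ∧
    ∀ {φ ψ : Rd d → ℝ}, ContDiff ℝ ∞ φ → HasCompactSupport φ → ContDiff ℝ ∞ ψ →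
      HasCompactSupport ψ →
      ∫ p, (∫ z, φ z * starKernel Kb z p) * (∫ z, ψ z * starKernel Kb z p) ∂(spaceTime d)
        = ∫ w, crossSpectrum φ ψ w * scaleDensity d k ‖w‖ := by
  -- At a fixed scale `r` the spatial integral is computed first, giving the spectral pairing with
  -- the dilated seed. Integration over the scales then produces `scaleDensity`.
  have hsec : ∀ {φ ψ : Rd d → ℝ}, Integrable φ → Integrable ψ → ∀ r : ℝ,
      Integrable (fun y => (∫ z, φ z * starKernel Kb z (y, r)) *
        ∫ z, ψ z * starKernel Kb z (y, r)) ∧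
      ∫ y, (∫ z, φ z * starKernel Kb z (y, r)) * (∫ z, ψ z * starKernel Kb z (y, r))
        = ∫ w : Rd d, crossSpectrum φ ψ (Real.exp r • w) * k ‖w‖ := by
    intro φ ψ hφ hψ r
    have hJm : Measurable (Function.uncurry fun (z y : Rd d) => starKernel Kb z (y, r)) :=
      ((continuous_starKernel hKb.continuous).comp
        (by fun_prop : Continuous fun q : Rd d × Rd d => (q.1, q.2, r))).measurable
    obtain ⟨h1, h2⟩ := integrable_and_integral_superposition hφ hψ hJm
      (fun z => hKb.memLp_starKernel hK1 z r) fun z => by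
        rw [hKb.integral_starKernel hK1, sub_self, smul_zero, hK1.one]
    refine ⟨h1, h2.trans ?_⟩
    simp_rw [hKb.integral_starKernel hK1]
    exact integral_seed_superposition hφ hψ hki hK _
  have hmix : ∀ {φ ψ : Rd d → ℝ}, ContDiff ℝ ∞ φ → HasCompactSupport φ → ContDiff ℝ ∞ ψ →
      HasCompactSupport ψ →
      IntegrableOn (fun r => ∫ w, crossSpectrum φ ψ (Real.exp r • w) * k ‖w‖) (Ioi 0) ∧
      ∫ r in Ioi (0 : ℝ), ∫ w, crossSpectrum φ ψ (Real.exp r • w) * k ‖w‖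
        = ∫ w, crossSpectrum φ ψ w * scaleDensity d k ‖w‖ := by
    intro φ ψ hφ hφc hψ hψc
    have heq : ∀ᵐ w : Rd d, crossSpectrum φ ψ w * scaleDensity d k ‖w‖ = crossSpectrum φ ψ w
        * ∫ r in Ioi (0 : ℝ), Real.exp (-(d * r)) * k (Real.exp (-r) * ‖w‖) := by
      filter_upwards [IsRadialProfile.ae_norm_pos hd] with w hw
      rw [setIntegral_Ioi_exp_scale hd hw]
    rw [integral_congr_ae heq]
    exact integrable_and_integral_scale_mixture hd h.measurable h.nonneg h.integrableOn
      measurableSet_Ioi (continuous_crossSpectrum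
        (hφ.continuous.integrable_of_hasCompactSupport hφc)
        (hψ.continuous.integrable_of_hasCompactSupport hψc)).measurable
      ((integrable_crossSpectrum_mul hd h hφ hφc hψ hψc).congr heq)
  have hmem : ∀ {φ : Rd d → ℝ}, ContDiff ℝ ∞ φ → HasCompactSupport φ →
      MemLp (fun p => ∫ z, φ z * starKernel Kb z p) 2 (spaceTime d) := by
    intro φ hφ hφc
    have hφi := hφ.continuous.integrable_of_hasCompactSupport hφc (μ := volume)
    refine memLp_two_spaceTime ?_ (fun r => (hsec hφi hφi r).1) ?_
    · have hcont : Continuous fun q : (Rd d × ℝ) × Rd d => φ q.2 * starKernel Kb q.2 q.1 :=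
        (hφ.continuous.comp continuous_snd).mul
          ((continuous_starKernel hKb.continuous).comp continuous_swap)
      exact hcont.stronglyMeasurable.integral_prod_right'.aestronglyMeasurable
    · simp_rw [(hsec hφi hφi _).2]
      exact (hmix hφ hφc hφ hφc).1
  refine ⟨hmem, fun {φ ψ} hφ hφc hψ hψc => ?_⟩
  have hφi := hφ.continuous.integrable_of_hasCompactSupport hφc (μ := volume)
  have hψi := hψ.continuous.integrable_of_hasCompactSupport hψc (μ := volume)
  rw [integral_mul_spaceTime (hmem hφ hφc) (hmem hψ hψc)]
  simp_rw [(hsec hφi hψi _).2]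
  exact (hmix hφ hφc hψ hψc).2

lemma crossSpectrum_reflect_translate (f : Rd d → ℝ) (x y w : Rd d) :
    crossSpectrum (fun z => f (x - z)) (fun z => f (y - z)) w
      = ‖fourierHat f w‖ ^ 2 * Real.cos (inner ℝ w (x - y)) := by
  rw [crossSpectrum, fourierHat_reflect_translate, fourierHat_reflect_translate, map_mul,
    Complex.conj_conj, ← Complex.exp_conj, map_neg, map_mul, Complex.conj_I, Complex.conj_ofReal]
  have h1 : Complex.exp (-(Complex.I * ((inner ℝ w x : ℝ) : ℂ)))
      * (starRingEnd ℂ) (fourierHat f w)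
      * (Complex.exp (-(-Complex.I * ((inner ℝ w y : ℝ) : ℂ))) * fourierHat f w)
      = ((‖fourierHat f w‖ ^ 2 : ℝ) : ℂ)
        * Complex.exp (((-(inner ℝ w (x - y) : ℝ) : ℝ) : ℂ) * Complex.I) := by
    rw [Complex.ofReal_pow, ← Complex.conj_mul', inner_sub_right]
    have h2 : Complex.exp (((-((inner ℝ w x : ℝ) - inner ℝ w y) : ℝ) : ℂ) * Complex.I)
        = Complex.exp (-(Complex.I * ((inner ℝ w x : ℝ) : ℂ)))
          * Complex.exp (-(-Complex.I * ((inner ℝ w y : ℝ) : ℂ))) := by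
      rw [← Complex.exp_add]
      congr 1
      push_cast
      ring
    rw [h2]
    ring
  rw [h1, Complex.re_ofReal_mul, Complex.exp_ofReal_mul_I_re, Real.cos_neg]

/-- The convolution approximation as a Gaussian field. -/
theorem IsWhiteNoise.isCentredGaussian_convApprox {Ω : Type*} [MeasurableSpace Ω]
    {P : Measure Ω} {ξ : Lp ℝ 2 (spaceTime d) → Ω → ℝ} (hξ : IsWhiteNoise ξ P) (hd : 1 ≤ d)
    (h : IsRadialProfile d σ c C k) {Kb K : Rd d → ℝ} (hKb : IsConvolutionRoot Kb K)
    (hK1 : AssumptionK1 K) (hki : Integrable fun w : Rd d => k ‖w‖)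
    (hK : ∀ x : Rd d, K x = ∫ w : Rd d, Real.cos (inner ℝ w x) * k ‖w‖) {ρ : Rd d → ℝ}
    (hρ : ContDiff ℝ ∞ ρ) (hρc : HasCompactSupport ρ) {ε : ℝ} (hε : 0 < ε) :
    IsCentredGaussian (convApprox ρ Kb ξ ε)
      (fun x y => ∫ w : Rd d, ‖fourierHat ρ (ε • w)‖ ^ 2 * scaleDensity d k ‖w‖
        * Real.cos (inner ℝ w (x - y))) P := by
  obtain ⟨hmem, hcov⟩ := memLp_and_integral_starField hd h hKb hK1 hki hK
  have hs : ∀ x, ContDiff ℝ ∞ fun z => rescale ρ ε (x - z) := fun x =>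
    (contDiff_rescale hρ ε).comp (contDiff_const.sub contDiff_id)
  have hc : ∀ x, HasCompactSupport fun z => rescale ρ ε (x - z) := fun x =>
    (hasCompactSupport_rescale hρc hε).comp_homeomorph (Homeomorph.subLeft x)
  have hG := hξ.isCentredGaussian fun x => hmem (hs x) (hc x)
  refine ⟨hG.gaussian, hG.centred, fun x y => (hG.covariance x y).trans ?_⟩
  rw [hcov (hs x) (hc x) (hs y) (hc y)]
  simp_rw [crossSpectrum_reflect_translate, fourierHat_rescale ρ hε]
  congr 1
  ext w
  ring

end ConvolutionCovariance

/-! ### Stationary fields, decay of correlations and prescribed densities -/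

section StationaryFields

variable {d : ℕ} {Ω : Type*} [MeasurableSpace Ω] {P : Measure Ω}

lemma IsCentredGaussian.isSmoothStationary {Y : Rd d → Ω → ℝ} {γ : Rd d → ℝ}
    (hY : IsCentredGaussian Y (fun x y => γ (x - y)) P) (hm : ∀ x, Measurable (Y x))
    (hs : ∀ o, ContDiff ℝ ∞ fun x => Y x o) : IsSmoothStationaryGaussianField Y P where
  measurable := hm
  gaussian := hY.gaussian
  centred := hY.centred
  smooth := hs
  stationary v := by
    have h := hY.comp_right fun x => x + v
    simp only [add_sub_add_right_eq_sub] at h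
    exact h.identDistrib hY (fun x => hm _) hm

open FourierTransform in
lemma tendsto_fourierHat_cocompact (f : Rd d → ℝ) :
    Tendsto (fourierHat f) (cocompact (Rd d)) (𝓝 0) := by
  have h1 : Tendsto (𝓕 fun x => (f x : ℂ)) (cocompact (Rd d)) (𝓝 0) :=
    tendsto_integral_exp_inner_smul_cocompact (fun x => (f x : ℂ))
  have hc : (2 * Real.pi)⁻¹ ≠ 0 := by positivity
  have h2 := h1.comp (Homeomorph.smulOfNeZero (α := Rd d) _ hc).isClosedEmbedding.tendsto_cocompact
  refine h2.congr fun w => ?_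
  rw [fourierHat_eq_fourier]
  rfl

/-- Riemann–Lebesgue: the covariance is the real part of the Fourier transform of an integrable
density, evaluated at `x - y`. -/
lemma IsCentredGaussian.hasDecayingCorrelations {Y : Rd d → Ω → ℝ} {f : Rd d → ℝ}
    (hf : Integrable f)
    (hY : IsCentredGaussian Y (fun x y => ∫ w, f w * Real.cos (inner ℝ w (x - y))) P) :
    HasDecayingCorrelations Y P := by
  have h1 : Tendsto (fun p : Rd d × Rd d => p.1 - p.2)
      (comap (fun p : Rd d × Rd d => ‖p.1 - p.2‖) atTop) (cocompact (Rd d)) := by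
    rw [← Metric.cobounded_eq_cocompact, ← comap_norm_atTop, tendsto_comap_iff]
    exact tendsto_comap
  have h2 := (Complex.continuous_re.tendsto 0).comp ((tendsto_fourierHat_cocompact f).comp h1)
  rw [Complex.zero_re] at h2
  refine h2.congr fun p => ?_
  rw [hY.covariance]
  simp only [Function.comp_apply]
  rw [fourierHat_re hf]
  congr 1
  ext w
  rw [real_inner_comm, mul_comm]

/-- A smooth field with spectral density `v`, provided `v` is divisible by `|p̂|²`. -/
lemma exists_smooth_field_of_density [IsProbabilityMeasure P]
    (I : Lp ℂ 2 (volume : Measure (Rd d)) →ₗᵢ[ℝ] Lp ℝ 2 P)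
    (hI : IsCentredGaussian (fun h => (I h : Ω → ℝ)) (fun h h' => inner ℝ h h') P)
    {p : Rd d → ℝ} (hp : ContDiff ℝ ∞ p) (hpc : HasCompactSupport p)
    {v : Rd d → ℝ} (hv0 : ∀ w, 0 ≤ v w) (hvp : ∀ w, fourierHat p w = 0 → v w = 0)
    (hv : Integrable fun w => v w / ‖fourierHat p w‖ ^ 2) :
    ∃ Y : Rd d → Ω → ℝ, (∀ x, Measurable (Y x)) ∧ (∀ o, ContDiff ℝ ∞ fun x => Y x o) ∧
      IsCentredGaussian Y (fun x y => ∫ w, v w * Real.cos (inner ℝ w (x - y))) P := by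
  obtain ⟨Y, h1, h2, h3⟩ := exists_smooth_field I hI hp hpc
    (fun w => div_nonneg (hv0 w) (sq_nonneg ‖fourierHat p w‖)) hv
  refine ⟨Y, h1, h2, ?_⟩
  convert h3 using 6 with x y w
  by_cases h : fourierHat p w = 0
  · simp [h, hvp w h]
  · rw [mul_div_cancel₀]
    simpa using h

end StationaryFields

/-! ### The tail and error densities -/

section Densities

variable {d : ℕ} {σ c C : ℝ} {k : ℝ → ℝ}

/-- The spectral density of the field independent of the martingale approximation. -/
noncomputable def tailDensity (d : ℕ) (σ : ℝ) (k : ℝ → ℝ) (g : Rd d → ℝ) (w : Rd d) : ℝ :=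
  (‖w‖ ^ d)⁻¹ * (σ * (g w - 1) + radialMass d k ‖w‖)

/-- The spectral density of the error field. -/
noncomputable def errorDensity (d : ℕ) (σ : ℝ) (k : ℝ → ℝ) (g : Rd d → ℝ) (w : Rd d) : ℝ :=
  (‖w‖ ^ d)⁻¹ * ((σ - radialMass d k ‖w‖) * (1 - g w))

/-- After multiplication by `|w|^d` this is the algebraic identity on which the theorem rests. The
terms `m(e^{-t}R)` cancel between the truncated and the tail parts, and the terms in `σ` between the
tail and the error parts. The factor `s^d` turns `|sw|^{-d}` into `|w|^{-d}`. -/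
lemma density_decomposition {s t : ℝ} (hs : s = Real.exp (-t)) {g : Rd d → ℝ} {w : Rd d}
    (hw : 0 < ‖w‖) :
    g (s • w) * scaleDensity d k ‖w‖
      = truncatedDensity d k t ‖w‖ + s ^ d * tailDensity d σ k g (s • w)
        + errorDensity d σ k (fun w => g (s • w)) w := by
  have hs0 : 0 < s := hs ▸ Real.exp_pos _
  rw [scaleDensity, truncatedDensity, tailDensity, errorDensity, norm_smul,
    Real.norm_of_nonneg hs0.le, ← hs, mul_pow]
  field_simp
  ring

/-- Dilating a field in space by `s⁻¹` turns its spectral density `v` into `s^d v(s ·)`. Hence the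
same tail field serves every `ε`. -/
lemma integral_tailDensity_scale {s : ℝ} (hs : 0 < s) (g : Rd d → ℝ) (x : Rd d) :
    ∫ w, s ^ d * tailDensity d σ k g (s • w) * Real.cos (inner ℝ w x)
      = ∫ w, tailDensity d σ k g w * Real.cos (inner ℝ w (s⁻¹ • x)) := by
  have h := Measure.integral_comp_smul (volume : Measure (Rd d))
    (fun w => tailDensity d σ k g w * Real.cos (inner ℝ w (s⁻¹ • x))) s
  rw [finrank_euclideanSpace_fin, abs_of_pos (by positivity), smul_eq_mul] at h
  rw [← mul_inv_cancel_left₀ (pow_pos hs d).ne'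
    (∫ w, tailDensity d σ k g w * Real.cos (inner ℝ w (s⁻¹ • x))), ← h, ← integral_const_mul]
  congr 1
  ext w
  rw [inner_smul_left, inner_smul_right, conj_trivial, mul_inv_cancel_left₀ hs.ne', mul_assoc]

/-- Smallness of a mollification scale: the squared transform `g` of the mollifier is close to one
on the unit ball. -/
structure IsSmallScale (d : ℕ) (σ c : ℝ) (g : Rd d → ℝ) : Prop where
  le_one : ∀ w, ‖w‖ ≤ 1 → g w ≤ 1
  half_le : ∀ w, ‖w‖ ≤ 1 → 1 / 2 ≤ g w
  defect : ∀ w, ‖w‖ ≤ 1 → σ * (1 - g w) ≤ c * ‖w‖ ^ d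

/-- Inside the unit ball the possibly negative term `σ (g - 1)` is absorbed by the lower bound on
the radial mass. Outside, the mass equals `σ` and only `σ g ≥ 0` remains. -/
lemma IsSmallScale.tailDensity_nonneg (h : IsRadialProfile d σ c C k) {g : Rd d → ℝ}
    (hg : IsSmallScale d σ c g) (hg0 : ∀ w, 0 ≤ g w) (hd : 1 ≤ d) (w : Rd d) :
    0 ≤ tailDensity d σ k g w := by
  rcases (norm_nonneg w).eq_or_lt with h0 | h0
  -- At the origin the prefactor is `0⁻¹ = 0`, since `d ≥ 1`.
  · rw [tailDensity, ← h0, zero_pow (by omega)]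
    simp
  refine mul_nonneg (by positivity) ?_
  rcases lt_or_ge ‖w‖ 1 with h1 | h1
  · have := hg.defect w h1.le
    have := h.lower _ h0 h1
    linarith
  · rw [h.total _ h1]
    nlinarith [mul_nonneg h.sigma_nonneg (hg0 w)]

/-- Inside the unit ball `σ (g - 1) ≤ 0` and `1 ≤ 2g`; outside, the numerator is `σ g`. The factor
`g` on the right is what allows division by `|p̂|²`. -/
lemma IsSmallScale.tailDensity_le (h : IsRadialProfile d σ c C k) {g : Rd d → ℝ}
    (hg : IsSmallScale d σ c g) (hg0 : ∀ w, 0 ≤ g w) (w : Rd d) :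
    tailDensity d σ k g w ≤ 2 * g w * scaleDensity d k ‖w‖ := by
  rw [tailDensity, scaleDensity, mul_left_comm]
  refine mul_le_mul_of_nonneg_left ?_ (by positivity)
  have hs := h.sigma_nonneg
  have hm := h.mass_nonneg ‖w‖
  rcases le_or_gt ‖w‖ 1 with h1 | h1
  · nlinarith [hg.le_one w h1, hg.half_le w h1]
  · rw [h.total _ h1.le]
    nlinarith [mul_nonneg hs (hg0 w)]

lemma measurable_tailDensity (h : IsRadialProfile d σ c C k) {g : Rd d → ℝ} (hgm : Measurable g) :
    Measurable (tailDensity d σ k g) :=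
  (measurable_norm.pow_const d).inv.mul
    (((hgm.sub measurable_const).const_mul σ).add (h.measurable_mass.comp measurable_norm))

lemma measurable_errorDensity (h : IsRadialProfile d σ c C k) {g : Rd d → ℝ}
    (hgm : Measurable g) : Measurable (errorDensity d σ k g) :=
  (measurable_norm.pow_const d).inv.mul
    ((measurable_const.sub (h.measurable_mass.comp measurable_norm)).mul
      (measurable_const.sub hgm))

lemma IsSmallScale.tailDensity_div_le (h : IsRadialProfile d σ c C k) {g : Rd d → ℝ}
    (hg : IsSmallScale d σ c g) (hg0 : ∀ w, 0 ≤ g w) (w : Rd d) :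
    tailDensity d σ k g w / ((1 + ‖w‖ ^ 2) ^ 2 * g w)
      ≤ 2 * (scaleDensity d k ‖w‖ / (1 + ‖w‖ ^ 2) ^ 2) := by
  have hF := h.scaleDensity_nonneg (norm_nonneg w)
  rcases (hg0 w).eq_or_lt with h0 | h0
  · rw [← h0, mul_zero, div_zero]
    positivity
  · rw [div_le_iff₀ (by positivity)]
    refine (hg.tailDensity_le h hg0 w).trans (le_of_eq ?_)
    field_simp

/-- Since `g ≥ 1/2` in the unit ball, a zero of `g` lies outside, where the density is `σ g /
|w|^d`. Division by `|p̂|²` therefore loses nothing at the zeros of `p̂`. -/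
lemma IsSmallScale.tailDensity_eq_zero (h : IsRadialProfile d σ c C k) {g : Rd d → ℝ}
    (hg : IsSmallScale d σ c g) {w : Rd d} (h0 : g w = 0) : tailDensity d σ k g w = 0 := by
  have h1 : 1 < ‖w‖ := by
    by_contra! h1
    have := hg.half_le w h1
    rw [h0] at this
    norm_num at this
  rw [tailDensity, h0, h.total _ h1.le]
  ring

lemma IsSmallScale.integrable_tailDensity_div (hd : 1 ≤ d) (h : IsRadialProfile d σ c C k)
    {g : Rd d → ℝ} (hg : IsSmallScale d σ c g) (hg0 : ∀ w, 0 ≤ g w) (hgm : Measurable g) :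
    Integrable fun w => tailDensity d σ k g w / ((1 + ‖w‖ ^ 2) ^ 2 * g w) := by
  refine ((h.integrable_scaleDensity_div hd).const_mul 2).mono' ?_ (ae_of_all _ fun w => ?_)
  · exact ((measurable_tailDensity h hgm).div
      (Measurable.mul (by fun_prop) hgm)).aestronglyMeasurable
  · have h1 := hg.tailDensity_nonneg h hg0 hd w
    have h2 := hg0 w
    rw [Real.norm_of_nonneg (by positivity)]
    exact hg.tailDensity_div_le h hg0 w

lemma IsSmallScale.integrable_tailDensity (hd : 1 ≤ d) (h : IsRadialProfile d σ c C k)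
    {g : Rd d → ℝ} (hg : IsSmallScale d σ c g) (hg0 : ∀ w, 0 ≤ g w) (hgm : Measurable g) {M : ℝ}
    (hM : ∀ w, (1 + ‖w‖ ^ 2) ^ 2 * g w ≤ M) : Integrable (tailDensity d σ k g) := by
  have hint := hg.integrable_tailDensity_div hd h hg0 hgm
  refine (hint.const_mul M).mono' (measurable_tailDensity h hgm).aestronglyMeasurable
    (ae_of_all _ fun w => ?_)
  have h1 := hg.tailDensity_nonneg h hg0 hd w
  rw [Real.norm_of_nonneg h1]
  rcases (hg0 w).eq_or_lt with h0 | h0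
  · rw [hg.tailDensity_eq_zero h h0.symm, zero_div, mul_zero]
  · rw [← mul_div_assoc, le_div_iff₀ (by positivity), mul_comm]
    exact mul_le_mul_of_nonneg_right (hM w) h1

/-- The smooth stationary field with the tail density. -/
lemma IsSmallScale.exists_tail_field {Ω : Type*} [MeasurableSpace Ω] {P : Measure Ω}
    [IsProbabilityMeasure P] (hd : 1 ≤ d) (h : IsRadialProfile d σ c C k) {g : Rd d → ℝ}
    (hg : IsSmallScale d σ c g) (hg0 : ∀ w, 0 ≤ g w) (hgm : Measurable g) {p : Rd d → ℝ}
    (hp : ContDiff ℝ ∞ p) (hpc : HasCompactSupport p)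
    (hpg : ∀ w, ‖fourierHat p w‖ ^ 2 = (1 + ‖w‖ ^ 2) ^ 2 * g w)
    (I : Lp ℂ 2 (volume : Measure (Rd d)) →ₗᵢ[ℝ] Lp ℝ 2 P)
    (hI : IsCentredGaussian (fun h => (I h : Ω → ℝ)) (fun h h' => inner ℝ h h') P) :
    Integrable (tailDensity d σ k g) ∧
    ∃ Y : Rd d → Ω → ℝ, (∀ x, Measurable (Y x)) ∧ (∀ o, ContDiff ℝ ∞ fun x => Y x o) ∧
      IsCentredGaussian Y
        (fun x y => ∫ w, tailDensity d σ k g w * Real.cos (inner ℝ w (x - y))) P := by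
  refine ⟨hg.integrable_tailDensity hd h hg0 hgm (M := (∫ x, ‖p x‖) ^ 2) fun w => ?_,
    exists_smooth_field_of_density I hI hp hpc (hg.tailDensity_nonneg h hg0 hd) (fun w hw => ?_) ?_⟩
  · rw [← hpg]
    exact pow_le_pow_left₀ (norm_nonneg _) (norm_fourierHat_le p w) 2
  · have h1 := hpg w
    rw [hw, norm_zero, zero_pow two_ne_zero, eq_comm, mul_eq_zero] at h1
    exact hg.tailDensity_eq_zero h (h1.resolve_left (by positivity))
  · simp_rw [hpg]
    exact hg.integrable_tailDensity_div hd h hg0 hgm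

/-- Outside the unit ball `σ - m` vanishes. Inside, `s ≤ 1` keeps `s w` in the ball, so `σ (1 -
g(sw)) ≤ c s^d |w|^d`; the power of `|w|` cancels the prefactor and leaves the small factor `s^d`.
-/
lemma IsSmallScale.errorDensity_bounds (h : IsRadialProfile d σ c C k) (hc : 0 ≤ c) {g : Rd d → ℝ}
    (hg : IsSmallScale d σ c g) {s : ℝ} (hs0 : 0 < s) (hs1 : s ≤ 1) (w : Rd d) :
    0 ≤ errorDensity d σ k (fun w => g (s • w)) w ∧
    errorDensity d σ k (fun w => g (s • w)) w
      ≤ (Metric.closedBall (0 : Rd d) 1).indicator (fun _ => c * s ^ d) w := by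
  rcases le_or_gt ‖w‖ 1 with h1 | h1
  · rw [indicator_of_mem (by simpa using h1)]
    have hsw : ‖s • w‖ = s * ‖w‖ := by rw [norm_smul, Real.norm_of_nonneg hs0.le]
    have hsw1 : ‖s • w‖ ≤ 1 := by
      rw [hsw]
      exact mul_le_one₀ hs1 (norm_nonneg _) h1
    have h2 := hg.le_one _ hsw1
    have h3 := hg.defect _ hsw1
    have h4 := h.mass_le ‖w‖
    have h5 := h.mass_nonneg ‖w‖
    rw [hsw, mul_pow] at h3
    rw [errorDensity]
    refine ⟨mul_nonneg (by positivity) (mul_nonneg (by linarith) (by linarith)), ?_⟩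
    have h6 : (σ - radialMass d k ‖w‖) * (1 - g (s • w)) ≤ c * s ^ d * ‖w‖ ^ d := by
      nlinarith
    rcases (pow_nonneg (norm_nonneg w) d).eq_or_lt with h0 | h0
    · rw [← h0, inv_zero, zero_mul]
      positivity
    · rwa [inv_mul_le_iff₀ h0, mul_comm (‖w‖ ^ d)]
  · rw [indicator_of_notMem (by simpa using h1), errorDensity, h.total _ h1.le]
    simp

lemma integrable_indicator_closedBall (r b : ℝ) :
    Integrable ((Metric.closedBall (0 : Rd d) r).indicator fun _ => b) :=
  (integrable_indicator_iff Metric.isClosed_closedBall.measurableSet).2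
    (integrableOn_const measure_closedBall_lt_top.ne)

lemma IsSmallScale.integrable_errorDensity (h : IsRadialProfile d σ c C k) (hc : 0 ≤ c)
    {g : Rd d → ℝ} (hg : IsSmallScale d σ c g) (hgm : Measurable g) {s : ℝ} (hs0 : 0 < s)
    (hs1 : s ≤ 1) : Integrable (errorDensity d σ k fun w => g (s • w)) := by
  refine (integrable_indicator_closedBall 1 (c * s ^ d)).mono'
    (measurable_errorDensity h (hgm.comp (measurable_const_smul s))).aestronglyMeasurable
    (ae_of_all _ fun w => ?_)
  obtain ⟨h1, h2⟩ := hg.errorDensity_bounds h hc hs0 hs1 w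
  rwa [Real.norm_of_nonneg h1]

lemma IsSmallScale.integral_errorDensity_le (h : IsRadialProfile d σ c C k) (hc : 0 ≤ c)
    {g : Rd d → ℝ} (hg : IsSmallScale d σ c g) (hgm : Measurable g) {s : ℝ} (hs0 : 0 < s)
    (hs1 : s ≤ 1) :
    ∫ w, errorDensity d σ k (fun w => g (s • w)) w
      ≤ volume.real (Metric.closedBall (0 : Rd d) 1) * (c * s ^ d) := by
  refine (integral_mono (hg.integrable_errorDensity h hc hgm hs0 hs1)
    (integrable_indicator_closedBall 1 (c * s ^ d))
    fun w => (hg.errorDensity_bounds h hc hs0 hs1 w).2).trans (le_of_eq ?_)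
  rw [integral_indicator Metric.isClosed_closedBall.measurableSet, setIntegral_const, smul_eq_mul]

/-- The smooth stationary field with the error density. -/
lemma IsSmallScale.exists_error_field {Ω : Type*} [MeasurableSpace Ω] {P : Measure Ω}
    [IsProbabilityMeasure P] (h : IsRadialProfile d σ c C k) (hc : 0 ≤ c) {g : Rd d → ℝ}
    (hg : IsSmallScale d σ c g) (hgm : Measurable g) {p : Rd d → ℝ}
    (hp : ContDiff ℝ ∞ p) (hpc : HasCompactSupport p)
    (hpg : ∀ w, ‖fourierHat p w‖ ^ 2 = (1 + ‖w‖ ^ 2) ^ 2 * g w)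
    (I : Lp ℂ 2 (volume : Measure (Rd d)) →ₗᵢ[ℝ] Lp ℝ 2 P)
    (hI : IsCentredGaussian (fun h => (I h : Ω → ℝ)) (fun h h' => inner ℝ h h') P)
    {s : ℝ} (hs0 : 0 < s) (hs1 : s ≤ 1) :
    ∃ Y : Rd d → Ω → ℝ, (∀ x, Measurable (Y x)) ∧ (∀ o, ContDiff ℝ ∞ fun x => Y x o) ∧
      IsCentredGaussian Y
        (fun x y => ∫ w, errorDensity d σ k (fun w => g (s • w)) w
          * Real.cos (inner ℝ w (x - y))) P := by
  have hb := hg.errorDensity_bounds h hc hs0 hs1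
  -- The error density is supported in the unit ball, where `p̂` is bounded away from zero. One test
  -- function `p` therefore works for all `s`.
  have hball : ∀ w : Rd d, ‖w‖ ≤ 1 → 1 / 2 ≤ ‖fourierHat p w‖ ^ 2 := by
    intro w hw
    have h1 := hg.half_le w hw
    have h2 : 1 ≤ (1 + ‖w‖ ^ 2) ^ 2 := one_le_pow₀ (by nlinarith [sq_nonneg ‖w‖])
    rw [hpg]
    nlinarith
  have hout : ∀ w : Rd d, 1 < ‖w‖ → errorDensity d σ k (fun w => g (s • w)) w = 0 := by
    intro w hw
    rw [errorDensity, h.total _ hw.le]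
    simp
  refine exists_smooth_field_of_density I hI hp hpc (fun w => (hb w).1) (fun w hw => ?_) ?_
  · refine hout w ?_
    by_contra! h1
    have := hball w h1
    rw [hw] at this
    norm_num at this
  · refine ((hg.integrable_errorDensity h hc hgm hs0 hs1).const_mul 2).mono' ?_
      (ae_of_all _ fun w => ?_)
    · exact ((measurable_errorDensity h (hgm.comp (measurable_const_smul s))).div
        ((continuous_fourierHat (hp.continuous.integrable_of_hasCompactSupport
          hpc)).norm.pow 2).measurable).aestronglyMeasurable
    · have h1 := (hb w).1
      rw [Real.norm_of_nonneg (by positivity)]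
      rcases le_or_gt ‖w‖ 1 with h2 | h2
      · have h3 := hball w h2
        rw [div_le_iff₀ (by linarith)]
        nlinarith
      · rw [hout w h2]
        simp

end Densities

/-! ### Choice of the scale, decomposition of the covariance, and assembly -/

section Decomposition

variable {d : ℕ}

/-- A sufficiently small mollification scale. -/
lemma exists_smallScale (hd : 1 ≤ d) {ρ : Rd d → ℝ} (hA1 : AssumptionA1 ρ)
    (hA2 : AssumptionA2 ρ) {c : ℝ} (hc : 0 < c) :
    ∃ a ∈ Ioo (0 : ℝ) 1, ∀ σ : ℝ, 0 ≤ σ →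
      IsSmallScale d σ (c * σ) fun w => ‖fourierHat ρ (a • w)‖ ^ 2 := by
  obtain ⟨r, ⟨hr0, hr1⟩, C, hC, hb⟩ := exists_mollifier_bounds hd hA1 hA2
  -- The bound `r` keeps `a w` where the mollifier estimates hold. The bound `c / C` gives `C a^d ≤
  -- C a ≤ c`, so the defect of the mollifier stays below the lower mass bound of (K3).
  have ha0 : 0 < min r (c / C) := by positivity
  have ha1 : min r (c / C) < 1 := (min_le_left _ _).trans_lt hr1
  refine ⟨min r (c / C), ⟨ha0, ha1⟩, fun σ hσ => ?_⟩
  set a := min r (c / C) with ha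
  have hnorm : ∀ w : Rd d, ‖a • w‖ = a * ‖w‖ := fun w => by
    rw [norm_smul, Real.norm_of_nonneg ha0.le]
  have hle : ∀ w : Rd d, ‖w‖ ≤ 1 → ‖a • w‖ ≤ r := fun w hw => by
    rw [hnorm]
    exact (mul_le_of_le_one_right ha0.le hw).trans (min_le_left _ _)
  refine ⟨fun w hw => (hb _ (hle w hw)).1, fun w hw => (hb _ (hle w hw)).2.1, fun w hw => ?_⟩
  have h1 := (hb _ (hle w hw)).2.2
  rw [hnorm, mul_pow] at h1
  have h2 : C * a ^ d ≤ c := by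
    have h3 : a ^ d ≤ a := pow_le_of_le_one ha0.le ha1.le (by omega)
    have h4 : a ≤ c / C := min_le_right _ _
    rw [le_div_iff₀ hC] at h4
    nlinarith
  have h5 : C * (a ^ d * ‖w‖ ^ d) ≤ c * ‖w‖ ^ d := by
    rw [← mul_assoc]
    exact mul_le_mul_of_nonneg_right h2 (by positivity)
  calc σ * (1 - ‖fourierHat ρ (a • w)‖ ^ 2) ≤ σ * (c * ‖w‖ ^ d) :=
        mul_le_mul_of_nonneg_left (h1.trans h5) hσ
    _ = c * σ * ‖w‖ ^ d := by ring

lemma IsSmallScale.covariance_decomposition (hd : 1 ≤ d) {σ c C : ℝ} {k : ℝ → ℝ}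
    (h : IsRadialProfile d σ c C k) (hc : 0 ≤ c) {g : Rd d → ℝ} (hg : IsSmallScale d σ c g)
    (hgm : Measurable g) (ht : Integrable (tailDensity d σ k g)) {t : ℝ} (ht0 : 0 ≤ t)
    (x y : Rd d) :
    ∫ w, g (Real.exp (-t) • w) * scaleDensity d k ‖w‖ * Real.cos (inner ℝ w (x - y))
      = (∫ w : Rd d, truncatedDensity d k t ‖w‖ * Real.cos (inner ℝ w (x - y)))
        + (∫ w, tailDensity d σ k g w
            * Real.cos (inner ℝ w (Real.exp t • x - Real.exp t • y)))
        + ∫ w, errorDensity d σ k (fun w => g (Real.exp (-t) • w)) w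
            * Real.cos (inner ℝ w (x - y)) := by
  have hs := Real.exp_pos (-t)
  have hs1 : Real.exp (-t) ≤ 1 := Real.exp_le_one_iff.2 (by linarith)
  have hinv : Real.exp t = (Real.exp (-t))⁻¹ := by rw [Real.exp_neg, inv_inv]
  have hcos : ∀ {f : Rd d → ℝ}, Integrable f →
      Integrable fun w => f w * Real.cos (inner ℝ w (x - y)) := fun hf => by
    simpa only [mul_comm] using integrable_cos_inner_mul hf (x - y)
  have h1 := hcos (h.integrable_truncatedDensity hd ht0)
  have h2 := hcos ((ht.comp_smul hs.ne').const_mul (Real.exp (-t) ^ d))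
  have h3 := hcos (hg.integrable_errorDensity h hc hgm hs hs1)
  have h12 : Integrable fun w : Rd d => truncatedDensity d k t ‖w‖ * Real.cos (inner ℝ w (x - y))
      + Real.exp (-t) ^ d * tailDensity d σ k g (Real.exp (-t) • w)
        * Real.cos (inner ℝ w (x - y)) := h1.add h2
  rw [← smul_sub, hinv, ← integral_tailDensity_scale hs, ← integral_add h1 h2,
    ← integral_add h12 h3]
  refine integral_congr_ae ?_
  filter_upwards [IsRadialProfile.ae_norm_pos hd] with w hw
  rw [density_decomposition (σ := σ) rfl hw, add_mul, add_mul]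

lemma IsWhiteNoise.starFiltrationTop_le {Ω : Type*} [m : MeasurableSpace Ω] {P : Measure Ω}
    {ξ : Lp ℝ 2 (spaceTime d) → Ω → ℝ} (hξ : IsWhiteNoise ξ P) (Kb : Rd d → ℝ) :
    starFiltrationTop Kb ξ ≤ m :=
  iSup₂_le fun _ _ => iSup₂_le fun _ _ =>
    (measurable_pi_lambda _ fun _ => hξ.measurable_wienerIntegral _).comap_le

lemma indep_comap_snd_comap_fst {Ω₁ Ω₂ : Type*} {m₁ : MeasurableSpace Ω₁}
    {m₂ : MeasurableSpace Ω₂} (P₁ : Measure Ω₁) (P₂ : Measure Ω₂) [IsProbabilityMeasure P₁]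
    [IsProbabilityMeasure P₂] :
    Indep (m₂.comap Prod.snd) (m₁.comap Prod.fst) (P₁.prod P₂) :=
  (indepFun_prod (μ := P₁) (ν := P₂) measurable_id measurable_id).symm

end Decomposition

theorem propositionA (d : ℕ) (hd : 1 ≤ d) (ρ K : Rd d → ℝ)
    (hA1 : AssumptionA1 ρ) (hA2 : AssumptionA2 ρ)
    (hK1 : AssumptionK1 K) (hK2 : AssumptionK2 K) (hK3 : AssumptionK3 K) :
    ∃ a ∈ Ioo (0 : ℝ) 1,
      ∀ Kb : Rd d → ℝ, IsConvolutionRoot Kb K →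
      ∀ (Ω : Type u) [MeasurableSpace Ω] (P : Measure Ω) [IsProbabilityMeasure P]
        (ξ : Lp ℝ 2 (spaceTime d) → Ω → ℝ), IsWhiteNoise ξ P →
      -- an extension `(Ω', P')` of the probability space, with projection `π`
      ∃ (Ω' : Type u) (_ : MeasurableSpace Ω') (P' : Measure Ω') (_ : IsProbabilityMeasure P')
        (π : Ω' → Ω) (_ : MeasurePreserving π P' P)
        (W : Rd d → Ω' → ℝ) (Z : ℝ → Rd d → Ω' → ℝ),
        IsSmoothStationaryGaussianField W P' ∧
        HasDecayingCorrelations W P' ∧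
        Indep (fieldSigma W) ((starFiltrationTop Kb ξ).comap π) P' ∧
        (∀ ε ∈ Ioo (0 : ℝ) a,
          IsSmoothStationaryGaussianField (Z (Real.log (a / ε))) P' ∧
          iIndepFun (β := fun _ : Fin 3 => Rd d → ℝ)
            ![fun w x => martingaleApprox Kb ξ (Real.log (a / ε)) x (π w),
              fun w x => W (Real.exp (Real.log (a / ε)) • x) w,
              fun w x => Z (Real.log (a / ε)) x w] P' ∧
          IdentDistrib
            (fun w x => convApprox ρ Kb ξ ε x w)
            (fun w x => martingaleApprox Kb ξ (Real.log (a / ε)) x (π w)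
              + W (Real.exp (Real.log (a / ε)) • x) w + Z (Real.log (a / ε)) x w)
            P P') ∧
        ∀ x, Tendsto (fun ε : ℝ => ∫ w, Z (Real.log (a / ε)) x w ^ 2 ∂P') (𝓝[>] 0) (𝓝 0) := by
  obtain ⟨Khat, hF, hs, c, hc, C, hC, hb⟩ := hK3
  obtain ⟨a, ⟨ha0, ha1⟩, hsmall⟩ := exists_smallScale hd hA1 hA2 hc
  refine ⟨a, ⟨ha0, ha1⟩, fun Kb hKb Ω _ P _ ξ hξ => ?_⟩
  obtain ⟨k, hk, hki, hK⟩ :=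
    -- The root enters here, to give nonnegativity of `Khat`. The constant `a` has already been
    -- fixed from `ρ` and the lower mass bound `c` alone.
    exists_radialProfile hd hF hK1 hs (hKb.fourier_nonneg hK1.one hF) hb
  have hsphere := sphereConst_pos hd
  set σ : ℝ := (d * volume.real (Metric.ball (0 : Rd d) 1))⁻¹ with hσ
  have hσ0 : 0 ≤ σ := hk.sigma_nonneg
  rw [div_eq_mul_inv, ← hσ] at hk
  have hcσ : 0 ≤ c * σ := mul_nonneg hc.le hσ0
  have hg := hsmall σ hσ0
  have hρi : Integrable ρ := hA1.smooth.continuous.integrable_of_hasCompactSupport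
    hA1.compactSupport
  set g : Rd d → ℝ := fun w => ‖fourierHat ρ (a • w)‖ ^ 2 with hgdef
  have hg0 : ∀ w, 0 ≤ g w := fun w => sq_nonneg _
  have hgm : Measurable g :=
    (((continuous_fourierHat hρi).comp (continuous_const_smul a)).norm.pow 2).measurable
  -- The test function is `p = (1 - Δ) ρ_a`. The factor `g` in `|p̂|²` matches the one in the tail
  -- density, and `(1 + |w|²)²` supplies the decay that makes the quotient integrable.
  obtain ⟨p, hp, hpc, hpρ⟩ := exists_fourierHat_one_add_sq (contDiff_rescale hA1.smooth a)
    (hasCompactSupport_rescale hA1.compactSupport ha0)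
  have hpg : ∀ w, ‖fourierHat p w‖ ^ 2 = (1 + ‖w‖ ^ 2) ^ 2 * g w := fun w => by
    rw [hpρ, fourierHat_rescale ρ ha0, norm_mul, mul_pow, Complex.norm_real, Real.norm_eq_abs,
      sq_abs]
  obtain ⟨Ω₂, _, P₂, _, I, hI⟩ :=
    exists_gaussian_isometry (Lp ℂ 2 (volume : Measure (Rd d)))
  obtain ⟨htail, W, hWm, hWs, hW⟩ := hg.exists_tail_field hd hk hg0 hgm hp hpc hpg I hI
  have hZ' : ∀ t : ℝ, ∃ Y : Rd d → Ω₂ → ℝ, 0 < t → (∀ x, Measurable (Y x)) ∧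
      (∀ o, ContDiff ℝ ∞ fun x => Y x o) ∧ IsCentredGaussian Y
        (fun x y => ∫ w, errorDensity d σ k (fun w => g (Real.exp (-t) • w)) w
          * Real.cos (inner ℝ w (x - y))) P₂ := by
    intro t
    by_cases ht : 0 < t
    · obtain ⟨Y, hY⟩ := hg.exists_error_field hk hcσ hgm hp hpc hpg I hI (Real.exp_pos (-t))
        (Real.exp_le_one_iff.2 (by linarith))
      exact ⟨Y, fun _ => hY⟩
    · exact ⟨fun _ _ => 0, fun h => absurd h ht⟩
  choose Z hZ using hZ'
  have htime : ∀ ε ∈ Ioo (0 : ℝ) a, 0 < Real.log (a / ε) ∧ Real.exp (-Real.log (a / ε)) = ε / a := by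
    intro ε hε
    have hpos : 0 < a / ε := div_pos ha0 hε.1
    refine ⟨Real.log_pos ((one_lt_div hε.1).2 hε.2), ?_⟩
    rw [Real.exp_neg, Real.exp_log hpos, inv_div]
  -- The white noise, `W` and the family `Z` each use their own factor. All `Z t` may share one
  -- factor, because nothing is claimed about their joint law across different times.
  let P' : Measure (Ω × Ω₂ × Ω₂) := P.prod (P₂.prod P₂)
  have h1 : MeasurePreserving (Prod.fst : Ω × Ω₂ × Ω₂ → Ω) P' P := measurePreserving_fst
  have h2 : MeasurePreserving (fun w : Ω × Ω₂ × Ω₂ => w.2.1) P' P₂ :=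
    measurePreserving_fst.comp measurePreserving_snd
  have h3 : MeasurePreserving (fun w : Ω × Ω₂ × Ω₂ => w.2.2) P' P₂ :=
    measurePreserving_snd.comp measurePreserving_snd
  have hW' := hW.measurePreserving h2
  have hZG := fun (t : ℝ) (ht : 0 < t) => ((hZ t ht).2.2).measurePreserving h3
  have hZm := fun (t : ℝ) (ht : 0 < t) (x : Rd d) => ((hZ t ht).1 x).comp h3.measurable
  refine ⟨Ω × Ω₂ × Ω₂, inferInstance, P', inferInstance, Prod.fst, h1,
    fun x w => W x w.2.1, fun t x w => Z t x w.2.2, ?_, ?_, ?_, ?_, ?_⟩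
  · exact IsCentredGaussian.isSmoothStationary
      (γ := fun v => ∫ w, tailDensity d σ k g w * Real.cos (inner ℝ w v)) hW'
      (fun x => (hWm x).comp h2.measurable) fun o => hWs o.2.1
  · exact IsCentredGaussian.hasDecayingCorrelations htail hW'
  · refine indep_of_indep_of_le_left (indep_of_indep_of_le_right
      (indep_comap_snd_comap_fst P (P₂.prod P₂))
      (MeasurableSpace.comap_mono (hξ.starFiltrationTop_le Kb))) ?_
    have hm : Measurable fun (o : Ω₂ × Ω₂) (x : Rd d) => W x o.1 :=
      measurable_pi_lambda _ fun x => (hWm x).comp measurable_fst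
    change MeasurableSpace.comap ((fun (o : Ω₂ × Ω₂) (x : Rd d) => W x o.1) ∘
      (Prod.snd : Ω × Ω₂ × Ω₂ → Ω₂ × Ω₂)) MeasurableSpace.pi ≤ _
    rw [← MeasurableSpace.comap_comp]
    exact MeasurableSpace.comap_mono hm.comap_le
  · intro ε hε
    obtain ⟨ht0, hexp⟩ := htime ε hε
    set t := Real.log (a / ε) with ht
    have hindep : iIndepFun (β := fun _ : Fin 3 => Rd d → ℝ)
        ![fun (w : Ω × Ω₂ × Ω₂) x => martingaleApprox Kb ξ t x w.1,
          fun w x => W (Real.exp t • x) w.2.1, fun w x => Z t x w.2.2] P' :=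
      iIndepFun_prod_three P P₂ P₂ (fun w x => martingaleApprox Kb ξ t x w)
        (fun w x => W (Real.exp t • x) w) fun w x => Z t x w
    refine ⟨?_, hindep, ?_⟩
    · exact IsCentredGaussian.isSmoothStationary
        (γ := fun v => ∫ w, errorDensity d σ k (fun w => g (Real.exp (-t) • w)) w
          * Real.cos (inner ℝ w v)) (hZG t ht0) (hZm t ht0) fun o => (hZ t ht0).2.1 o.2.2
    · have hX := (hξ.isCentredGaussian_martingaleApprox hd hk hKb hK1 hK
        ht0.le).measurePreserving h1
      have hsum := hX.add_three (hW'.comp_right fun x => Real.exp t • x) (hZG t ht0) hindep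
      have hconv := hξ.isCentredGaussian_convApprox hd hk hKb hK1 hki hK hA1.smooth
        hA1.compactSupport hε.1
      -- The choice `e^{-t} = ε / a` is what makes the dilated `g` the multiplier of the mollifier
      -- at scale `ε`.
      have hgε : ∀ w, g (Real.exp (-t) • w) = ‖fourierHat ρ (ε • w)‖ ^ 2 := fun w => by
        simp only [hgdef]
        rw [hexp, smul_smul, mul_div_cancel₀ _ ha0.ne']
      simp only [← hg.covariance_decomposition hd hk hcσ hgm htail ht0.le] at hsum
      simp only [hgε] at hsum
      refine hconv.identDistrib hsum (fun x => hξ.measurable_wienerIntegral _) fun x => ?_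
      exact (((hξ.measurable_wienerIntegral _).comp h1.measurable).add
        ((hWm _).comp h2.measurable)).add (hZm t ht0 x)
  · intro x
    have hlim : Tendsto (fun ε : ℝ => volume.real (Metric.closedBall (0 : Rd d) 1)
        * (c * σ * (ε / a) ^ d)) (𝓝[>] 0) (𝓝 0) := by
      have hcont : Continuous fun ε : ℝ => volume.real (Metric.closedBall (0 : Rd d) 1)
        * (c * σ * (ε / a) ^ d) := by fun_prop
      have := (hcont.tendsto 0).mono_left (nhdsWithin_le_nhds (s := Ioi 0))
      simpa [show d ≠ 0 by omega] using this
    refine tendsto_of_tendsto_of_tendsto_of_le_of_le' tendsto_const_nhds hlim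
      (Eventually.of_forall fun ε => integral_nonneg fun w => sq_nonneg _) ?_
    filter_upwards [Ioo_mem_nhdsGT ha0] with ε hε
    obtain ⟨ht0, hexp⟩ := htime ε hε
    -- The variance is the total mass of the error density, of order `(ε/a)^d`, which tends to zero
    -- because `d ≥ 1`.
    have hvar := (hZG _ ht0).covariance x x
    simp only [sub_self, inner_zero_right, Real.cos_zero, mul_one] at hvar
    simp_rw [sq]
    rw [hvar, ← hexp]
    exact hg.integral_errorDensity_le hk hcσ hgm (Real.exp_pos _)
      (Real.exp_le_one_iff.2 (by linarith))
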